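/- Let $\mathcal Y,\mathcal Z$ be finite alphabets, let $W_{Y|X}$ (legitimate receiver) and $W_{Z|X}$ (warden) be binary-input discrete memoryless channels, $P_a=W_{Y|X=a}$, $Q_a=W_{Z|X=a}$ ($a\in\{0,1\}$), with $P_1\ll P_0$, $Q_1\ll Q_0$, $Q_1\ne Q_0$, and let $\delta>0$. All logarithms are natural; $D(\cdot\|\cdot)$ is relative entropy, $\chi_2(p\|r)=\sum (p-r)^2/r$, and $\chi_2:=\chi_2(Q_1\|Q_0)$. *Super channel.* For $q\ge1$ put $m=2^q$. A vector $x_{1:q}\in\{0,1\}^q$ is mapped to the PPM symbol of length $m$ whose only $1$ is at position $1+\sum_i x_i2^{i-1}$, and this symbol is sent over $m$ channel uses; $\widetilde Y,\widetilde Z$ are the outputs. For i.i.d. uniform $X_1,\dots,X_q$ let $I^Y_i=I(X_i;\widetilde Y|X_{i+1:q})$ and $I^Z_i=I(X_i;\widetilde Z|X_{i+1:q})$. *Rates.* For $\varepsilon>0$, $B\ge1$ put $\ell=\lfloor 2m\delta/(B\chi_2)\rfloor$ and $$R_{U,i}=\min(I^Y_i-\tfrac{\varepsilon}{q},\,I^Z_i+\tfrac{\varepsilon}{q}),\quad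 R_{V,i}=\max(0,\,I^Y_i-I^Z_i-\tfrac{2\varepsilon}{q}),\quad R_{K,i}=\max(0,\,I^Z_i-I^Y_i+\tfrac{2\varepsilon}{q}).$$ In each block, level $i$ carries $\max(0,\lfloor \ell R_{U,i}/\log 2\rfloor)$ message bits $u_i$, $\lfloor \ell R_{V,i}/\log 2\rfloor$ secret message bits $v_i$, and uses $\lceil \ell R_{K,i}/\log 2\rceil$ key bits $k_i$ (a level with $R_{U,i}\le 0$ carries no $u_i$). Let $b_V,b_K$ be the total numbers of secret message bits and of key bits per block. *Code.* For each level a binary codebook $(u_i,v_i,k_i)\mapsto \mathbf x_i\in\{0,1\}^\ell$ has all its codewords independent and uniform; the same codebooks are used in all $B$ blocks. The secret message bits of a block, aggregated over the levels, serve as key bits of the next block, completed by $(b_K-b_V)^+$ fresh key bits if they are too few. The shared key thus consists of $b_K+(B-1)(b_K-b_V)^+$ bits. For $0<\tau<\varepsilon/2$, the receiver decodes a block to the unique message $(u,v)$ for which $\log\frac{\widetilde W^{\ell}(\widetilde{\mathbf y}|\mathbf x_{1:q})}{P(\widetilde{\mathbf y}|\mathbf x_{S^c})}>\ell\,(I(X_S;\widetilde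 Y|X_{S^c})-\tau/q)$ for all $S\subseteq\{1,\dots,q\}$ (to a fixed message if there is no such unique message), block after block, forming the key of each block after the first from the secret message decoded in the block before. Messages and shared key are uniform. Let $P_{\rm err}$ be the probability that at least one of the $B$ blocks is decoded wrongly, $P_{\mathbf Z}$ the distribution of the warden's observation of all $n=Bm\ell$ channel uses, $M$ the total number of messages (of all blocks, $u$ and $v$) and $K$ the number of shared keys. *Claim.* (1) For all $0<\tau<\varepsilon/2$ and $B\ge1$: (a) for all large $q$, $\;\mathbb E[P_{\rm err}]\le Bm\,(e^{-2\ell\tau^2/q^4}+2^{-\ell\tau/q})$, the expectation being over the random codebooks; (b) there is a constant $A$ such that for every $\eta>0$ and all large $q$, with probability at least $1-\eta$ the random codebook satisfies both $P_{\rm err}\le\eta$ and $D(P_{\mathbf Z}\|Q_0^{\otimes Bm\ell})\le\delta+A/m$; (c) for every $\eta>0$ and all large $q$, $$\frac{\log M}{\sqrt{n\delta}}\ge\sqrt{\tfrac{2}{\chi_2}}\,\bigl(D(P_1\|P_0)-\varepsilon\bigr)-\eta,$$ $$\frac{\log K}{\sqrt{n\delta}}\le\sqrt{\tfrac{2}{\chi_2}}\Bigl(\tfrac{B-1}{B}\bigl(D(Q_1\|Q_0)-D(P_1\|P_0)+2\varepsilon\bigr)^++\tfrac{D(Q_1\|Q_0)+2\varepsilon}{B}\Bigr)+\eta.$$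 (2) For every $\zeta>0$ there are $\varepsilon_0>0$ and $B_0$ such that for all $0<\varepsilon\le\varepsilon_0$, all $B\ge B_0$ and all large $q$, $\frac{\log M}{\sqrt{n\delta}}$ is within $\zeta$ of $\sqrt{2/\chi_2}\,D(P_1\|P_0)$ and $\frac{\log K}{\sqrt{n\delta}}$ is within $\zeta$ of $\sqrt{2/\chi_2}\,(D(Q_1\|Q_0)-D(P_1\|P_0))^+$. -/

import Mathlib

open scoped ENNReal

noncomputable section

namespace MLCPPM

/-! ### Relative entropy and chi-square divergence of distributions on finite alphabets -/

/-- The measure on a finite alphabet (with its discrete sigma-algebra) whose mass function is `p`. -/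
def pmfMeasure {α : Type*} [Fintype α] (p : α → ℝ) : @MeasureTheory.Measure α ⊤ :=
  letI : MeasurableSpace α := ⊤
  ∑ a, ENNReal.ofReal (p a) • MeasureTheory.Measure.dirac a

/-- Relative entropy `D(p ‖ r)` in nats. -/
def relEntropy {α : Type*} [Fintype α] (p r : α → ℝ) : ℝ≥0∞ :=
  @InformationTheory.klDiv α ⊤ (pmfMeasure p) (pmfMeasure r)

/-- `χ₂(p ‖ r) = ∑ (p - r)² / r`. -/
def chiTwo {α : Type*} [Fintype α] (p r : α → ℝ) : ℝ :=
  ∑ a, (p a - r a) ^ 2 / r a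

/-! ### The PPM super channel

A binary-input discrete memoryless channel is a family `W : Fin 2 → Y → ℝ`, `W a y` being the
probability of the output `y` when `a` is sent.  Level `i + 1` of the multilevel scheme has index
`i : Fin q`. -/

/-- The PPM symbol of order `2 ^ q` whose only `1` stands at the position with binary expansion `x`,
the least significant bit being the one of index `0`. -/
def ppmSymbol {q : ℕ} (x : Fin q → Fin 2) : Fin (2 ^ q) → Fin 2 :=
  Pi.single (finFunctionFinEquiv x) 1

/-- The super channel `W̃(y | x₁, …, x_q)`: the PPM symbol of `x` is sent over `2 ^ q` uses of `W`. -/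
def superChannel {Y : Type*} (W : Fin 2 → Y → ℝ) {q : ℕ} (x : Fin q → Fin 2)
    (y : Fin (2 ^ q) → Y) : ℝ :=
  ∏ t, W (ppmSymbol x t) (y t)

/-- `P(y | x_C)` for uniform independent level inputs: the mean of `W̃(y | x')` over the inputs `x'`
that agree with `x` on `C`. -/
def condOutput {Y : Type*} (W : Fin 2 → Y → ℝ) {q : ℕ} (C : Finset (Fin q)) (x : Fin q → Fin 2)
    (y : Fin (2 ^ q) → Y) : ℝ :=
  (∑ x' : Fin q → Fin 2 with ∀ i ∈ C, x' i = x i, superChannel W x' y) / 2 ^ Cᶜ.card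

/-- `I(X_A ; Ỹ | X_C)` in nats (for disjoint `A`, `C`), `X₁, …, X_q` uniform and independent: the
expectation of `log (P(Ỹ | X_A, X_C) / P(Ỹ | X_C))`. -/
def condMutualInfo {Y : Type*} [Fintype Y] (W : Fin 2 → Y → ℝ) {q : ℕ} (A C : Finset (Fin q)) : ℝ :=
  (∑ x : Fin q → Fin 2, ∑ y : Fin (2 ^ q) → Y,
    superChannel W x y * Real.log (condOutput W (A ∪ C) x y / condOutput W C x y)) / 2 ^ q

/-- `I(X_i ; Ỹ | X_{i+1:q})`. -/
def levelInfo {Y : Type*} [Fintype Y] (W : Fin 2 → Y → ℝ) {q : ℕ} (i : Fin q) : ℝ :=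
  condMutualInfo W {i} (Finset.Ioi i)

/-! ### Multistage-decoding rates (in nats per PPM symbol) and numbers of bits -/

/-- Rate of the non-secret messages `U_i`. -/
def rateU {Y Z : Type*} [Fintype Y] [Fintype Z] (P : Fin 2 → Y → ℝ) (Q : Fin 2 → Z → ℝ) (ε : ℝ)
    {q : ℕ} (i : Fin q) : ℝ :=
  min (levelInfo P i - ε / q) (levelInfo Q i + ε / q)

/-- Rate of the secret messages `V_i`. -/
def rateV {Y Z : Type*} [Fintype Y] [Fintype Z] (P : Fin 2 → Y → ℝ) (Q : Fin 2 → Z → ℝ) (ε : ℝ)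
    {q : ℕ} (i : Fin q) : ℝ :=
  max 0 (levelInfo P i - levelInfo Q i - 2 * ε / q)

/-- Rate of the keys `K_i`. -/
def rateK {Y Z : Type*} [Fintype Y] [Fintype Z] (P : Fin 2 → Y → ℝ) (Q : Fin 2 → Z → ℝ) (ε : ℝ)
    {q : ℕ} (i : Fin q) : ℝ :=
  max 0 (levelInfo Q i - levelInfo P i + 2 * ε / q)

/-- Numbers of bits, per level and per block, of `U_i`, `V_i` and `K_i`. -/
structure LevelBits (q : ℕ) where
  U : Fin q → ℕ
  V : Fin q → ℕ
  K : Fin q → ℕ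

/-- The numbers of bits that the rates give for code length `ℓ`.  Message bits are rounded down
(`⌊·⌋₊` is `0` on negative reals: a level with negative `rateU` carries no message), key bits up. -/
def mlcBits {Y Z : Type*} [Fintype Y] [Fintype Z] (P : Fin 2 → Y → ℝ) (Q : Fin 2 → Z → ℝ) (ε : ℝ)
    (q ℓ : ℕ) : LevelBits q where
  U i := ⌊ℓ * rateU P Q ε i / Real.log 2⌋₊
  V i := ⌊ℓ * rateV P Q ε i / Real.log 2⌋₊
  K i := ⌈ℓ * rateK P Q ε i / Real.log 2⌉₊

/-! ### One block: codebooks, encoding and decoding -/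

/-- One binary string per level, of length `n i` at level `i`. -/
abbrev Strings {q : ℕ} (n : Fin q → ℕ) : Type := (i : Fin q) → Fin (n i) → Fin 2

/-- The messages `w = (u, v)` of one block. -/
abbrev Message {q : ℕ} (b : LevelBits q) : Type := Strings b.U × Strings b.V

/-- For each level a binary codebook `(u_i, v_i, k_i) ↦ x_i ∈ {0,1}^ℓ`. -/
abbrev Codebook {q : ℕ} (b : LevelBits q) (ℓ : ℕ) : Type :=
  (i : Fin q) → (Fin (b.U i) → Fin 2) → (Fin (b.V i) → Fin 2) → (Fin (b.K i) → Fin 2) →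
    Fin ℓ → Fin 2

/-- The codewords `x₁(u₁, v₁, k₁), …, x_q(u_q, v_q, k_q)`. -/
def encode {q ℓ : ℕ} {b : LevelBits q} (c : Codebook b ℓ) (w : Message b) (k : Strings b.K) :
    Fin q → Fin ℓ → Fin 2 :=
  fun i => c i (w.1 i) (w.2 i) (k i)

/-- `ℓ` uses of the super channel. -/
def blockChannel {Y : Type*} (W : Fin 2 → Y → ℝ) {q ℓ : ℕ} (x : Fin q → Fin ℓ → Fin 2)
    (y : Fin ℓ → Fin (2 ^ q) → Y) : ℝ :=
  ∏ s, superChannel W (fun i => x i s) (y s)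

/-- The decoding set: for all `S`, the log-likelihood ratio of `W̃(y | x)` and `P(y | x_{Sᶜ})`
exceeds `γ_S = ℓ (I(X_S ; Ỹ | X_{Sᶜ}) - τ / q)` (written without the logarithm). -/
def IsTypical {Y : Type*} [Fintype Y] (W : Fin 2 → Y → ℝ) (τ : ℝ) {q ℓ : ℕ}
    (x : Fin q → Fin ℓ → Fin 2) (y : Fin ℓ → Fin (2 ^ q) → Y) : Prop :=
  ∀ S : Finset (Fin q),
    Real.exp (ℓ * (condMutualInfo W S Sᶜ - τ / q)) *
      ∏ s, condOutput W Sᶜ (fun i => x i s) (y s) < blockChannel W x y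

open Classical in
/-- Decoder of one block with key `k`: the unique message whose codewords lie in the decoding set
with `y`; an arbitrary fixed message if there is none or more than one. -/
def decode {Y : Type*} [Fintype Y] (W : Fin 2 → Y → ℝ) (τ : ℝ) {q ℓ : ℕ} {b : LevelBits q}
    (c : Codebook b ℓ) (k : Strings b.K) (y : Fin ℓ → Fin (2 ^ q) → Y) : Message b :=
  if h : ∃! w : Message b, IsTypical W τ (encode c w k) y then h.choose else 0

/-! ### Chaining over `N + 1` blocks -/

/-- The key of a block from the secret message `v` of the block before: all levels are aggregated,
the bits of `v` are taken as key bits in order, and, if they are too few, fresh bits `f` complete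
the key. -/
def nextKey {q : ℕ} {b : LevelBits q} (v : Strings b.V)
    (f : Fin ((∑ i, b.K i) - ∑ i, b.V i) → Fin 2) : Strings b.K :=
  fun i a =>
    if h : (finSigmaFinEquiv ⟨i, a⟩ : Fin (∑ i, b.K i)).val < ∑ i, b.V i then
      v (finSigmaFinEquiv.symm ⟨(finSigmaFinEquiv ⟨i, a⟩ : Fin (∑ i, b.K i)).val, h⟩).1
        (finSigmaFinEquiv.symm ⟨(finSigmaFinEquiv ⟨i, a⟩ : Fin (∑ i, b.K i)).val, h⟩).2
    else
      f ⟨(finSigmaFinEquiv ⟨i, a⟩ : Fin (∑ i, b.K i)).val - ∑ i, b.V i, by omega⟩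

/-- The secret key shared in advance: the key of the first block, and the fresh key bits of each of
the `N` others. -/
abbrev SharedKey {q : ℕ} (b : LevelBits q) (N : ℕ) : Type :=
  Strings b.K × (Fin N → Fin ((∑ i, b.K i) - ∑ i, b.V i) → Fin 2)

/-- The messages of all blocks. -/
abbrev ChainMessage {q : ℕ} (b : LevelBits q) (N : ℕ) : Type := Fin (N + 1) → Message b

/-- The keys of all blocks. -/
def chainKeys {q N : ℕ} {b : LevelBits q} (w : ChainMessage b N) (s : SharedKey b N) :
    Fin (N + 1) → Strings b.K :=
  Fin.cases s.1 fun j => nextKey (w j.castSucc).2 (s.2 j)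

/-- The probability of the output `y` of all blocks, given messages and shared key. -/
def chainChannel {Y : Type*} (W : Fin 2 → Y → ℝ) {q ℓ N : ℕ} {b : LevelBits q} (c : Codebook b ℓ)
    (w : ChainMessage b N) (s : SharedKey b N) (y : Fin (N + 1) → Fin ℓ → Fin (2 ^ q) → Y) : ℝ :=
  ∏ j, blockChannel W (encode c (w j) (chainKeys w s j)) (y j)

/-- Block after block, the receiver decodes with the key formed from the secret message that he
decoded in the block before. -/
def chainDecode {Y : Type*} [Fintype Y] (W : Fin 2 → Y → ℝ) (τ : ℝ) {q ℓ N : ℕ} {b : LevelBits q}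
    (c : Codebook b ℓ) (s : SharedKey b N) (y : Fin (N + 1) → Fin ℓ → Fin (2 ^ q) → Y) :
    ChainMessage b N :=
  fun j => Fin.induction (motive := fun _ => Message b) (decode W τ c s.1 (y 0))
    (fun j w => decode W τ c (nextKey w.2 (s.2 j)) (y j.succ)) j

/-- Probability that some block is decoded wrongly, for uniform messages and shared key. -/
def errorProb {Y : Type*} [Fintype Y] (W : Fin 2 → Y → ℝ) (τ : ℝ) {q ℓ : ℕ} {b : LevelBits q}
    (c : Codebook b ℓ) (N : ℕ) : ℝ :=
  (∑ w : ChainMessage b N, ∑ s : SharedKey b N,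
    ∑ y : Fin (N + 1) → Fin ℓ → Fin (2 ^ q) → Y,
      if chainDecode W τ c s y = w then 0 else chainChannel W c w s y) /
    (Fintype.card (ChainMessage b N) * Fintype.card (SharedKey b N))

/-- Distribution of the warden's observation `Z` of all blocks, for uniform messages and shared
key. -/
def outputLaw {Z : Type*} (W : Fin 2 → Z → ℝ) {q ℓ : ℕ} {b : LevelBits q} (c : Codebook b ℓ)
    (N : ℕ) (z : Fin (N + 1) → Fin ℓ → Fin (2 ^ q) → Z) : ℝ :=
  (∑ w : ChainMessage b N, ∑ s : SharedKey b N, chainChannel W c w s z) /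
    (Fintype.card (ChainMessage b N) * Fintype.card (SharedKey b N))

/-- The innocent distribution: the symbol `0` is sent in all `(N + 1) ℓ 2 ^ q` channel uses. -/
def innocentLaw {Z : Type*} (W : Fin 2 → Z → ℝ) {q ℓ N : ℕ}
    (z : Fin (N + 1) → Fin ℓ → Fin (2 ^ q) → Z) : ℝ :=
  ∏ j, ∏ s, ∏ t, W 0 (z j s t)

/-! ### Random codebooks and throughputs -/

/-- Probability of an event when all codewords are independent and uniform on `{0,1}^ℓ`, that is,
when the codebook is uniform. -/
def codebookProb {q ℓ : ℕ} {b : LevelBits q} (E : Codebook b ℓ → Prop) : ℝ :=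
  Nat.card {c : Codebook b ℓ // E c} / Fintype.card (Codebook b ℓ)

/-- Expectation over the uniform codebook. -/
def codebookMean {q ℓ : ℕ} {b : LevelBits q} (f : Codebook b ℓ → ℝ) : ℝ :=
  (∑ c, f c) / Fintype.card (Codebook b ℓ)

/-- Number of PPM symbols per block: `ℓ = ⌊2 m δ / (B χ₂(Q₁ ‖ Q₀))⌋`, `m = 2 ^ q`, `B = N + 1`. -/
def blockLength {Z : Type*} [Fintype Z] (Q : Fin 2 → Z → ℝ) (δ : ℝ) (N q : ℕ) : ℕ :=
  ⌊2 * 2 ^ q * δ / ((N + 1) * chiTwo (Q 1) (Q 0))⌋₊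

/-- `log M / √(n δ)` for a set of `M` messages and `n = (N + 1) 2 ^ q ℓ` channel uses. -/
def msgThroughput {q : ℕ} (b : LevelBits q) (δ : ℝ) (N ℓ : ℕ) : ℝ :=
  Real.log (Fintype.card (ChainMessage b N)) / √((N + 1) * 2 ^ q * ℓ * δ)

/-- `log K / √(n δ)` for a set of `K` shared keys and `n = (N + 1) 2 ^ q ℓ` channel uses. -/
def keyThroughput {q : ℕ} (b : LevelBits q) (δ : ℝ) (N ℓ : ℕ) : ℝ :=
  Real.log (Fintype.card (SharedKey b N)) / √((N + 1) * 2 ^ q * ℓ * δ)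

end MLCPPM

end

/-! The level inputs are independent, so `C ↦ -H(Ỹ | X_C)`, called `meanLog`, is supermodular
(`meanLog_supermodular`). Along the chain of levels this gives, for every set `S` of levels, `I(X_S;
Ỹ) ≤ ∑_{i ∈ S} I_i ≤ I(X_S; Ỹ | X_{Sᶜ})`, with equality when `S` contains all levels
(`le_sum_levelInfo`, `sum_levelInfo_le`, `sum_univ_levelInfo`). The right inequality, for the
receiver, is the family of joint decoding constraints of a multiple-access code; the left one, for
the warden, is the family of resolvability constraints. Rates chosen level by level therefore
satisfy both families.

Reliability. A PPM symbol differs from the zero word in one position, so the log-likelihood ratios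
of the decoder have range `q log 2 + O(1) ≤ q`, and Hoeffding's inequality with a union bound over
`S` controls atypical outputs. Wrong messages are grouped by the levels where they differ
(`sum_exp_agree_le`). An error in the chain implies an error of a decoder that is given the true key
of each block (`errorProb_le`).

Resolvability. For each secret message `v` of a block, the output law averaged over `u` and the key
is `L¹`-close to the law for uniform inputs, by a second moment computation on a truncated channel
(`expect_sq_flatKeyedLaw_sub_le`). The warden's output is thus almost independent of `v`, which may
serve as the next key; that key is exactly uniform (`expect_nextKey`), and an induction over the
blocks adds up the errors (`sum_abs_outputLaw_sub_le`).

Covertness. Relative entropy is continuous enough to pass to the product law (`kl_outputLaw_le`).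
For one PPM symbol, a fourth-order expansion gives divergence at most `χ₂ / (2 m) + O(m⁻²)`
(`exists_kl_meanLaw_le`), and the block length turns this into `δ + O(1 / m)`. As `ℓ` grows like `2
^ q`, the factors `exp (-a ℓ / q ^ 4)` beat all powers of `2 ^ q`; Markov's inequality then finds
codebooks that are reliable and covert at once.

Throughputs. The total information is `D(W 1 ‖ W 0)` minus the divergence of one PPM symbol, which
vanishes; `B ℓ / √(n δ)` tends to `√(2 / χ₂)`, and rounding to bits costs only `O(q)`. -/

open scoped ENNReal

noncomputable section

namespace MLCPPM

open Finset
open scoped BigOperators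

/-! ### Resampling of coordinates -/

section Resample

set_option linter.unusedSectionVars false

variable {ι α : Type*} [Fintype ι] [DecidableEq ι] [Fintype α] [Nonempty α]

/-- The conditional mean of `f` given the coordinates in `C`, under the uniform distribution. -/
def resample (C : Finset ι) (f : (ι → α) → ℝ) (x : ι → α) : ℝ :=
  𝔼 x', f (C.piecewise x x')

/-- Exchanging the coordinates outside `C` between two independent uniform strings is an involution
on pairs, so it preserves their joint law. -/
lemma expect_expect_piecewise_swap (C : Finset ι) (g : (ι → α) → (ι → α) → ℝ) :
    𝔼 x, 𝔼 x', g (C.piecewise x x') (C.piecewise x' x) = 𝔼 x, 𝔼 x', g x x' := by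
  have h := Fintype.expect_bijective (fun p : (ι → α) × (ι → α) =>
      (C.piecewise p.1 p.2, C.piecewise p.2 p.1))
    (Function.Involutive.bijective (by
      rintro ⟨x, x'⟩
      ext i <;> by_cases hi : i ∈ C <;> simp [hi]))
    (fun p => g (C.piecewise p.1 p.2) (C.piecewise p.2 p.1)) (fun p => g p.1 p.2) (fun p => rfl)
  rw [← univ_product_univ, expect_product, expect_product] at h
  exact h

lemma expect_expect_piecewise (C : Finset ι) (g : (ι → α) → ℝ) :
    𝔼 x, 𝔼 x', g (C.piecewise x x') = 𝔼 x, g x := by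
  rw [expect_expect_piecewise_swap C (fun x _ => g x)]
  simp

@[simp] lemma resample_univ (f : (ι → α) → ℝ) : resample univ f = f := by
  ext x; simp [resample]

@[simp] lemma resample_empty (f : (ι → α) → ℝ) (x : ι → α) : resample ∅ f x = 𝔼 x', f x' := by
  simp [resample]

/-- Independence of the coordinates makes conditional expectations commute. Supermodularity of
`meanLog` rests on this identity. -/
lemma resample_resample (A B : Finset ι) (f : (ι → α) → ℝ) :
    resample A (resample B f) = resample (A ∩ B) f := by
  ext x
  unfold resample
  -- The fresh string of the right side is composed of two strings along `B`, to match the two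
  -- resamplings on the left.
  rw [← expect_expect_piecewise B (fun z => f ((A ∩ B).piecewise x z))]
  refine Finset.expect_congr rfl fun x' _ => Finset.expect_congr rfl fun x'' _ => ?_
  congr 1
  ext i
  by_cases hA : i ∈ A <;> by_cases hB : i ∈ B <;> simp [hA, hB]

/-- Self-adjointness of conditional expectation: after the swap outside `C`, the two factors trade
the strings at which they are evaluated. -/
lemma expect_resample_mul (C : Finset ι) (f g : (ι → α) → ℝ) :
    𝔼 x, resample C f x * g x = 𝔼 x, f x * resample C g x := by
  unfold resample
  simp_rw [expect_mul, mul_expect]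
  rw [← expect_expect_piecewise_swap C (fun x x' => f x * g (C.piecewise x x'))]
  refine Finset.expect_congr rfl fun x _ => Finset.expect_congr rfl fun x' _ => ?_
  congr 2
  ext i
  by_cases hA : i ∈ C <;> simp [hA]

lemma expect_resample (C : Finset ι) (f : (ι → α) → ℝ) :
    𝔼 x, resample C f x = 𝔼 x, f x := expect_expect_piecewise C f

lemma resample_congr {C : Finset ι} (f : (ι → α) → ℝ) {x y : ι → α} (h : ∀ i ∈ C, x i = y i) :
    resample C f x = resample C f y := by
  unfold resample
  refine Finset.expect_congr rfl fun x' _ => ?_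
  congr 1
  ext i
  by_cases hA : i ∈ C <;> simp [hA, h]

lemma resample_mul_of_congr {C : Finset ι} {f g : (ι → α) → ℝ}
    (hg : ∀ x y, (∀ i ∈ C, x i = y i) → g x = g y) (x : ι → α) :
    resample C (fun x => f x * g x) x = resample C f x * g x := by
  unfold resample
  rw [expect_mul]
  refine Finset.expect_congr rfl fun x' _ => ?_
  simp only [hg (C.piecewise x x') x fun i hi => by simp [hi]]

lemma resample_nonneg {C : Finset ι} {f : (ι → α) → ℝ} (hf : ∀ x, 0 ≤ f x) (x : ι → α) :
    0 ≤ resample C f x := expect_nonneg fun _ _ => hf _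

lemma le_card_mul_expect {β : Type*} [Fintype β] {f : β → ℝ} (hf : ∀ x, 0 ≤ f x) (x : β) :
    f x ≤ Fintype.card β * 𝔼 y, f y := by
  rw [Fintype.card_mul_expect]
  exact single_le_sum (fun y _ => hf y) (mem_univ x)

/-- The string `x` itself is among those averaged over. For level inputs this yields the factor `2 ^
q` in all upper bounds on likelihood ratios. -/
lemma le_card_mul_resample (C : Finset ι) {f : (ι → α) → ℝ} (hf : ∀ x, 0 ≤ f x) (x : ι → α) :
    f x ≤ Fintype.card (ι → α) * resample C f x := by
  have := le_card_mul_expect (f := fun x' => f (C.piecewise x x')) (fun _ => hf _) x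
  have hx : C.piecewise x x = x := by ext i; simp [piecewise]
  rwa [hx] at this

lemma resample_pos (C : Finset ι) {f : (ι → α) → ℝ} (hf : ∀ x, 0 ≤ f x) {x : ι → α}
    (hx : 0 < f x) : 0 < resample C f x := by
  have h1 := le_card_mul_resample C hf x
  have h2 : (0 : ℝ) ≤ resample C f x := resample_nonneg hf x
  rcases h2.lt_or_eq with h | h
  · exact h
  · rw [← h] at h1; simp at h1; linarith

lemma resample_sum {β : Type*} (s : Finset β) (C : Finset ι) (f : β → (ι → α) → ℝ) (x : ι → α) :
    resample C (fun x => ∑ y ∈ s, f y x) x = ∑ y ∈ s, resample C (f y) x := by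
  unfold resample; rw [expect_sum_comm]

/-- The mean over the strings that agree with `x` on `C`. -/
lemma resample_eq_sum_filter [DecidableEq α] (C : Finset ι) (f : (ι → α) → ℝ) (x : ι → α) :
    resample C f x =
      (∑ x' with ∀ i ∈ C, x' i = x i, f x') / (Fintype.card α : ℝ) ^ Cᶜ.card := by
  have hcard : ∀ x' : ι → α, (∀ i ∈ C, x' i = x i) →
      #{z : ι → α | C.piecewise x z = x'} = Fintype.card α ^ C.card := by
    intro x' hx'
    have : ({z : ι → α | C.piecewise x z = x'} : Finset (ι → α)) =
        Fintype.piFinset fun i => if i ∈ C then univ else {x' i} := by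
      ext z
      simp only [mem_filter, mem_univ, true_and, Fintype.mem_piFinset, funext_iff]
      refine forall_congr' fun i => ?_
      by_cases hi : i ∈ C <;> simp [hi, hx']
    rw [this, Fintype.card_piFinset]
    simp [apply_ite Finset.card]
  have hsum : ∑ z, f (C.piecewise x z) =
      (Fintype.card α : ℝ) ^ C.card * ∑ x' with ∀ i ∈ C, x' i = x i, f x' := by
    rw [← sum_fiberwise_of_maps_to (s := univ) (t := {x' | ∀ i ∈ C, x' i = x i})
      (g := fun z => C.piecewise x z) (fun z _ => by simp +contextual), mul_sum]
    refine sum_congr rfl fun x' hx' => ?_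
    rw [sum_congr rfl (g := fun _ => f x') (fun z hz => by rw [(mem_filter.1 hz).2]), sum_const,
      hcard x' (mem_filter.1 hx').2]
    simp
  have hα : (Fintype.card α : ℝ) ≠ 0 := by simp
  rw [resample, Fintype.expect_eq_sum_div_card, hsum, Fintype.card_fun, ← card_add_card_compl C,
    Nat.cast_pow, pow_add, mul_div_mul_left _ _ (pow_ne_zero _ hα)]

lemma expect_mul_of_congr {C : Finset ι} {f g : (ι → α) → ℝ}
    (hg : ∀ x y, (∀ i ∈ C, x i = y i) → g x = g y) :
    𝔼 x, f x * g x = 𝔼 x, resample C f x * g x := by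
  rw [← expect_resample C fun x => f x * g x]
  exact Finset.expect_congr rfl fun x _ => resample_mul_of_congr hg x

end Resample

/-! ### Mutual informations of a channel with uniform inputs -/

section Info

set_option linter.unusedSectionVars false

variable {ι α 𝒴 : Type*} [Fintype ι] [DecidableEq ι] [Fintype α] [Nonempty α] [Fintype 𝒴]

/-- A channel: a family of probability mass functions. -/
structure IsChannel {X 𝒴 : Type*} [Fintype 𝒴] (V : X → 𝒴 → ℝ) : Prop where
  nonneg : ∀ x y, 0 ≤ V x y
  sum_eq_one : ∀ x, ∑ y, V x y = 1

/-- `P(y | x_C)` for the channel `V` with uniform inputs. -/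
def condLaw (V : (ι → α) → 𝒴 → ℝ) (C : Finset ι) (x : ι → α) (y : 𝒴) : ℝ :=
  resample C (fun x => V x y) x

/-- The mean of `log P(Y | X_C)`, that is, minus the conditional entropy of `Y` given `X_C`. -/
def meanLog (V : (ι → α) → 𝒴 → ℝ) (C : Finset ι) : ℝ :=
  𝔼 x, ∑ y, V x y * Real.log (condLaw V C x y)

variable {V : (ι → α) → 𝒴 → ℝ}

lemma condLaw_nonneg (hV : IsChannel V) (C : Finset ι) (x : ι → α) (y : 𝒴) :
    0 ≤ condLaw V C x y := resample_nonneg (fun _ => hV.nonneg _ _) _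

lemma condLaw_pos (hV : IsChannel V) (C : Finset ι) {x : ι → α} {y : 𝒴} (h : 0 < V x y) :
    0 < condLaw V C x y := resample_pos C (f := fun x => V x y) (fun _ => hV.nonneg _ _) h

lemma condLaw_congr (C : Finset ι) {x x' : ι → α} (h : ∀ i ∈ C, x i = x' i) (y : 𝒴) :
    condLaw V C x y = condLaw V C x' y := resample_congr _ h

@[simp] lemma condLaw_univ : condLaw V univ = V := by
  ext x y; simp [condLaw]

lemma isChannel_condLaw (hV : IsChannel V) (C : Finset ι) : IsChannel (condLaw V C) where
  nonneg := condLaw_nonneg hV C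
  sum_eq_one x := by
    unfold condLaw
    rw [← resample_sum]
    simp [hV.sum_eq_one, resample]

/-- Jensen's inequality in the form `log g ≤ g - 1`. Monotonicity and supermodularity of `meanLog`
are both instances, with `g` a ratio of conditional laws. -/
lemma expect_sum_mul_log_le (hV : IsChannel V) {g : (ι → α) → 𝒴 → ℝ}
    (hg : ∀ x y, 0 < V x y → 0 < g x y) (h : 𝔼 x, ∑ y, V x y * g x y ≤ 1) :
    𝔼 x, ∑ y, V x y * Real.log (g x y) ≤ 0 := by
  have h1 : 𝔼 x, ∑ y, V x y * Real.log (g x y) ≤ 𝔼 x, ∑ y, (V x y * g x y - V x y) := by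
    refine expect_le_expect fun x _ => sum_le_sum fun y _ => ?_
    rcases (hV.nonneg x y).lt_or_eq with hxy | hxy
    · nlinarith [Real.log_le_sub_one_of_pos (hg x y hxy)]
    · simp [← hxy]
  simp_rw [sum_sub_distrib, hV.sum_eq_one, expect_sub_distrib, Fintype.expect_const] at h1
  linarith

lemma meanLog_mono (hV : IsChannel V) {A B : Finset ι} (hAB : A ⊆ B) :
    meanLog V A ≤ meanLog V B := by
  have key := expect_sum_mul_log_le hV (g := fun x y => condLaw V A x y / condLaw V B x y)
    (fun x y h => div_pos (condLaw_pos hV A h) (condLaw_pos hV B h)) (by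
      calc 𝔼 x, ∑ y, V x y * (condLaw V A x y / condLaw V B x y)
          = ∑ y, 𝔼 x, condLaw V B x y * (condLaw V A x y / condLaw V B x y) := by
            rw [expect_sum_comm]
            refine sum_congr rfl fun y _ => expect_mul_of_congr fun x x' h => ?_
            rw [condLaw_congr B h, condLaw_congr A fun i hi => h i (hAB hi)]
        _ ≤ ∑ y, 𝔼 x, condLaw V A x y := by
            refine sum_le_sum fun y _ => expect_le_expect fun x _ => ?_
            rw [mul_div_left_comm]
            exact mul_le_of_le_one_right (condLaw_nonneg hV A x y) (div_self_le_one _)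
        _ = 1 := by
            rw [← expect_sum_comm]; simp [(isChannel_condLaw hV A).sum_eq_one])
  rw [← sub_nonpos, meanLog, meanLog, ← expect_sub_distrib]
  refine le_of_eq_of_le (Finset.expect_congr rfl fun x _ => ?_) key
  rw [← sum_sub_distrib]
  refine sum_congr rfl fun y _ => ?_
  rcases (hV.nonneg x y).lt_or_eq with h | h
  · rw [Real.log_div (condLaw_pos hV A h).ne' (condLaw_pos hV B h).ne']; ring
  · simp [← h]

/-- The ratio `P_A P_B / (P_{A ∪ B} P_{A ∩ B})` has mean at most one: conditioning on `X_{A ∪ B}`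
cancels the first factor of the denominator, self-adjointness moves the averaging of `P_A` onto `P_B
/ P_{A ∩ B}`, and averaging `P_B` given `X_A` returns `P_{A ∩ B}`. -/
lemma meanLog_supermodular (hV : IsChannel V) (A B : Finset ι) :
    meanLog V A + meanLog V B ≤ meanLog V (A ∪ B) + meanLog V (A ∩ B) := by
  have hI (y : 𝒴) {x x' : ι → α} (C : Finset ι) (hC : A ∩ B ⊆ C) (h : ∀ i ∈ C, x i = x' i) :
      condLaw V (A ∩ B) x y = condLaw V (A ∩ B) x' y :=
    condLaw_congr _ (fun i hi => h i (hC hi)) y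
  have key := expect_sum_mul_log_le hV
    (g := fun x y => condLaw V A x y * condLaw V B x y /
      (condLaw V (A ∪ B) x y * condLaw V (A ∩ B) x y))
    (fun x y h => div_pos (mul_pos (condLaw_pos hV A h) (condLaw_pos hV B h))
      (mul_pos (condLaw_pos hV _ h) (condLaw_pos hV _ h))) (by
      calc 𝔼 x, ∑ y, V x y * (condLaw V A x y * condLaw V B x y /
              (condLaw V (A ∪ B) x y * condLaw V (A ∩ B) x y))
          = ∑ y, 𝔼 x, condLaw V (A ∪ B) x y * (condLaw V A x y * condLaw V B x y /
              (condLaw V (A ∪ B) x y * condLaw V (A ∩ B) x y)) := by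
            rw [expect_sum_comm]
            refine sum_congr rfl fun y _ => expect_mul_of_congr fun x x' h => ?_
            rw [condLaw_congr (A ∪ B) h, hI y (A ∪ B) (inter_subset_union) h,
              condLaw_congr A fun i hi => h i (mem_union_left _ hi),
              condLaw_congr B fun i hi => h i (mem_union_right _ hi)]
        _ ≤ ∑ y, 𝔼 x, condLaw V A x y * (condLaw V B x y * (condLaw V (A ∩ B) x y)⁻¹) := by
            refine sum_le_sum fun y _ => expect_le_expect fun x _ => ?_
            have hA := condLaw_nonneg hV A x y
            have hB := condLaw_nonneg hV B x y
            have hI := condLaw_nonneg hV (A ∩ B) x y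
            rcases eq_or_ne (condLaw V (A ∪ B) x y) 0 with h | h
            · rw [h, zero_mul]; positivity
            · rw [← mul_div_assoc, mul_div_mul_left _ _ h, div_eq_mul_inv, mul_assoc]
        _ ≤ ∑ y, 𝔼 x, V x y := by
            refine sum_le_sum fun y _ => ?_
            unfold condLaw
            rw [expect_resample_mul]
            refine expect_le_expect fun x _ => mul_le_of_le_one_right (hV.nonneg x y) ?_
            rw [resample_mul_of_congr (fun x x' h => by
              rw [resample_congr _ fun i hi => h i (inter_subset_left hi)]), resample_resample]
            exact mul_inv_le_one
        _ = 1 := by rw [← expect_sum_comm]; simp [hV.sum_eq_one])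
  have : meanLog V A + meanLog V B - (meanLog V (A ∪ B) + meanLog V (A ∩ B)) ≤ 0 := by
    simp only [meanLog, ← expect_add_distrib, ← expect_sub_distrib, ← sum_add_distrib,
      ← sum_sub_distrib]
    refine le_of_eq_of_le (Finset.expect_congr rfl fun x _ => sum_congr rfl fun y _ => ?_) key
    rcases (hV.nonneg x y).lt_or_eq with h | h
    · have h1 := (condLaw_pos hV A h).ne'
      have h2 := (condLaw_pos hV B h).ne'
      have h3 := (condLaw_pos hV (A ∪ B) h).ne'
      have h4 := (condLaw_pos hV (A ∩ B) h).ne'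
      rw [Real.log_div (mul_ne_zero h1 h2) (mul_ne_zero h3 h4), Real.log_mul h1 h2,
        Real.log_mul h3 h4]
      ring
    · simp [← h]
  linarith

end Info

/-! ### Supermodular set functions along a chain -/

section Chain

set_option linter.unusedSectionVars false

variable {ι : Type*} [Fintype ι] [LinearOrder ι] [LocallyFiniteOrderTop ι] {F : Finset ι → ℝ}

/-- Elements are added in increasing order. For a new maximum `a`, supermodularity is used for `Ici
a` and the complement of `insert a S`: their union is `Sᶜ` and their intersection is `Ioi a`. -/
lemma sum_Ici_sub_Ioi_le (hF : ∀ A B, F A + F B ≤ F (A ∪ B) + F (A ∩ B)) (S : Finset ι) :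
    ∑ i ∈ S, (F (Ici i) - F (Ioi i)) ≤ F univ - F Sᶜ := by
  induction S using Finset.induction_on_max with
  | empty => simp
  | insert a S hS ih =>
    have ha : a ∉ S := fun h => lt_irrefl _ (hS a h)
    rw [sum_insert ha]
    have h := hF (Ici a) (insert a S)ᶜ
    have h1 : Ici a ∪ (insert a S)ᶜ = Sᶜ := by
      ext i
      simp only [mem_union, mem_Ici, mem_compl, mem_insert]
      constructor
      · rintro (h | h) hi
        · exact (hS i hi).not_ge h
        · exact h (Or.inr hi)
      · intro hi
        by_cases hia : i = a
        · exact Or.inl hia.ge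
        · exact Or.inr (by tauto)
    have h2 : Ici a ∩ (insert a S)ᶜ = Ioi a := by
      ext i
      simp only [mem_inter, mem_Ici, mem_compl, mem_insert, mem_Ioi]
      constructor
      · rintro ⟨h, h'⟩
        exact lt_of_le_of_ne h fun h'' => h' (Or.inl h''.symm)
      · intro h
        refine ⟨h.le, ?_⟩
        rintro (h' | h')
        · exact h.ne' h'
        · exact (hS i h').not_gt h
    rw [h1, h2] at h
    linarith

/-- Mirror image of the previous bound: elements are added in decreasing order, and the pair is
`insert a S` and `Ioi a`. -/
lemma le_sum_Ici_sub_Ioi (hF : ∀ A B, F A + F B ≤ F (A ∪ B) + F (A ∩ B)) (S : Finset ι) :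
    F S - F ∅ ≤ ∑ i ∈ S, (F (Ici i) - F (Ioi i)) := by
  induction S using Finset.induction_on_min with
  | empty => simp
  | insert a S hS ih =>
    have ha : a ∉ S := fun h => lt_irrefl _ (hS a h)
    rw [sum_insert ha]
    have h := hF (insert a S) (Ioi a)
    have h1 : insert a S ∪ Ioi a = Ici a := by
      ext i
      simp only [mem_union, mem_Ici, mem_insert, mem_Ioi]
      constructor
      · rintro ((h | h) | h)
        exacts [h.ge, (hS i h).le, h.le]
      · intro hi
        rcases hi.lt_or_eq with h | h
        exacts [Or.inr h, Or.inl (Or.inl h.symm)]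
    have h2 : insert a S ∩ Ioi a = S := by
      ext i
      simp only [mem_inter, mem_insert, mem_Ioi]
      constructor
      · rintro ⟨h | h, h'⟩
        · exact absurd h h'.ne'
        · exact h
      · intro h
        exact ⟨Or.inr h, hS i h⟩
    rw [h1, h2] at h
    linarith

lemma sum_univ_Ici_sub_Ioi (hF : ∀ A B, F A + F B ≤ F (A ∪ B) + F (A ∩ B)) :
    ∑ i, (F (Ici i) - F (Ioi i)) = F univ - F ∅ := by
  have h1 := sum_Ici_sub_Ioi_le hF univ
  have h2 := le_sum_Ici_sub_Ioi hF univ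
  rw [compl_univ] at h1
  exact le_antisymm h1 h2

end Chain

/-! ### Finite probability spaces as measures -/

section Measure

open MeasureTheory

variable {α : Type*} [Fintype α]

/-- `pmfMeasure` for an arbitrary sigma-algebra. -/
def sumDirac [MeasurableSpace α] (p : α → ℝ) : Measure α :=
  ∑ a, ENNReal.ofReal (p a) • Measure.dirac a

lemma sumDirac_apply [MeasurableSpace α] [DiscreteMeasurableSpace α] (p : α → ℝ) (s : Set α) :
    sumDirac p s = ∑ a, ENNReal.ofReal (p a) * s.indicator 1 a := by
  simp [sumDirac, Measure.finsetSum_apply]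

instance [MeasurableSpace α] (p : α → ℝ) : IsFiniteMeasure (sumDirac p) := by
  refine ⟨?_⟩
  simp [sumDirac, Measure.finsetSum_apply, ENNReal.sum_lt_top]

lemma isProbabilityMeasure_sumDirac [MeasurableSpace α] {p : α → ℝ} (hp : ∀ a, 0 ≤ p a)
    (h1 : ∑ a, p a = 1) : IsProbabilityMeasure (sumDirac p) := ⟨by
  simp [sumDirac, Measure.finsetSum_apply, ← ENNReal.ofReal_sum_of_nonneg fun a _ => hp a, h1]⟩

lemma integral_sumDirac [MeasurableSpace α] [DiscreteMeasurableSpace α] {p : α → ℝ}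
    (hp : ∀ a, 0 ≤ p a) (g : α → ℝ) : ∫ a, g a ∂(sumDirac p) = ∑ a, p a * g a := by
  rw [sumDirac, integral_finsetSum_measure fun a _ => (integrable_dirac (by simp)).smul_measure
    ENNReal.ofReal_ne_top]
  simp [integral_smul_measure, ENNReal.toReal_ofReal, hp]

lemma ae_sumDirac [MeasurableSpace α] [DiscreteMeasurableSpace α] {p : α → ℝ} {q : α → Prop}
    (h : ∀ a, 0 < p a → q a) : ∀ᵐ a ∂(sumDirac p), q a := by
  rw [ae_iff, sumDirac_apply]
  refine sum_eq_zero fun a _ => ?_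
  by_cases ha : 0 < p a
  · simp [h a ha]
  · simp [ENNReal.ofReal_of_nonpos (not_lt.1 ha)]

/-- Hoeffding's lemma on a finite probability space. -/
lemma sum_mul_exp_le {p : α → ℝ} (hp : ∀ a, 0 ≤ p a) (h1 : ∑ a, p a = 1) {f : α → ℝ} {a b : ℝ}
    (hf : ∀ x, 0 < p x → f x ∈ Set.Icc a b) (t : ℝ) :
    ∑ x, p x * Real.exp (t * (f x - ∑ x, p x * f x)) ≤ Real.exp (t ^ 2 * (b - a) ^ 2 / 8) := by
  let _ : MeasurableSpace α := ⊤
  have := isProbabilityMeasure_sumDirac hp h1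
  have h := (ProbabilityTheory.hasSubgaussianMGF_of_mem_Icc (μ := sumDirac p) (X := f)
    (measurable_of_finite f).aemeasurable (ae_sumDirac hf)).mgf_le t
  rw [ProbabilityTheory.mgf, integral_sumDirac hp, integral_sumDirac hp] at h
  refine h.trans_eq ?_
  congr 1
  simp only [NNReal.coe_pow, NNReal.coe_div, coe_nnnorm, Real.norm_eq_abs, NNReal.coe_ofNat,
    div_pow, sq_abs]
  ring

end Measure

/-! ### Products -/

section Product

variable {κ β : Type*} [Fintype κ] [DecidableEq κ] [Fintype β]

lemma expect_prod (f : κ → β → ℝ) : 𝔼 x : κ → β, ∏ s, f s (x s) = ∏ s, 𝔼 b, f s b := by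
  simp_rw [Fintype.expect_eq_sum_div_card]
  rw [← Fintype.prod_sum, prod_div_distrib]
  simp

lemma sum_prod (f : κ → β → ℝ) : ∑ x : κ → β, ∏ s, f s (x s) = ∏ s, ∑ b, f s b :=
  (Fintype.prod_sum _).symm

lemma expect_piComm {ι α : Type*} [Fintype ι] [DecidableEq ι] [Fintype α]
    (g : (ι → κ → α) → ℝ) : 𝔼 X, g X = 𝔼 X : κ → ι → α, g fun i s => X s i :=
  Fintype.expect_equiv (Equiv.piComm _) _ _ fun _ => rfl

end Product

/-! ### Block channels -/

section Block

set_option linter.unusedSectionVars false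

variable {ι α 𝒴 κ : Type*} [Fintype ι] [DecidableEq ι] [Fintype α] [Nonempty α] [Fintype 𝒴]
  [Fintype κ] [DecidableEq κ]

/-- Independent uses of the channel `V`, indexed by `κ`. -/
def block (V : (ι → α) → 𝒴 → ℝ) (X : ι → κ → α) (y : κ → 𝒴) : ℝ :=
  ∏ s, V (fun i => X i s) (y s)

variable {V : (ι → α) → 𝒴 → ℝ}

lemma isChannel_block (hV : IsChannel V) : IsChannel (block (κ := κ) V) where
  nonneg X y := prod_nonneg fun s _ => hV.nonneg _ _
  sum_eq_one X := by
    unfold block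
    rw [sum_prod fun s b => V (fun i => X i s) b]
    simp [hV.sum_eq_one]

lemma condLaw_block (C : Finset ι) (X : ι → κ → α) (y : κ → 𝒴) :
    condLaw (block V) C X y = ∏ s, condLaw V C (fun i => X i s) (y s) := by
  simp only [condLaw, resample, block]
  rw [expect_piComm, ← expect_prod fun s x' => V (C.piecewise (fun i => X i s) x') (y s)]
  refine Finset.expect_congr rfl fun X' _ => prod_congr rfl fun s _ => ?_
  congr 1
  ext i
  by_cases hi : i ∈ C <;> simp [hi]

lemma expect_sum_block_mul_prod (f : (ι → α) → 𝒴 → ℝ) :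
    𝔼 X : ι → κ → α, ∑ y, block V X y * ∏ s, f (fun i => X i s) (y s) =
      (𝔼 x, ∑ y, V x y * f x y) ^ Fintype.card κ := by
  rw [expect_piComm]
  simp only [block, ← prod_mul_distrib]
  rw [Finset.expect_congr rfl fun X _ => sum_prod fun s b => V (X s) b * f (X s) b,
    expect_prod fun _ x => ∑ b, V x b * f x b]
  simp

/-- Hoeffding's inequality for the lower tail of a sum over the uses of a channel with uniform
inputs. -/
lemma hoeffding_lower (hV : IsChannel V) {f : (ι → α) → 𝒴 → ℝ} {a b t : ℝ} (hab : a < b)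
    (hf : ∀ x y, 0 < V x y → f x y ∈ Set.Icc a b) (ht : 0 ≤ t) (q : (ι → κ → α) → (κ → 𝒴) → Prop)
    [∀ X y, Decidable (q X y)]
    (hq : ∀ X y, 0 < block V X y → q X y →
      ∑ s, f (fun i => X i s) (y s) ≤ Fintype.card κ * ((𝔼 x, ∑ y, V x y * f x y) - t)) :
    𝔼 X : ι → κ → α, ∑ y, (if q X y then block V X y else 0) ≤
      Real.exp (-(2 * Fintype.card κ * t ^ 2 / (b - a) ^ 2)) := by
  set μ := 𝔼 x, ∑ y, V x y * f x y with hμ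
  -- Minimizer of the Chernoff exponent `l ^ 2 (b - a) ^ 2 / 8 - l t`.
  set l : ℝ := 4 * t / (b - a) ^ 2 with hl
  have hba : 0 < b - a := sub_pos.2 hab
  have hl0 : 0 ≤ l := by positivity
  have hN : (0 : ℝ) < Fintype.card (ι → α) := by exact_mod_cast Fintype.card_pos
  have hoeff : 𝔼 x, ∑ y, V x y * Real.exp (-l * (f x y - μ)) ≤
      Real.exp (l ^ 2 * (b - a) ^ 2 / 8) := by
    have h := sum_mul_exp_le (α := (ι → α) × 𝒴) (p := fun z => V z.1 z.2 / Fintype.card (ι → α))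
      (fun z => div_nonneg (hV.nonneg _ _) hN.le)
      (by rw [Fintype.sum_prod_type]
          simp_rw [← sum_div, hV.sum_eq_one]
          simp)
      (f := fun z => f z.1 z.2) (a := a) (b := b)
      (fun z hz => hf _ _ (by
        by_contra h
        have h0 : V z.1 z.2 = 0 := le_antisymm (not_lt.1 h) (hV.nonneg _ _)
        simp [h0] at hz)) (-l)
    have e : ∀ g : (ι → α) → 𝒴 → ℝ, ∑ z : (ι → α) × 𝒴, V z.1 z.2 / Fintype.card (ι → α) * g z.1 z.2 =
        𝔼 x, ∑ y, V x y * g x y := by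
      intro g
      rw [Fintype.sum_prod_type, Fintype.expect_eq_sum_div_card, sum_div]
      refine sum_congr rfl fun x _ => ?_
      rw [sum_div]
      exact sum_congr rfl fun y _ => by ring
    rw [e f, e fun x y => Real.exp (-l * (f x y - μ))] at h
    simpa using h
  have key : ∀ X : ι → κ → α, ∀ y, (if q X y then block V X y else 0) ≤
      Real.exp (-(l * (Fintype.card κ * t))) *
        (block V X y * ∏ s, Real.exp (-l * (f (fun i => X i s) (y s) - μ))) := by
    intro X y
    have h0 := (isChannel_block (κ := κ) hV).nonneg X y
    split_ifs with h
    · rcases h0.lt_or_eq with hpos | hz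
      · rw [← Real.exp_sum, mul_left_comm, ← Real.exp_add]
        refine le_mul_of_one_le_right h0 (Real.one_le_exp ?_)
        rw [← mul_sum, sum_sub_distrib]
        have := hq X y hpos h
        simp only [sum_const, card_univ, nsmul_eq_mul]
        nlinarith
      · simp [← hz]
    · exact mul_nonneg (Real.exp_nonneg _) (mul_nonneg h0 (prod_nonneg fun _ _ => Real.exp_nonneg _))
  calc 𝔼 X : ι → κ → α, ∑ y, (if q X y then block V X y else 0)
      ≤ 𝔼 X : ι → κ → α, ∑ y, Real.exp (-(l * (Fintype.card κ * t))) *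
        (block V X y * ∏ s, Real.exp (-l * (f (fun i => X i s) (y s) - μ))) :=
        expect_le_expect fun X _ => sum_le_sum fun y _ => key X y
    _ = Real.exp (-(l * (Fintype.card κ * t))) *
          (𝔼 x, ∑ y, V x y * Real.exp (-l * (f x y - μ))) ^ Fintype.card κ := by
        simp_rw [← mul_sum, ← mul_expect]
        rw [expect_sum_block_mul_prod fun x y => Real.exp (-l * (f x y - μ))]
    _ ≤ Real.exp (-(l * (Fintype.card κ * t))) *
          Real.exp (l ^ 2 * (b - a) ^ 2 / 8) ^ Fintype.card κ := by
        gcongr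
        exact expect_nonneg fun x _ => sum_nonneg fun y _ =>
          mul_nonneg (hV.nonneg _ _) (Real.exp_nonneg _)
    _ = _ := by
        rw [← Real.exp_nat_mul, ← Real.exp_add, hl]
        congr 1
        field_simp
        ring

/-- Hoeffding's inequality for the upper tail. -/
lemma hoeffding_upper (hV : IsChannel V) {f : (ι → α) → 𝒴 → ℝ} {a b t : ℝ} (hab : a < b)
    (hf : ∀ x y, 0 < V x y → f x y ∈ Set.Icc a b) (ht : 0 ≤ t) (q : (ι → κ → α) → (κ → 𝒴) → Prop)
    [∀ X y, Decidable (q X y)]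
    (hq : ∀ X y, 0 < block V X y → q X y →
      Fintype.card κ * ((𝔼 x, ∑ y, V x y * f x y) + t) ≤ ∑ s, f (fun i => X i s) (y s)) :
    𝔼 X : ι → κ → α, ∑ y, (if q X y then block V X y else 0) ≤
      Real.exp (-(2 * Fintype.card κ * t ^ 2 / (b - a) ^ 2)) := by
  have h := hoeffding_lower hV (f := fun x y => -f x y) (neg_lt_neg hab)
    (fun x y hxy => ⟨neg_le_neg (hf x y hxy).2, neg_le_neg (hf x y hxy).1⟩) ht q (by
      intro X y h0 hX
      have := hq X y h0 hX
      simp only [mul_neg, sum_neg_distrib, expect_neg_distrib]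
      nlinarith)
  rwa [neg_sub_neg] at h

end Block

/-! ### Random codebooks -/

section Codebook

variable {q ℓ : ℕ} {b : LevelBits q}

/-- The codebook `c` with the codewords of `w` and `k` replaced by `X`. -/
def plant (c : Codebook b ℓ) (w : Message b) (k : Strings b.K) (X : Fin q → Fin ℓ → Fin 2) :
    Codebook b ℓ :=
  fun i u v k' => if u = w.1 i ∧ v = w.2 i ∧ k' = k i then X i else c i u v k'

@[simp] lemma encode_plant (c : Codebook b ℓ) (w : Message b) (k : Strings b.K)
    (X : Fin q → Fin ℓ → Fin 2) : encode (plant c w k X) w k = X := by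
  ext i : 1; simp [encode, plant]

lemma plant_plant_encode (c : Codebook b ℓ) (w : Message b) (k : Strings b.K)
    (X : Fin q → Fin ℓ → Fin 2) : plant (plant c w k X) w k (encode c w k) = c := by
  ext i u v k' : 4
  by_cases h : u = w.1 i ∧ v = w.2 i ∧ k' = k i
  · simp [plant, encode, h]
  · simp [plant, h]

/-- Exchanging the codewords of `w` and `k` with independent uniform ones is an involution, so
planting fresh codewords preserves the law of the codebook. -/
lemma expect_plant (w : Message b) (k : Strings b.K) (h : Codebook b ℓ → ℝ) :
    𝔼 c, h c = 𝔼 c, 𝔼 X, h (plant c w k X) := by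
  have e := Fintype.expect_bijective (fun p : Codebook b ℓ × (Fin q → Fin ℓ → Fin 2) =>
      (plant p.1 w k p.2, encode p.1 w k))
    (Function.Involutive.bijective (by
      rintro ⟨c, X⟩
      simp [plant_plant_encode]))
    (fun p => h (plant p.1 w k p.2)) (fun p => h p.1) (fun p => rfl)
  rw [← univ_product_univ, expect_product, expect_product] at e
  rw [e]
  simp

/-- The codewords of a message and a key are uniform. -/
lemma expect_encode (w : Message b) (k : Strings b.K) (g : (Fin q → Fin ℓ → Fin 2) → ℝ) :
    𝔼 c : Codebook b ℓ, g (encode c w k) = 𝔼 X, g X := by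
  rw [expect_plant w k]
  simp

/-- The codewords of two messages and keys coincide on the levels where these agree, and are
independent on the others. -/
lemma expect_encode_encode (w w' : Message b) (k k' : Strings b.K)
    (g : (Fin q → Fin ℓ → Fin 2) → (Fin q → Fin ℓ → Fin 2) → ℝ) (A : Finset (Fin q))
    (hA : ∀ i, i ∈ A ↔ w'.1 i = w.1 i ∧ w'.2 i = w.2 i ∧ k' i = k i) :
    𝔼 c : Codebook b ℓ, g (encode c w k) (encode c w' k') =
      𝔼 X, 𝔼 X', g X (A.piecewise X X') := by
  -- Planting `X'` for `w'` and `k'` overwrites the codewords of `w` and `k` exactly on the levels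
  -- in `A`.
  rw [expect_plant w' k', Finset.expect_comm]
  have h (X' : Fin q → Fin ℓ → Fin 2) : 𝔼 c : Codebook b ℓ,
      g (encode (plant c w' k' X') w k) (encode (plant c w' k' X') w' k') =
      𝔼 X, g (A.piecewise X' X) X' := by
    rw [← expect_encode w k fun X => g (A.piecewise X' X) X']
    refine Finset.expect_congr rfl fun c _ => ?_
    rw [encode_plant]
    congr 1
    ext i : 1
    by_cases hi : i ∈ A
    · have := (hA i).1 hi
      simp [encode, plant, hi, this]
    · have h' := hi
      rw [hA] at h'
      have : ¬ (w.1 i = w'.1 i ∧ w.2 i = w'.2 i ∧ k i = k' i) := fun h =>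
        h' ⟨h.1.symm, h.2.1.symm, h.2.2.symm⟩
      simp [encode, plant, hi, this]
  simp_rw [h]
  rw [← expect_expect_piecewise_swap A fun X X' => g X (A.piecewise X X')]
  refine Finset.expect_congr rfl fun X _ => Finset.expect_congr rfl fun X' _ => ?_
  congr 1
  ext i : 1
  by_cases hi : i ∈ A <;> simp [hi]

lemma codebookMean_eq_expect (f : Codebook b ℓ → ℝ) : codebookMean f = 𝔼 c, f c :=
  (Fintype.expect_eq_sum_div_card f).symm

end Codebook

/-! ### The super channel -/

section Super

variable {Y : Type*} {q : ℕ}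

/-- Relative to zero input, only the letter at the pulse matters. Where `W 0` vanishes there,
absolute continuity makes both sides zero. -/
lemma superChannel_eq (W : Fin 2 → Y → ℝ) (x : Fin q → Fin 2) (y : Fin (2 ^ q) → Y)
    (hW : ∀ y, W 0 y = 0 → W 1 y = 0) :
    superChannel W x y = (∏ t, W 0 (y t)) *
      (W 1 (y (finFunctionFinEquiv x)) / W 0 (y (finFunctionFinEquiv x))) := by
  set e := finFunctionFinEquiv x with he
  rw [superChannel, ← mul_prod_erase univ _ (mem_univ e),
    ← mul_prod_erase univ (fun t => W 0 (y t)) (mem_univ e)]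
  have h1 : ∏ t ∈ univ.erase e, W (ppmSymbol x t) (y t) = ∏ t ∈ univ.erase e, W 0 (y t) := by
    refine prod_congr rfl fun t ht => ?_
    rw [ppmSymbol, Pi.single_eq_of_ne (ne_of_mem_erase ht)]
  rw [h1, ppmSymbol, Pi.single_eq_same]
  by_cases h0 : W 0 (y e) = 0
  · simp [h0, hW _ h0]
  · field_simp

variable [Fintype Y]

lemma isChannel_superChannel {W : Fin 2 → Y → ℝ} (hW : ∀ a, W a ∈ stdSimplex ℝ Y) :
    IsChannel (superChannel (q := q) W) where
  nonneg x y := prod_nonneg fun t _ => (hW _).1 _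
  sum_eq_one x := by
    unfold superChannel
    rw [sum_prod fun t b => W (ppmSymbol x t) b]
    exact prod_eq_one fun t _ => (hW _).2

omit [Fintype Y] in
lemma condOutput_eq (W : Fin 2 → Y → ℝ) (C : Finset (Fin q)) (x : Fin q → Fin 2)
    (y : Fin (2 ^ q) → Y) : condOutput W C x y = condLaw (superChannel W) C x y := by
  rw [condLaw, resample_eq_sum_filter, condOutput, Fintype.card_fin, Nat.cast_ofNat]
  congr!

lemma condMutualInfo_eq {W : Fin 2 → Y → ℝ} (hW : ∀ a, W a ∈ stdSimplex ℝ Y)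
    (A C : Finset (Fin q)) : condMutualInfo W A C =
      meanLog (superChannel W) (A ∪ C) - meanLog (superChannel W) C := by
  have hV := isChannel_superChannel (q := q) hW
  rw [meanLog, meanLog, ← expect_sub_distrib, condMutualInfo, Fintype.expect_eq_sum_div_card]
  congr 1
  · refine sum_congr rfl fun x _ => ?_
    rw [← sum_sub_distrib]
    refine sum_congr rfl fun y _ => ?_
    rw [condOutput_eq, condOutput_eq]
    rcases (hV.nonneg x y).lt_or_eq with h | h
    · rw [Real.log_div (condLaw_pos hV _ h).ne' (condLaw_pos hV _ h).ne']; ring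
    · simp [← h]
  · simp

lemma levelInfo_eq {W : Fin 2 → Y → ℝ} (hW : ∀ a, W a ∈ stdSimplex ℝ Y) (i : Fin q) :
    levelInfo W i = meanLog (superChannel W) (Ici i) - meanLog (superChannel W) (Ioi i) := by
  rw [levelInfo, condMutualInfo_eq hW]
  congr 2
  ext j
  simp [le_iff_eq_or_lt]

lemma levelInfo_nonneg {W : Fin 2 → Y → ℝ} (hW : ∀ a, W a ∈ stdSimplex ℝ Y) (i : Fin q) :
    0 ≤ levelInfo W i := by
  rw [levelInfo_eq hW, sub_nonneg]
  exact meanLog_mono (isChannel_superChannel hW) Ioi_subset_Ici_self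

lemma sum_levelInfo_le {W : Fin 2 → Y → ℝ} (hW : ∀ a, W a ∈ stdSimplex ℝ Y)
    (S : Finset (Fin q)) : ∑ i ∈ S, levelInfo W i ≤ condMutualInfo W S Sᶜ := by
  simp_rw [levelInfo_eq hW, condMutualInfo_eq hW, union_compl]
  exact sum_Ici_sub_Ioi_le (meanLog_supermodular (isChannel_superChannel hW)) S

lemma le_sum_levelInfo {W : Fin 2 → Y → ℝ} (hW : ∀ a, W a ∈ stdSimplex ℝ Y)
    (S : Finset (Fin q)) : condMutualInfo W S ∅ ≤ ∑ i ∈ S, levelInfo W i := by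
  simp_rw [levelInfo_eq hW, condMutualInfo_eq hW, union_empty]
  exact le_sum_Ici_sub_Ioi (meanLog_supermodular (isChannel_superChannel hW)) S

lemma sum_univ_levelInfo {W : Fin 2 → Y → ℝ} (hW : ∀ a, W a ∈ stdSimplex ℝ Y) :
    ∑ i : Fin q, levelInfo W i = condMutualInfo W (univ : Finset (Fin q)) ∅ := by
  simp_rw [levelInfo_eq hW, condMutualInfo_eq hW, union_empty]
  exact sum_univ_Ici_sub_Ioi (meanLog_supermodular (isChannel_superChannel hW))

/-- The likelihood ratio `W 1 y / W 0 y` is bounded, and bounded away from zero where it is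
positive. -/
lemma exists_ratio_bound (W : Fin 2 → Y → ℝ) (hW : ∀ a, W a ∈ stdSimplex ℝ Y) :
    ∃ C : ℝ, 1 ≤ C ∧ ∀ y, W 1 y / W 0 y ≤ C ∧ (0 < W 1 y / W 0 y → C⁻¹ ≤ W 1 y / W 0 y) := by
  have h0 : ∀ y, 0 ≤ W 1 y / W 0 y := fun y => div_nonneg ((hW 1).1 y) ((hW 0).1 y)
  have hs : ∀ y, 0 ≤ (W 1 y / W 0 y) + (W 1 y / W 0 y)⁻¹ := fun y =>
    add_nonneg (h0 y) (inv_nonneg.2 (h0 y))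
  -- The sum of all ratios and their inverses dominates each of them; the leading `1` ensures `1 ≤
  -- C`.
  refine ⟨1 + ∑ y, (W 1 y / W 0 y + (W 1 y / W 0 y)⁻¹),
    le_add_of_nonneg_right (sum_nonneg fun y _ => hs y), fun y => ?_⟩
  have h1 := single_le_sum (f := fun y => W 1 y / W 0 y + (W 1 y / W 0 y)⁻¹)
    (fun y _ => hs y) (mem_univ y)
  have h2 := inv_nonneg.2 (h0 y)
  have h3 := h0 y
  refine ⟨by linarith, fun hy => ?_⟩
  rw [inv_le_comm₀ (by linarith) hy]
  linarith

variable {W : Fin 2 → Y → ℝ} {C : ℝ}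

lemma condLaw_superChannel_le (hW : ∀ a, W a ∈ stdSimplex ℝ Y)
    (hac : ∀ y, W 0 y = 0 → W 1 y = 0) (hC : ∀ y, W 1 y / W 0 y ≤ C) (A : Finset (Fin q))
    (x : Fin q → Fin 2) (y : Fin (2 ^ q) → Y) :
    condLaw (superChannel W) A x y ≤ (∏ t, W 0 (y t)) * C := by
  refine Finset.expect_le univ_nonempty fun x' _ => ?_
  rw [superChannel_eq W _ _ hac]
  exact mul_le_mul_of_nonneg_left (hC _) (prod_nonneg fun t _ => (hW 0).1 _)

lemma prod_pos_of_superChannel_pos (hW : ∀ a, W a ∈ stdSimplex ℝ Y)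
    (hac : ∀ y, W 0 y = 0 → W 1 y = 0) {x : Fin q → Fin 2} {y : Fin (2 ^ q) → Y}
    (h : 0 < superChannel W x y) : 0 < ∏ t, W 0 (y t) := by
  rw [superChannel_eq W _ _ hac] at h
  exact pos_of_mul_pos_left h (div_nonneg ((hW 1).1 _) ((hW 0).1 _))

lemma le_superChannel (hW : ∀ a, W a ∈ stdSimplex ℝ Y)
    (hac : ∀ y, W 0 y = 0 → W 1 y = 0)
    (hC : ∀ y, 0 < W 1 y / W 0 y → C⁻¹ ≤ W 1 y / W 0 y) {x : Fin q → Fin 2}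
    {y : Fin (2 ^ q) → Y} (h : 0 < superChannel W x y) :
    (∏ t, W 0 (y t)) * C⁻¹ ≤ superChannel W x y := by
  have hp := prod_pos_of_superChannel_pos hW hac h
  rw [superChannel_eq W _ _ hac] at h ⊢
  exact mul_le_mul_of_nonneg_left (hC _ (pos_of_mul_pos_right h hp.le)) hp.le

lemma condLaw_le_condLaw (hW : ∀ a, W a ∈ stdSimplex ℝ Y) {A B : Finset (Fin q)} (hAB : A ⊆ B)
    (x : Fin q → Fin 2) (y : Fin (2 ^ q) → Y) :
    condLaw (superChannel W) B x y ≤ 2 ^ q * condLaw (superChannel W) A x y := by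
  have := le_card_mul_resample A (f := resample B fun x => superChannel W x y)
    (fun x => resample_nonneg (fun x => (isChannel_superChannel hW).nonneg x y) x) x
  rw [resample_resample, inter_eq_left.2 hAB] at this
  simpa [condLaw] using this

lemma superChannel_le_condLaw (hW : ∀ a, W a ∈ stdSimplex ℝ Y) (A : Finset (Fin q))
    (x : Fin q → Fin 2) (y : Fin (2 ^ q) → Y) :
    superChannel W x y ≤ 2 ^ q * condLaw (superChannel W) A x y := by
  simpa using condLaw_le_condLaw hW (subset_univ A) x y

/-- From below, both laws are compared with the zero-input law: where positive, the channel is at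
least `C⁻¹` times it, and the averaged law is at most `C` times it. From above, the channel is one
of at most `2 ^ q` terms of the average. -/
lemma log_superChannel_div_mem (hW : ∀ a, W a ∈ stdSimplex ℝ Y)
    (hac : ∀ y, W 0 y = 0 → W 1 y = 0) (hC1 : 1 ≤ C)
    (hC : ∀ y, W 1 y / W 0 y ≤ C ∧ (0 < W 1 y / W 0 y → C⁻¹ ≤ W 1 y / W 0 y))
    (A : Finset (Fin q)) {x : Fin q → Fin 2} {y : Fin (2 ^ q) → Y} (h : 0 < superChannel W x y) :
    Real.log (superChannel W x y / condLaw (superChannel W) A x y) ∈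
      Set.Icc (-(2 * Real.log C)) (q * Real.log 2) := by
  have hV := isChannel_superChannel (q := q) hW
  have hA := condLaw_pos hV A h
  have hp := prod_pos_of_superChannel_pos hW hac h
  have hC0 : 0 < C := by linarith
  constructor
  · have h1 := Real.log_le_log (mul_pos hp (inv_pos.2 hC0))
      (le_superChannel hW hac (fun y => (hC y).2) h)
    have h2 := Real.log_le_log hA (condLaw_superChannel_le hW hac (fun y => (hC y).1) A x y)
    rw [Real.log_mul hp.ne' (inv_ne_zero hC0.ne'), Real.log_inv] at h1
    rw [Real.log_mul hp.ne' hC0.ne'] at h2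
    rw [Real.log_div h.ne' hA.ne']
    linarith
  · rw [← Real.log_pow]
    exact Real.log_le_log (div_pos h hA) ((div_le_iff₀ hA).2 (superChannel_le_condLaw hW A x y))

/-- The numerator is now an average too and may be smaller than the channel by a factor `2 ^ q`,
which doubles the leading term of the range. -/
lemma log_condLaw_div_mem (hW : ∀ a, W a ∈ stdSimplex ℝ Y)
    (hac : ∀ y, W 0 y = 0 → W 1 y = 0) (hC1 : 1 ≤ C)
    (hC : ∀ y, W 1 y / W 0 y ≤ C ∧ (0 < W 1 y / W 0 y → C⁻¹ ≤ W 1 y / W 0 y))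
    (A : Finset (Fin q)) {x : Fin q → Fin 2} {y : Fin (2 ^ q) → Y} (h : 0 < superChannel W x y) :
    Real.log (condLaw (superChannel W) A x y / condLaw (superChannel W) ∅ x y) ∈
      Set.Icc (-(q * Real.log 2 + 2 * Real.log C)) (q * Real.log 2) := by
  have hV := isChannel_superChannel (q := q) hW
  have hA := condLaw_pos hV A h
  have h0 := condLaw_pos hV ∅ h
  constructor
  · have h1 := Real.log_le_log h (superChannel_le_condLaw hW A x y)
    have h2 := (log_superChannel_div_mem hW hac hC1 hC ∅ h).1
    rw [Real.log_mul (by positivity) hA.ne', Real.log_pow] at h1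
    rw [Real.log_div h.ne' h0.ne'] at h2
    rw [Real.log_div hA.ne' h0.ne']
    linarith
  · rw [← Real.log_pow]
    exact Real.log_le_log (div_pos hA h0)
      ((div_le_iff₀ h0).2 (condLaw_le_condLaw hW (empty_subset A) x y))

end Super

/-! ### Counting strings -/

section Count

variable {q : ℕ}

lemma card_strings_agree (n : Fin q → ℕ) (x : Strings n) (S : Finset (Fin q)) :
    #{x' : Strings n | ∀ i ∈ Sᶜ, x' i = x i} = 2 ^ ∑ i ∈ S, n i := by
  have : ({x' : Strings n | ∀ i ∈ Sᶜ, x' i = x i} : Finset (Strings n)) =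
      Fintype.piFinset fun i => if i ∈ S then univ else {x i} := by
    ext z
    simp only [mem_filter, mem_univ, true_and, Fintype.mem_piFinset, mem_compl]
    refine forall_congr' fun i => ?_
    by_cases hi : i ∈ S <;> simp [hi]
  rw [this, Fintype.card_piFinset]
  simp [apply_ite Finset.card, prod_ite_mem, prod_pow_eq_pow_sum]

lemma card_strings (n : Fin q → ℕ) : Fintype.card (Strings n) = 2 ^ ∑ i, n i := by
  simp [Strings, prod_pow_eq_pow_sum]

end Count

/-! ### Numbers of bits -/

section Bits

variable {Y Z : Type*} [Fintype Y] [Fintype Z] {P : Fin 2 → Y → ℝ} {Q : Fin 2 → Z → ℝ}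
  {ε : ℝ} {q ℓ : ℕ}

lemma floor_mul_log_le {x : ℝ} (hx : 0 ≤ x) :
    (⌊x / Real.log 2⌋₊ : ℝ) * Real.log 2 ≤ x := by
  have hl : 0 < Real.log 2 := Real.log_pos one_lt_two
  rw [← le_div_iff₀ hl]
  exact Nat.floor_le (by positivity)

lemma le_floor_mul_log (x : ℝ) : x - Real.log 2 ≤ (⌊x / Real.log 2⌋₊ : ℝ) * Real.log 2 := by
  have hl : 0 < Real.log 2 := Real.log_pos one_lt_two
  have := (Nat.lt_floor_add_one (x / Real.log 2)).le
  rw [div_le_iff₀ hl] at this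
  linarith

lemma le_ceil_mul_log (x : ℝ) : x ≤ (⌈x / Real.log 2⌉₊ : ℝ) * Real.log 2 := by
  have hl : 0 < Real.log 2 := Real.log_pos one_lt_two
  rw [← div_le_iff₀ hl]
  exact Nat.le_ceil _

lemma ceil_mul_log_le {x : ℝ} (hx : 0 ≤ x) :
    (⌈x / Real.log 2⌉₊ : ℝ) * Real.log 2 ≤ x + Real.log 2 := by
  have hl : 0 < Real.log 2 := Real.log_pos one_lt_two
  have := (Nat.ceil_lt_add_one (a := x / Real.log 2) (by positivity)).le
  calc _ ≤ (x / Real.log 2 + 1) * Real.log 2 := by gcongr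
    _ = _ := by field_simp

lemma rateV_nonneg (i : Fin q) : 0 ≤ rateV P Q ε i := le_max_left _ _

lemma rateK_nonneg (i : Fin q) : 0 ≤ rateK P Q ε i := le_max_left _ _

lemma rateU_add_rateV (i : Fin q) : rateU P Q ε i + rateV P Q ε i = levelInfo P i - ε / q := by
  unfold rateU rateV
  rw [mul_div_assoc]
  rcases le_total (levelInfo P i - ε / q) (levelInfo Q i + ε / q) with h | h
  · rw [min_eq_left h, max_eq_left (by linarith)]; ring
  · rw [min_eq_right h, max_eq_right (by linarith)]; ring

lemma rateU_add_rateK (i : Fin q) : rateU P Q ε i + rateK P Q ε i = levelInfo Q i + ε / q := by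
  unfold rateU rateK
  rw [mul_div_assoc]
  rcases le_total (levelInfo P i - ε / q) (levelInfo Q i + ε / q) with h | h
  · rw [min_eq_left h, max_eq_right (by linarith)]; ring
  · rw [min_eq_right h, max_eq_left (by linarith)]; ring

lemma rateK_sub_rateV (i : Fin q) :
    rateK P Q ε i - rateV P Q ε i = levelInfo Q i - levelInfo P i + 2 * (ε / q) := by
  linarith [rateU_add_rateV (P := P) (Q := Q) (ε := ε) i,
    rateU_add_rateK (P := P) (Q := Q) (ε := ε) i]

/-- The two rates add up to `levelInfo P i - ε / q`, but rounding a negative `rateU` to zero bits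
breaks the bound. It survives on levels with at least one bit: if `rateV` is positive, then `rateU`
is `levelInfo Q i + ε / q`, which is nonnegative. -/
lemma mlcBits_UV_mul_log_le (hQ : ∀ a, Q a ∈ stdSimplex ℝ Z) (hε : 0 ≤ ε) (i : Fin q)
    (h : 0 < (mlcBits P Q ε q ℓ).U i + (mlcBits P Q ε q ℓ).V i) :
    (((mlcBits P Q ε q ℓ).U i : ℝ) + (mlcBits P Q ε q ℓ).V i) * Real.log 2 ≤
      ℓ * (levelInfo P i - ε / q) := by
  have hV0 := rateV_nonneg (P := P) (Q := Q) (ε := ε) i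
  have hV := floor_mul_log_le (x := ℓ * rateV P Q ε i) (by positivity)
  have hs := rateU_add_rateV (P := P) (Q := Q) (ε := ε) i
  have key : ((mlcBits P Q ε q ℓ).U i : ℝ) * Real.log 2 ≤ ℓ * rateU P Q ε i := by
    rcases le_total 0 (rateU P Q ε i) with hU | hU
    · exact floor_mul_log_le (by positivity)
    · have hU0 : (mlcBits P Q ε q ℓ).U i = 0 := Nat.floor_of_nonpos
        (div_nonpos_of_nonpos_of_nonneg (mul_nonpos_of_nonneg_of_nonpos (by positivity) hU)
          (Real.log_pos one_lt_two).le)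
      rcases hV0.lt_or_eq with hVp | hV0
      · have h1 : 0 < levelInfo P i - levelInfo Q i - 2 * ε / q := by
          by_contra hc
          rw [rateV, max_eq_left (not_lt.1 hc)] at hVp
          exact lt_irrefl _ hVp
        have h2 : 0 ≤ ε / q := by positivity
        have h3 := levelInfo_nonneg hQ i
        rw [mul_div_assoc] at h1
        have h4 : rateU P Q ε i = levelInfo Q i + ε / q := min_eq_right (by linarith)
        rw [hU0, h4]
        simp only [CharP.cast_eq_zero, zero_mul]
        positivity
      · have : (mlcBits P Q ε q ℓ).V i = 0 := by simp [mlcBits, ← hV0]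
        omega
  change ((mlcBits P Q ε q ℓ).V i : ℝ) * Real.log 2 ≤ _ at hV
  rw [← hs]
  linarith

lemma le_mlcBits_UV_mul_log (i : Fin q) :
    ℓ * (levelInfo P i - ε / q) - 2 * Real.log 2 ≤
      (((mlcBits P Q ε q ℓ).U i : ℝ) + (mlcBits P Q ε q ℓ).V i) * Real.log 2 := by
  have h1 := le_floor_mul_log (ℓ * rateU P Q ε i)
  have h2 := le_floor_mul_log (ℓ * rateV P Q ε i)
  rw [← rateU_add_rateV (P := P) (Q := Q) (ε := ε) i]
  simp only [mlcBits]
  linarith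

lemma le_mlcBits_UK_mul_log (i : Fin q) :
    ℓ * (levelInfo Q i + ε / q) - Real.log 2 ≤
      (((mlcBits P Q ε q ℓ).U i : ℝ) + (mlcBits P Q ε q ℓ).K i) * Real.log 2 := by
  have h1 := le_floor_mul_log (ℓ * rateU P Q ε i)
  have h2 := le_ceil_mul_log (ℓ * rateK P Q ε i)
  rw [← rateU_add_rateK (P := P) (Q := Q) (ε := ε) i]
  simp only [mlcBits]
  linarith

lemma mlcBits_K_sub_V_mul_log_le (i : Fin q) :
    (((mlcBits P Q ε q ℓ).K i : ℝ) - (mlcBits P Q ε q ℓ).V i) * Real.log 2 ≤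
      ℓ * (levelInfo Q i - levelInfo P i + 2 * (ε / q)) + 2 * Real.log 2 := by
  have hK0 := rateK_nonneg (P := P) (Q := Q) (ε := ε) i
  have h1 := le_floor_mul_log (ℓ * rateV P Q ε i)
  have h2 := ceil_mul_log_le (x := ℓ * rateK P Q ε i) (by positivity)
  rw [← rateK_sub_rateV (P := P) (Q := Q) (ε := ε) i]
  simp only [mlcBits]
  linarith

lemma le_mlcBits_K_sub_V_mul_log (i : Fin q) :
    ℓ * (levelInfo Q i - levelInfo P i + 2 * (ε / q)) ≤
      (((mlcBits P Q ε q ℓ).K i : ℝ) - (mlcBits P Q ε q ℓ).V i) * Real.log 2 := by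
  have hV0 := rateV_nonneg (P := P) (Q := Q) (ε := ε) i
  have h1 := floor_mul_log_le (x := ℓ * rateV P Q ε i) (by positivity)
  have h2 := le_ceil_mul_log (ℓ * rateK P Q ε i)
  rw [← rateK_sub_rateV (P := P) (Q := Q) (ε := ε) i]
  simp only [mlcBits]
  linarith

lemma mlcBits_K_mul_log_le (hP : ∀ a, P a ∈ stdSimplex ℝ Y) (hQ : ∀ a, Q a ∈ stdSimplex ℝ Z)
    (hε : 0 ≤ ε) (i : Fin q) :
    ((mlcBits P Q ε q ℓ).K i : ℝ) * Real.log 2 ≤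
      ℓ * (levelInfo Q i + 2 * (ε / q)) + Real.log 2 := by
  have hK0 := rateK_nonneg (P := P) (Q := Q) (ε := ε) i
  refine (ceil_mul_log_le (x := ℓ * rateK P Q ε i) (by positivity)).trans ?_
  have h1 := levelInfo_nonneg hP i
  have h2 := levelInfo_nonneg hQ i
  have h3 : 0 ≤ ε / q := by positivity
  gcongr
  refine max_le (by linarith) ?_
  rw [mul_div_assoc]
  linarith

end Bits

/-! ### Reliability of one block -/

section Reliability

variable {Y : Type*} [Fintype Y] {W : Fin 2 → Y → ℝ} {C τ : ℝ} {q ℓ : ℕ}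

lemma condMutualInfo_eq_expect (W : Fin 2 → Y → ℝ) (A B : Finset (Fin q)) :
    condMutualInfo W A B = 𝔼 x, ∑ y, superChannel W x y *
      Real.log (condLaw (superChannel W) (A ∪ B) x y / condLaw (superChannel W) B x y) := by
  rw [Fintype.expect_eq_sum_div_card]
  simp [condMutualInfo, condOutput_eq]

lemma isTypical_iff (X : Fin q → Fin ℓ → Fin 2) (y : Fin ℓ → Fin (2 ^ q) → Y) :
    IsTypical W τ X y ↔ ∀ S : Finset (Fin q),
      Real.exp (ℓ * (condMutualInfo W S Sᶜ - τ / q)) * condLaw (block (superChannel W)) Sᶜ X y <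
        block (superChannel W) X y := by
  simp only [IsTypical, condLaw_block, condOutput_eq]
  rfl

open Classical in
-- One lower-tail bound for each set `S`, whose log-likelihood ratio has mean `I(X_S; Ỹ | X_{Sᶜ})`;
-- the factor `2 ^ q` counts the sets.
lemma expect_atypical_le (hW : ∀ a, W a ∈ stdSimplex ℝ Y)
    (hac : ∀ y, W 0 y = 0 → W 1 y = 0) (hC1 : 1 ≤ C)
    (hC : ∀ y, W 1 y / W 0 y ≤ C ∧ (0 < W 1 y / W 0 y → C⁻¹ ≤ W 1 y / W 0 y)) (hq : 0 < q)
    (hqC : 2 * Real.log C + q * Real.log 2 ≤ q) (hτ : 0 ≤ τ) :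
    𝔼 X : Fin q → Fin ℓ → Fin 2, ∑ y,
        (if IsTypical W τ X y then 0 else block (superChannel W) X y) ≤
      2 ^ q * Real.exp (-(2 * ℓ * τ ^ 2 / q ^ 4)) := by
  have hV := isChannel_superChannel (q := q) hW
  have hB := isChannel_block (κ := Fin ℓ) hV
  have hq' : (0 : ℝ) < q := by exact_mod_cast hq
  set bad : Finset (Fin q) → (Fin q → Fin ℓ → Fin 2) → (Fin ℓ → Fin (2 ^ q) → Y) → Prop :=
    fun S X y => block (superChannel W) X y ≤ Real.exp (ℓ * (condMutualInfo W S Sᶜ - τ / q)) *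
      condLaw (block (superChannel W)) Sᶜ X y with hbad
  calc 𝔼 X : Fin q → Fin ℓ → Fin 2, ∑ y,
        (if IsTypical W τ X y then 0 else block (superChannel W) X y)
      ≤ 𝔼 X : Fin q → Fin ℓ → Fin 2, ∑ y, ∑ S,
          (if bad S X y then block (superChannel W) X y else 0) := by
        refine expect_le_expect fun X _ => sum_le_sum fun y _ => ?_
        have h0 : ∀ S ∈ univ, 0 ≤ if bad S X y then block (superChannel W) X y else 0 :=
          fun S _ => by
            split_ifs
            exacts [hB.nonneg _ _, le_rfl]
        split_ifs with h
        · exact sum_nonneg h0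
        · rw [isTypical_iff] at h
          push Not at h
          obtain ⟨S, hS⟩ := h
          refine le_trans ?_ (single_le_sum h0 (mem_univ S))
          rw [if_pos hS]
    _ = ∑ S, 𝔼 X : Fin q → Fin ℓ → Fin 2, ∑ y,
          (if bad S X y then block (superChannel W) X y else 0) := by
        rw [← expect_sum_comm]
        exact Finset.expect_congr rfl fun X _ => sum_comm
    _ ≤ ∑ _S : Finset (Fin q), Real.exp (-(2 * ℓ * τ ^ 2 / q ^ 4)) := by
        refine sum_le_sum fun S _ => ?_
        -- Range `q` and deviation `τ / q` give the exponent `2 ℓ (τ / q) ^ 2 / q ^ 2`.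
        refine (hoeffding_lower hV (f := fun x y => Real.log (superChannel W x y /
          condLaw (superChannel W) Sᶜ x y)) (a := -(2 * Real.log C)) (b := -(2 * Real.log C) + q)
          (t := τ / q) (by linarith) ?_ (by positivity) (bad S) ?_).trans_eq ?_
        · intro x y h
          have := log_superChannel_div_mem hW hac hC1 hC Sᶜ h
          exact ⟨this.1, this.2.trans (by linarith)⟩
        · intro X y h hX
          have hl : Real.log (block (superChannel W) X y) ≤ _ := Real.log_le_log h hX
          rw [Real.log_mul (Real.exp_ne_zero _) (condLaw_pos hB _ h).ne', Real.log_exp,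
            condLaw_block] at hl
          have hpos : ∀ s, 0 < superChannel W (fun i => X i s) (y s) := fun s =>
            lt_of_le_of_ne (hV.nonneg _ _) fun h' => h.ne' (prod_eq_zero (mem_univ s) h'.symm)
          rw [block, Real.log_prod fun s _ => (hpos s).ne',
            Real.log_prod fun s _ => (condLaw_pos hV _ (hpos s)).ne', ← sub_le_iff_le_add,
            ← sum_sub_distrib] at hl
          have hI := condMutualInfo_eq_expect W S Sᶜ
          simp only [union_compl, condLaw_univ] at hI
          rw [← hI, Fintype.card_fin]
          refine le_of_eq_of_le (sum_congr rfl fun s _ => ?_) hl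
          rw [Real.log_div (hpos s).ne' (condLaw_pos hV _ (hpos s)).ne']
        · congr 1
          rw [Fintype.card_fin, neg_add_eq_sub, sub_neg_eq_add, sub_add_cancel]
          field_simp
    _ = _ := by simp

open Classical in
/-- Codewords that are independent of the output on the levels outside `A` are rarely typical. -/
lemma expect_typical_le (hW : ∀ a, W a ∈ stdSimplex ℝ Y) (A : Finset (Fin q)) :
    𝔼 X : Fin q → Fin ℓ → Fin 2, 𝔼 X', ∑ y,
        (if IsTypical W τ (A.piecewise X X') y then block (superChannel W) X y else 0) ≤
      Real.exp (-(ℓ * (condMutualInfo W Aᶜ A - τ / q))) := by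
  have hV := isChannel_superChannel (q := q) hW
  have hB := isChannel_block (κ := Fin ℓ) hV
  set γ : ℝ := ℓ * (condMutualInfo W Aᶜ A - τ / q) with hγ
  -- Change of measure: on the decoding set for `Aᶜ`, the likelihood ratio divided by its threshold
  -- is at least one. Averaging over `X'` turns the numerator into `P(y | x_A)`, which cancels.
  calc _ ≤ 𝔼 X : Fin q → Fin ℓ → Fin 2, 𝔼 X', ∑ y, block (superChannel W) X y *
        (block (superChannel W) (A.piecewise X X') y /
          (Real.exp γ * condLaw (block (superChannel W)) A X y)) := by
        refine expect_le_expect fun X _ => expect_le_expect fun X' _ => sum_le_sum fun y _ => ?_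
        have h0 := hB.nonneg X y
        have h1 := hB.nonneg (A.piecewise X X') y
        have h2 := condLaw_nonneg hB A X y
        split_ifs with h
        · refine le_mul_of_one_le_right h0 ?_
          have h' := (isTypical_iff _ _).1 h Aᶜ
          rw [compl_compl, condLaw_congr A (x' := X) fun i hi => by simp [hi]] at h'
          have h3 : 0 < condLaw (block (superChannel W)) A X y := by
            rw [← condLaw_congr A (x := A.piecewise X X') fun i hi => by simp [hi]]
            exact condLaw_pos hB A (lt_of_le_of_lt (by positivity) h')
          rw [one_le_div (by positivity)]
          exact h'.le
        · positivity
    _ = 𝔼 X : Fin q → Fin ℓ → Fin 2, ∑ y, block (superChannel W) X y *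
        (condLaw (block (superChannel W)) A X y /
          (Real.exp γ * condLaw (block (superChannel W)) A X y)) := by
        refine Finset.expect_congr rfl fun X _ => ?_
        rw [expect_sum_comm]
        refine sum_congr rfl fun y _ => ?_
        rw [← mul_expect, ← expect_div]
        rfl
    _ ≤ 𝔼 X : Fin q → Fin ℓ → Fin 2, ∑ y, block (superChannel W) X y * Real.exp (-γ) := by
        refine expect_le_expect fun X _ => sum_le_sum fun y _ =>
          mul_le_mul_of_nonneg_left ?_ (hB.nonneg X y)
        rw [mul_comm, ← div_div, Real.exp_neg, ← one_div]
        exact div_le_div_of_nonneg_right (div_self_le_one _) (Real.exp_nonneg _)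
    _ = _ := by simp [← sum_mul, hB.sum_eq_one]

variable {b : LevelBits q}

open Classical in
/-- Probability that one block is decoded wrongly when its key is known to the receiver. -/
def blockError (W : Fin 2 → Y → ℝ) (τ : ℝ) (c : Codebook b ℓ) (w : Message b)
    (k : Strings b.K) : ℝ :=
  ∑ y, if decode W τ c k y = w then 0 else blockChannel W (encode c w k) y

/-- The levels on which two messages agree. -/
def agree (w w' : Message b) : Finset (Fin q) := {i | w'.1 i = w.1 i ∧ w'.2 i = w.2 i}

open Classical in
-- A wrong decision requires that the sent message lies outside the decoding set or that another one
-- lies inside. Codewords of another message equal the sent ones on the levels of agreement and are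
-- independent elsewhere.
lemma expect_blockError_le (hW : ∀ a, W a ∈ stdSimplex ℝ Y) (w : Message b) (k : Strings b.K) :
    𝔼 c : Codebook b ℓ, blockError W τ c w k ≤
      (𝔼 X : Fin q → Fin ℓ → Fin 2, ∑ y,
        (if IsTypical W τ X y then 0 else block (superChannel W) X y)) +
      ∑ w' ∈ univ.erase w,
        Real.exp (-(ℓ * (condMutualInfo W (agree w w')ᶜ (agree w w') - τ / q))) := by
  have hV := isChannel_superChannel (q := q) hW
  have hB := isChannel_block (κ := Fin ℓ) hV
  have hpt : ∀ c : Codebook b ℓ, blockError W τ c w k ≤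
      (∑ y, if IsTypical W τ (encode c w k) y then 0
        else block (superChannel W) (encode c w k) y) +
      ∑ w' ∈ univ.erase w, ∑ y, if IsTypical W τ (encode c w' k) y
        then block (superChannel W) (encode c w k) y else 0 := by
    intro c
    rw [blockError, sum_comm, ← sum_add_distrib]
    refine sum_le_sum fun y _ => ?_
    have hn := hB.nonneg (encode c w k) y
    have hs : ∀ w' ∈ univ.erase w, 0 ≤ if IsTypical W τ (encode c w' k) y
        then block (superChannel W) (encode c w k) y else 0 := fun w' _ => by
      split_ifs
      exacts [hn, le_rfl]
    by_cases hw : IsTypical W τ (encode c w k) y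
    · rw [if_pos hw, zero_add]
      by_cases hw' : ∃ w' ∈ univ.erase w, IsTypical W τ (encode c w' k) y
      · obtain ⟨w', hw'm, hw't⟩ := hw'
        refine le_trans ?_ (single_le_sum hs hw'm)
        rw [if_pos hw't]
        split_ifs
        exacts [hn, le_rfl]
      · have hu : ∃! w : Message b, IsTypical W τ (encode c w k) y := ⟨w, hw, fun w' h' => by
          by_contra hne
          exact hw' ⟨w', mem_erase.2 ⟨hne, mem_univ _⟩, h'⟩⟩
        have hd : decode W τ c k y = w := by
          rw [decode, dif_pos hu]
          exact hu.unique hu.choose_spec.1 hw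
        rw [if_pos hd]
        exact sum_nonneg hs
    · rw [if_neg hw]
      refine le_trans ?_ (le_add_of_nonneg_right (sum_nonneg hs))
      split_ifs
      exacts [hn, le_rfl]
  refine (expect_le_expect fun c _ => hpt c).trans ?_
  rw [expect_add_distrib, expect_sum_comm univ (univ.erase w)]
  refine add_le_add (le_of_eq ?_) (sum_le_sum fun w' _ => ?_)
  · exact expect_encode w k fun X => ∑ y, if IsTypical W τ X y then 0
      else block (superChannel W) X y
  · rw [expect_encode_encode w w' k k (fun X X' => ∑ y, if IsTypical W τ X' y
        then block (superChannel W) X y else 0) (agree w w') fun i => by simp [agree]]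
    exact expect_typical_le hW _

/-- At most `exp (ℓ ∑_{i ∈ S} (I_i - ε / q))` messages differ from `w` exactly on `S`. As `∑_{i ∈ S}
I_i ≤ I(X_S; Ỹ | X_{Sᶜ})`, they contribute at most `exp (-ℓ (|S| ε - τ) / q)`, which `2 τ ≤ ε`
reduces to the stated term when `S` is nonempty. -/
lemma sum_exp_agree_le {Z : Type*} [Fintype Z] {P : Fin 2 → Y → ℝ} {Q : Fin 2 → Z → ℝ} {ε : ℝ}
    (hP : ∀ a, P a ∈ stdSimplex ℝ Y) (hQ : ∀ a, Q a ∈ stdSimplex ℝ Z) (hτ : 0 ≤ τ)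
    (hτε : 2 * τ ≤ ε) (w : Message (mlcBits P Q ε q ℓ)) :
    ∑ w' ∈ univ.erase w,
        Real.exp (-(ℓ * (condMutualInfo P (agree w w')ᶜ (agree w w') - τ / q))) ≤
      2 ^ q * Real.exp (-(ℓ * τ / q)) := by
  have hl : 0 < Real.log 2 := Real.log_pos one_lt_two
  rw [← sum_fiberwise (univ.erase w) (fun w' => (agree w w')ᶜ)]
  have : ∀ S : Finset (Fin q), ∑ w' ∈ univ.erase w with (agree w w')ᶜ = S,
      Real.exp (-(ℓ * (condMutualInfo P (agree w w')ᶜ (agree w w') - τ / q))) ≤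
      Real.exp (-(ℓ * τ / q)) := by
    intro S
    rcases (univ.erase w |>.filter fun w' => (agree w w')ᶜ = S).eq_empty_or_nonempty with h | h
    · rw [h, sum_empty]; positivity
    obtain ⟨w₁, hw₁⟩ := h
    simp only [mem_filter, mem_erase, mem_univ, and_true] at hw₁
    obtain ⟨hne, hS⟩ := hw₁
    have hmem : ∀ w' : Message (mlcBits P Q ε q ℓ), (agree w w')ᶜ = S → ∀ i,
        i ∈ S ↔ ¬ (w'.1 i = w.1 i ∧ w'.2 i = w.2 i) := by
      rintro w' rfl i
      simp [agree]
    have hSne : S.Nonempty := by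
      by_contra hS0
      rw [not_nonempty_iff_eq_empty] at hS0
      have : ∀ i, w₁.1 i = w.1 i ∧ w₁.2 i = w.2 i := fun i => by
        have := (hmem w₁ hS i).not
        rw [not_not] at this
        exact this.1 (by simp [hS0])
      exact hne (Prod.ext (funext fun i => (this i).1) (funext fun i => (this i).2))
    have hbits : ∀ i ∈ S, (((mlcBits P Q ε q ℓ).U i : ℝ) + (mlcBits P Q ε q ℓ).V i) * Real.log 2 ≤
        ℓ * (levelInfo P i - ε / q) := by
      intro i hi
      -- Messages that differ on a level have a bit there, as the rate bound requires.
      refine mlcBits_UV_mul_log_le hQ (by linarith) i (Nat.pos_of_ne_zero fun h0 => ?_)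
      rw [Nat.add_eq_zero_iff] at h0
      refine (hmem w₁ hS i).1 hi ⟨funext fun a => ?_, funext fun a => ?_⟩
      · exact absurd a.2 (by omega)
      · exact absurd a.2 (by omega)
    have hcard : (#{w' ∈ univ.erase w | (agree w w')ᶜ = S} : ℝ) ≤
        Real.exp (∑ i ∈ S, ℓ * (levelInfo P i - ε / q)) := by
      have h1 : #{w' ∈ univ.erase w | (agree w w')ᶜ = S} ≤
          #(({x' : Strings (mlcBits P Q ε q ℓ).U | ∀ i ∈ Sᶜ, x' i = w.1 i} : Finset _) ×ˢ
            ({x' : Strings (mlcBits P Q ε q ℓ).V | ∀ i ∈ Sᶜ, x' i = w.2 i} : Finset _)) := by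
        refine card_le_card fun w' hw' => ?_
        have h' := hmem w' (mem_filter.1 hw').2
        simp only [mem_product, mem_filter, mem_univ, true_and, mem_compl, h', not_not]
        exact ⟨fun i hi => hi.1, fun i hi => hi.2⟩
      rw [card_product, card_strings_agree, card_strings_agree, ← pow_add,
        ← sum_add_distrib] at h1
      calc (#{w' ∈ univ.erase w | (agree w w')ᶜ = S} : ℝ)
          ≤ 2 ^ (∑ i ∈ S, ((mlcBits P Q ε q ℓ).U i + (mlcBits P Q ε q ℓ).V i)) := by
            exact_mod_cast h1
        _ = Real.exp (∑ i ∈ S, (((mlcBits P Q ε q ℓ).U i : ℝ) + (mlcBits P Q ε q ℓ).V i) *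
              Real.log 2) := by
            rw [← sum_mul, mul_comm, Real.exp_mul, Real.exp_log two_pos]
            rw [← Real.rpow_natCast]
            push_cast
            rfl
        _ ≤ _ := Real.exp_le_exp.2 (sum_le_sum hbits)
    rw [sum_congr rfl (g := fun _ => Real.exp (-(ℓ * (condMutualInfo P S Sᶜ - τ / q))))
      fun w' hw' => by rw [← (mem_filter.1 hw').2, compl_compl], sum_const, nsmul_eq_mul]
    refine (mul_le_mul_of_nonneg_right hcard (Real.exp_nonneg _)).trans ?_
    rw [← Real.exp_add, Real.exp_le_exp, ← mul_sum, sum_sub_distrib, sum_const, nsmul_eq_mul]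
    have h1 := sum_levelInfo_le hP S
    have h2 : (1 : ℝ) ≤ #S := by exact_mod_cast hSne.card_pos
    have h3 : 2 * (τ / q) ≤ #S * (ε / q) := by
      calc 2 * (τ / q) = 1 * (2 * τ / q) := by ring
        _ ≤ #S * (ε / q) := by gcongr
    have h4 : (0 : ℝ) ≤ ℓ := by positivity
    have : (ℓ : ℝ) * τ / q = ℓ * (τ / q) := by ring
    rw [this]
    nlinarith [mul_le_mul_of_nonneg_left h1 h4, mul_le_mul_of_nonneg_left h3 h4]
  refine (sum_le_sum fun S _ => this S).trans_eq ?_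
  simp

end Reliability

/-! ### Reliability of the chain -/

section ChainReliability

variable {Y : Type*} [Fintype Y] {W : Fin 2 → Y → ℝ} {τ : ℝ} {q ℓ N : ℕ} {b : LevelBits q}

/-- As long as the earlier blocks are decoded correctly, the receiver forms the true key. Error
propagation thus needs no analysis: it suffices to compare with a decoder that is given all true
keys. -/
lemma chainDecode_eq (c : Codebook b ℓ) (w : ChainMessage b N) (s : SharedKey b N)
    (y : Fin (N + 1) → Fin ℓ → Fin (2 ^ q) → Y)
    (h : ∀ j, decode W τ c (chainKeys w s j) (y j) = w j) : chainDecode W τ c s y = w := by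
  ext1 j
  induction j using Fin.induction with
  | zero =>
    rw [← h 0]
    rfl
  | succ j ih =>
    rw [← h j.succ]
    have : chainDecode W τ c s y j.succ =
        decode W τ c (nextKey (chainDecode W τ c s y j.castSucc).2 (s.2 j)) (y j.succ) := rfl
    rw [this, ih]
    rfl

lemma errorProb_le (hW : ∀ a, W a ∈ stdSimplex ℝ Y) (c : Codebook b ℓ) (N : ℕ) :
    errorProb W τ c N ≤ 𝔼 w : ChainMessage b N, 𝔼 s : SharedKey b N,
      ∑ j, blockError W τ c (w j) (chainKeys w s j) := by
  classical
  have hB := isChannel_block (κ := Fin ℓ) (isChannel_superChannel (q := q) hW)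
  have key : ∀ (w : ChainMessage b N) (s : SharedKey b N),
      ∑ y : Fin (N + 1) → Fin ℓ → Fin (2 ^ q) → Y,
        (if chainDecode W τ c s y = w then 0 else chainChannel W c w s y) ≤
      ∑ j, blockError W τ c (w j) (chainKeys w s j) := by
    intro w s
    set f : Fin (N + 1) → (Fin ℓ → Fin (2 ^ q) → Y) → ℝ := fun j y =>
      blockChannel W (encode c (w j) (chainKeys w s j)) y with hf
    have hf0 : ∀ j y, 0 ≤ f j y := fun j y => hB.nonneg _ y
    have hf1 : ∀ j, ∑ y, f j y = 1 := fun j => hB.sum_eq_one _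
    -- Union bound over the block `j` that fails with its true key; the outputs of the other blocks
    -- then sum to one.
    calc _ ≤ ∑ y : Fin (N + 1) → Fin ℓ → Fin (2 ^ q) → Y, ∑ j,
          ∏ j', (if j' = j then
            (if decode W τ c (chainKeys w s j') (y j') = w j' then 0 else f j' (y j'))
            else f j' (y j')) := by
          refine sum_le_sum fun y _ => ?_
          have hn : ∀ j ∈ univ, 0 ≤ ∏ j', (if j' = j then
            (if decode W τ c (chainKeys w s j') (y j') = w j' then 0 else f j' (y j'))
            else f j' (y j')) := fun j _ => prod_nonneg fun j' _ => by
              split_ifs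
              exacts [le_rfl, hf0 _ _, hf0 _ _]
          split_ifs with h
          · exact sum_nonneg hn
          · have : ∃ j, decode W τ c (chainKeys w s j) (y j) ≠ w j := by
              by_contra hc
              push Not at hc
              exact h (chainDecode_eq c w s y hc)
            obtain ⟨j, hj⟩ := this
            refine le_trans (le_of_eq ?_) (single_le_sum hn (mem_univ j))
            refine prod_congr rfl fun j' _ => ?_
            by_cases hjj : j' = j
            · subst hjj; simp [hj, hf]
            · simp [hjj, hf]
      _ = ∑ j, ∏ j', ∑ y, (if j' = j then
            (if decode W τ c (chainKeys w s j') y = w j' then 0 else f j' y) else f j' y) := by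
          rw [sum_comm]
          refine sum_congr rfl fun j _ => ?_
          exact sum_prod fun j' y => (if j' = j then
            (if decode W τ c (chainKeys w s j') y = w j' then 0 else f j' y) else f j' y)
      _ = _ := by
          refine sum_congr rfl fun j _ => ?_
          rw [prod_eq_single j]
          · simp [blockError, hf]
          · intro j' _ hj'
            simp [hj', hf1]
          · simp
  rw [errorProb, Fintype.expect_eq_sum_div_card]
  simp_rw [Fintype.expect_eq_sum_div_card, ← sum_div]
  rw [div_div, mul_comm]
  gcongr with w _ s _
  exact key w s

/-- Average reliability over the random codebook. -/
lemma codebookMean_errorProb_le {Z : Type*} [Fintype Z] {P : Fin 2 → Y → ℝ} {Q : Fin 2 → Z → ℝ}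
    {ε C : ℝ} (hP : ∀ a, P a ∈ stdSimplex ℝ Y) (hQ : ∀ a, Q a ∈ stdSimplex ℝ Z)
    (hac : ∀ y, P 0 y = 0 → P 1 y = 0) (hC1 : 1 ≤ C)
    (hC : ∀ y, P 1 y / P 0 y ≤ C ∧ (0 < P 1 y / P 0 y → C⁻¹ ≤ P 1 y / P 0 y)) (hq : 0 < q)
    (hqC : 2 * Real.log C + q * Real.log 2 ≤ q) (hτ : 0 ≤ τ) (hτε : 2 * τ ≤ ε) (N : ℕ) :
    codebookMean (b := mlcBits P Q ε q ℓ) (ℓ := ℓ) (fun c => errorProb P τ c N) ≤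
      (N + 1) * 2 ^ q * (Real.exp (-(2 * ℓ * τ ^ 2 / q ^ 4)) + (2 : ℝ) ^ (-(ℓ * τ / q))) := by
  rw [codebookMean_eq_expect]
  refine (expect_le_expect fun c _ => errorProb_le hP c N).trans ?_
  have hblock : ∀ (w : Message (mlcBits P Q ε q ℓ)) (k : Strings (mlcBits P Q ε q ℓ).K),
      𝔼 c : Codebook (mlcBits P Q ε q ℓ) ℓ, blockError P τ c w k ≤
      2 ^ q * (Real.exp (-(2 * ℓ * τ ^ 2 / q ^ 4)) + (2 : ℝ) ^ (-(ℓ * τ / q))) := by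
    intro w k
    refine (expect_blockError_le hP w k).trans ?_
    rw [mul_add]
    refine add_le_add (expect_atypical_le hP hac hC1 hC hq hqC hτ)
      ((sum_exp_agree_le hP hQ hτ hτε w).trans ?_)
    rw [Real.rpow_def_of_pos two_pos]
    gcongr
    -- Base `2` instead of `e` only weakens the bound.
    have : Real.log 2 ≤ 1 := by linarith [Real.log_two_lt_d9]
    have h0 : 0 ≤ ℓ * τ / q := by positivity
    nlinarith
  -- Once messages and shared key are fixed, so are the keys of all blocks, and each block is
  -- averaged over the codebook separately; reusing the codebooks does no harm.
  rw [expect_comm]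
  refine expect_le univ_nonempty fun w _ => ?_
  rw [expect_comm]
  refine expect_le univ_nonempty fun s _ => ?_
  rw [expect_sum_comm]
  refine (sum_le_sum fun j _ => hblock (w j) (chainKeys w s j)).trans_eq ?_
  simp only [sum_const, card_univ, Fintype.card_fin, nsmul_eq_mul]
  push_cast
  ring

end ChainReliability

/-! ### Resolvability of one block -/

section Resolvability

variable {Z : Type*} [Fintype Z] {W : Fin 2 → Z → ℝ} {C t : ℝ} {q ℓ : ℕ} {b : LevelBits q}

/-- The output distribution of the super channel for uniform inputs. -/
def meanLaw (W : Fin 2 → Z → ℝ) (q : ℕ) (z : Fin (2 ^ q) → Z) : ℝ :=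
  𝔼 x : Fin q → Fin 2, superChannel W x z

/-- The output distribution of a block for independent uniform inputs. -/
def blockLaw (W : Fin 2 → Z → ℝ) (q ℓ : ℕ) (z : Fin ℓ → Fin (2 ^ q) → Z) : ℝ :=
  ∏ s, meanLaw W q (z s)

omit [Fintype Z] in
lemma condLaw_empty (x : Fin q → Fin 2) (z : Fin (2 ^ q) → Z) :
    condLaw (superChannel W) ∅ x z = meanLaw W q z := by
  rw [condLaw, resample_empty, meanLaw]

lemma condLaw_block_empty (X : Fin q → Fin ℓ → Fin 2) (z : Fin ℓ → Fin (2 ^ q) → Z) :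
    condLaw (block (superChannel W)) ∅ X z = blockLaw W q ℓ z := by
  rw [condLaw_block]
  simp [condLaw_empty, blockLaw]

lemma expect_block_eq (z : Fin ℓ → Fin (2 ^ q) → Z) :
    𝔼 X : Fin q → Fin ℓ → Fin 2, block (superChannel W) X z = blockLaw W q ℓ z := by
  rw [← condLaw_block_empty (fun _ _ => 0), condLaw, resample_empty]

lemma meanLaw_nonneg (hW : ∀ a, W a ∈ stdSimplex ℝ Z) (z : Fin (2 ^ q) → Z) :
    0 ≤ meanLaw W q z :=
  expect_nonneg fun _ _ => (isChannel_superChannel hW).nonneg _ _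

lemma sum_meanLaw (hW : ∀ a, W a ∈ stdSimplex ℝ Z) : ∑ z, meanLaw W q z = 1 := by
  simp_rw [← condLaw_empty (W := W) (fun _ => 0)]
  exact (isChannel_condLaw (isChannel_superChannel hW) _).sum_eq_one _

lemma blockLaw_nonneg (hW : ∀ a, W a ∈ stdSimplex ℝ Z) (z : Fin ℓ → Fin (2 ^ q) → Z) :
    0 ≤ blockLaw W q ℓ z := prod_nonneg fun _ _ => meanLaw_nonneg hW _

lemma sum_blockLaw (hW : ∀ a, W a ∈ stdSimplex ℝ Z) : ∑ z, blockLaw W q ℓ z = 1 := by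
  unfold blockLaw
  rw [sum_prod fun _ z => meanLaw W q z]
  simp [sum_meanLaw hW]

open Classical in
/-- The block channel, restricted to the outputs for which no `P(z | x_S)` is much larger than
`P(z)`. -/
def flatChannel (W : Fin 2 → Z → ℝ) (t : ℝ) (X : Fin q → Fin ℓ → Fin 2)
    (z : Fin ℓ → Fin (2 ^ q) → Z) : ℝ :=
  if ∀ S : Finset (Fin q), condLaw (block (superChannel W)) S X z ≤
    Real.exp (ℓ * (condMutualInfo W S ∅ + t)) * blockLaw W q ℓ z
  then block (superChannel W) X z else 0

lemma flatChannel_nonneg (hW : ∀ a, W a ∈ stdSimplex ℝ Z) (X : Fin q → Fin ℓ → Fin 2)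
    (z : Fin ℓ → Fin (2 ^ q) → Z) : 0 ≤ flatChannel W t X z := by
  unfold flatChannel
  split_ifs
  exacts [(isChannel_block (isChannel_superChannel hW)).nonneg _ _, le_rfl]

lemma flatChannel_le (hW : ∀ a, W a ∈ stdSimplex ℝ Z) (X : Fin q → Fin ℓ → Fin 2)
    (z : Fin ℓ → Fin (2 ^ q) → Z) : flatChannel W t X z ≤ block (superChannel W) X z := by
  unfold flatChannel
  split_ifs
  exacts [le_rfl, (isChannel_block (isChannel_superChannel hW)).nonneg _ _]

lemma expect_sub_flatChannel_le (hW : ∀ a, W a ∈ stdSimplex ℝ Z)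
    (hac : ∀ y, W 0 y = 0 → W 1 y = 0) (hC1 : 1 ≤ C)
    (hC : ∀ y, W 1 y / W 0 y ≤ C ∧ (0 < W 1 y / W 0 y → C⁻¹ ≤ W 1 y / W 0 y)) (hq : 0 < q)
    (hqC : 2 * Real.log C + 2 * q * Real.log 2 ≤ 2 * q) (ht : 0 ≤ t) :
    𝔼 X : Fin q → Fin ℓ → Fin 2, ∑ z, (block (superChannel W) X z - flatChannel W t X z) ≤
      2 ^ q * Real.exp (-(ℓ * t ^ 2 / (2 * q ^ 2))) := by
  classical
  have hV := isChannel_superChannel (q := q) hW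
  have hB := isChannel_block (κ := Fin ℓ) hV
  have hq' : (0 : ℝ) < q := by exact_mod_cast hq
  set bad : Finset (Fin q) → (Fin q → Fin ℓ → Fin 2) → (Fin ℓ → Fin (2 ^ q) → Z) → Prop :=
    fun S X z => Real.exp (ℓ * (condMutualInfo W S ∅ + t)) * blockLaw W q ℓ z ≤
      condLaw (block (superChannel W)) S X z with hbad
  calc 𝔼 X : Fin q → Fin ℓ → Fin 2, ∑ z, (block (superChannel W) X z - flatChannel W t X z)
      ≤ 𝔼 X : Fin q → Fin ℓ → Fin 2, ∑ z, ∑ S,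
          (if bad S X z then block (superChannel W) X z else 0) := by
        refine expect_le_expect fun X _ => sum_le_sum fun z _ => ?_
        have h0 : ∀ S ∈ univ, 0 ≤ if bad S X z then block (superChannel W) X z else 0 :=
          fun S _ => by
            split_ifs
            exacts [hB.nonneg _ _, le_rfl]
        unfold flatChannel
        split_ifs with h
        · rw [sub_self]
          exact sum_nonneg h0
        · push Not at h
          obtain ⟨S, hS⟩ := h
          refine le_trans ?_ (single_le_sum h0 (mem_univ S))
          rw [if_pos hS.le, sub_zero]
    _ = ∑ S, 𝔼 X : Fin q → Fin ℓ → Fin 2, ∑ z,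
          (if bad S X z then block (superChannel W) X z else 0) := by
        rw [← expect_sum_comm]
        exact Finset.expect_congr rfl fun X _ => sum_comm
    _ ≤ ∑ _S : Finset (Fin q), Real.exp (-(ℓ * t ^ 2 / (2 * q ^ 2))) := by
        refine sum_le_sum fun S _ => ?_
        -- Here the range is `2 q`, so the exponent is `2 ℓ t ^ 2 / (2 q) ^ 2`.
        refine (hoeffding_upper hV (f := fun x z => Real.log (condLaw (superChannel W) S x z /
          condLaw (superChannel W) ∅ x z)) (a := -(q * Real.log 2 + 2 * Real.log C))
          (b := -(q * Real.log 2 + 2 * Real.log C) + 2 * q)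
          (t := t) (by linarith) ?_ (by positivity) (bad S) ?_).trans_eq ?_
        · intro x z h
          have := log_condLaw_div_mem hW hac hC1 hC S h
          exact ⟨this.1, this.2.trans (by linarith)⟩
        · intro X z h hX
          have h0 : 0 < blockLaw W q ℓ z := by
            rw [← condLaw_block_empty X]
            exact condLaw_pos hB _ h
          have hl := Real.log_le_log (by positivity) hX
          rw [Real.log_mul (Real.exp_ne_zero _) h0.ne', Real.log_exp, ← condLaw_block_empty X,
            condLaw_block, condLaw_block] at hl
          have hpos : ∀ s, 0 < superChannel W (fun i => X i s) (z s) := fun s =>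
            lt_of_le_of_ne (hV.nonneg _ _) fun h' => h.ne' (prod_eq_zero (mem_univ s) h'.symm)
          rw [Real.log_prod fun s _ => (condLaw_pos hV _ (hpos s)).ne',
            Real.log_prod fun s _ => (condLaw_pos hV _ (hpos s)).ne', ← le_sub_iff_add_le,
            ← sum_sub_distrib] at hl
          have hI := condMutualInfo_eq_expect W S ∅
          rw [union_empty] at hI
          rw [← hI, Fintype.card_fin]
          refine hl.trans_eq (sum_congr rfl fun s _ => ?_)
          rw [Real.log_div (condLaw_pos hV _ (hpos s)).ne' (condLaw_pos hV _ (hpos s)).ne']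
        · congr 1
          rw [Fintype.card_fin, neg_add_eq_sub, sub_neg_eq_add, sub_add_cancel]
          field_simp
    _ = _ := by simp

/-- The output distribution of a block with secret message `v`, for uniform `u` and key. -/
def keyedLaw (W : Fin 2 → Z → ℝ) (c : Codebook b ℓ) (v : Strings b.V)
    (z : Fin ℓ → Fin (2 ^ q) → Z) : ℝ :=
  𝔼 u : Strings b.U, 𝔼 k : Strings b.K, blockChannel W (encode c (u, v) k) z

/-- `keyedLaw` for the restricted channel. -/
def flatKeyedLaw (W : Fin 2 → Z → ℝ) (t : ℝ) (c : Codebook b ℓ) (v : Strings b.V)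
    (z : Fin ℓ → Fin (2 ^ q) → Z) : ℝ :=
  𝔼 u : Strings b.U, 𝔼 k : Strings b.K, flatChannel W t (encode c (u, v) k) z

/-- Truncation is needed in one factor only: averaging the other, untruncated, over `X'` gives `P(z
| x_A)`, which the truncation of the first factor controls. -/
lemma expect_flat_mul_flat_le (hW : ∀ a, W a ∈ stdSimplex ℝ Z) (A : Finset (Fin q))
    (z : Fin ℓ → Fin (2 ^ q) → Z) :
    𝔼 X, 𝔼 X', flatChannel W t X z * flatChannel W t (A.piecewise X X') z ≤
      blockLaw W q ℓ z ^ 2 * Real.exp (ℓ * (condMutualInfo W A ∅ + t)) := by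
  have hB := isChannel_block (κ := Fin ℓ) (isChannel_superChannel (q := q) hW)
  calc 𝔼 X, 𝔼 X', flatChannel W t X z * flatChannel W t (A.piecewise X X') z
      ≤ 𝔼 X, flatChannel W t X z * condLaw (block (superChannel W)) A X z := by
        refine expect_le_expect fun X _ => ?_
        rw [← mul_expect]
        exact mul_le_mul_of_nonneg_left (expect_le_expect fun X' _ => flatChannel_le hW _ _)
          (flatChannel_nonneg hW _ _)
    _ ≤ 𝔼 X : Fin q → Fin ℓ → Fin 2, block (superChannel W) X z *
          (Real.exp (ℓ * (condMutualInfo W A ∅ + t)) * blockLaw W q ℓ z) := by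
        refine expect_le_expect fun X _ => ?_
        have h0 := blockLaw_nonneg (ℓ := ℓ) hW z
        unfold flatChannel
        split_ifs with h
        · exact mul_le_mul_of_nonneg_left (h A) (hB.nonneg _ _)
        · rw [zero_mul]
          exact mul_nonneg (hB.nonneg _ _) (by positivity)
    _ = _ := by
        rw [← expect_mul, expect_block_eq]
        ring

/-- Second moment method. Pairs `(u, k)`, `(u', k')` are grouped by the set `A` of levels where they
agree. For empty `A` the codewords are independent and the product of the means cancels; the
fraction of pairs with a given `A` is at most the inverse power of two. -/
lemma expect_sq_flatKeyedLaw_sub_le (hW : ∀ a, W a ∈ stdSimplex ℝ Z) (v : Strings b.V)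
    (z : Fin ℓ → Fin (2 ^ q) → Z) :
    𝔼 c : Codebook b ℓ, (flatKeyedLaw W t c v z - 𝔼 X, flatChannel W t X z) ^ 2 ≤
      blockLaw W q ℓ z ^ 2 * ∑ A ∈ univ.erase (∅ : Finset (Fin q)),
        Real.exp (ℓ * (condMutualInfo W A ∅ + t)) / 2 ^ ∑ i ∈ A, (b.U i + b.K i) := by
  set g := fun X : Fin q → Fin ℓ → Fin 2 => flatChannel W t X z with hg
  set m := 𝔼 X, g X with hm
  set R := blockLaw W q ℓ z with hR
  set e : Finset (Fin q) → ℝ := fun A => Real.exp (ℓ * (condMutualInfo W A ∅ + t)) with he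
  let ag : Strings b.U × Strings b.K → Strings b.U × Strings b.K → Finset (Fin q) :=
    fun j j' => {i | j'.1 i = j.1 i ∧ j'.2 i = j.2 i}
  have hflat : ∀ c : Codebook b ℓ, flatKeyedLaw W t c v z =
      𝔼 j : Strings b.U × Strings b.K, g (encode c (j.1, v) j.2) := fun c => by
    rw [← univ_product_univ, expect_product]
    rfl
  have hpair : ∀ j j' : Strings b.U × Strings b.K,
      𝔼 c : Codebook b ℓ, g (encode c (j.1, v) j.2) * g (encode c (j'.1, v) j'.2) ≤
      m ^ 2 + ∑ A ∈ univ.erase (∅ : Finset (Fin q)), if ag j j' = A then R ^ 2 * e A else 0 := by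
    intro j j'
    rw [expect_encode_encode (j.1, v) (j'.1, v) j.2 j'.2 (fun X X' => g X * g X') (ag j j')
      (fun i => by simp [ag])]
    rw [sum_ite_eq]
    by_cases h : ag j j' = ∅
    · rw [h, if_neg (by simp), add_zero, sq, hm, expect_mul_expect]
      simp
    · simp only [mem_erase, ne_eq, h, not_false_eq_true, mem_univ, and_true, if_true]
      exact (expect_flat_mul_flat_le hW _ z).trans (le_add_of_nonneg_left (sq_nonneg m))
  have hcount : ∀ (j : Strings b.U × Strings b.K) (A : Finset (Fin q)),
      𝔼 j', (if ag j j' = A then R ^ 2 * e A else 0) ≤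
        R ^ 2 * (e A / 2 ^ ∑ i ∈ A, (b.U i + b.K i)) := by
    intro j A
    have h1 : #{j' | ag j j' = A} ≤ #(({x' : Strings b.U | ∀ i ∈ Aᶜᶜ, x' i = j.1 i} : Finset _) ×ˢ
        ({x' : Strings b.K | ∀ i ∈ Aᶜᶜ, x' i = j.2 i} : Finset _)) := by
      refine card_le_card fun j' hj' => ?_
      have h' : ag j j' = A := (mem_filter.1 hj').2
      have : ∀ i ∈ A, j'.1 i = j.1 i ∧ j'.2 i = j.2 i := fun i hi => by
        rw [← h'] at hi
        exact (mem_filter.1 hi).2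
      simp only [mem_product, mem_filter, mem_univ, true_and, compl_compl]
      exact ⟨fun i hi => (this i hi).1, fun i hi => (this i hi).2⟩
    rw [card_product, card_strings_agree, card_strings_agree, ← pow_add,
      ← sum_add_distrib] at h1
    have h2 : Fintype.card (Strings b.U × Strings b.K) =
        2 ^ (∑ i ∈ A, (b.U i + b.K i)) * 2 ^ (∑ i ∈ Aᶜ, (b.U i + b.K i)) := by
      rw [Fintype.card_prod, card_strings, card_strings, ← pow_add, ← pow_add, ← sum_add_distrib,
        sum_add_sum_compl]
    have h3 : (#{j' | ag j j' = A} : ℝ) ≤ 2 ^ ∑ i ∈ Aᶜ, (b.U i + b.K i) := by exact_mod_cast h1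
    rw [Fintype.expect_eq_sum_div_card, ← sum_filter, sum_const, nsmul_eq_mul, h2,
      div_le_iff₀ (by positivity)]
    push_cast
    calc _ ≤ 2 ^ (∑ i ∈ Aᶜ, (b.U i + b.K i)) * (R ^ 2 * e A) := by gcongr
      _ = _ := by field_simp
  have hlin : ∀ c : Codebook b ℓ, (flatKeyedLaw W t c v z - m) ^ 2 =
      (𝔼 j : Strings b.U × Strings b.K, 𝔼 j' : Strings b.U × Strings b.K,
        g (encode c (j.1, v) j.2) * g (encode c (j'.1, v) j'.2)) -
        2 * m * (𝔼 j : Strings b.U × Strings b.K, g (encode c (j.1, v) j.2)) + m ^ 2 := by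
    intro c
    rw [hflat, ← expect_mul_expect]
    ring
  have hmean : 𝔼 c : Codebook b ℓ, 𝔼 j : Strings b.U × Strings b.K,
      g (encode c (j.1, v) j.2) = m := by
    rw [expect_comm]
    simp_rw [expect_encode _ _ g]
    simp [hm]
  rw [Finset.expect_congr rfl fun c _ => hlin c, expect_add_distrib, expect_sub_distrib,
    ← mul_expect, hmean, Fintype.expect_const, expect_comm]
  have hmain : 𝔼 j : Strings b.U × Strings b.K, 𝔼 c : Codebook b ℓ, 𝔼 j' : Strings b.U × Strings b.K,
      g (encode c (j.1, v) j.2) * g (encode c (j'.1, v) j'.2) ≤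
      m ^ 2 + R ^ 2 * ∑ A ∈ univ.erase (∅ : Finset (Fin q)),
        e A / 2 ^ ∑ i ∈ A, (b.U i + b.K i) := by
    refine expect_le univ_nonempty fun j _ => ?_
    rw [expect_comm]
    refine (expect_le_expect fun j' _ => hpair j j').trans ?_
    rw [expect_add_distrib, Fintype.expect_const, expect_sum_comm, mul_sum]
    gcongr with A _
    exact hcount j A
  linarith

/-- Average resolvability of one block over the random codebook. -/
lemma expect_sum_abs_keyedLaw_sub_le (hW : ∀ a, W a ∈ stdSimplex ℝ Z) (v : Strings b.V)
    {θ φ : ℝ} (hθ : 0 ≤ θ)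
    (h1 : ∑ A ∈ univ.erase (∅ : Finset (Fin q)),
        Real.exp (ℓ * (condMutualInfo W A ∅ + t)) / 2 ^ ∑ i ∈ A, (b.U i + b.K i) ≤ θ ^ 2)
    (h2 : 𝔼 X : Fin q → Fin ℓ → Fin 2, ∑ z,
      (block (superChannel W) X z - flatChannel W t X z) ≤ φ) :
    𝔼 c : Codebook b ℓ, ∑ z, |keyedLaw W c v z - blockLaw W q ℓ z| ≤ θ + 2 * φ := by
  have hdiff : ∀ z, 𝔼 c : Codebook b ℓ, (keyedLaw W c v z - flatKeyedLaw W t c v z) =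
      𝔼 X : Fin q → Fin ℓ → Fin 2, (block (superChannel W) X z - flatChannel W t X z) := by
    intro z
    simp only [keyedLaw, flatKeyedLaw, ← expect_sub_distrib]
    rw [expect_comm]
    refine (Finset.expect_congr rfl fun u _ => expect_comm _ _ _).trans ?_
    simp_rw [expect_encode _ _ fun X => blockChannel W X z - flatChannel W t X z]
    simp only [Fintype.expect_const]
    rfl
  have hflat : ∀ z, 𝔼 c : Codebook b ℓ, |flatKeyedLaw W t c v z - 𝔼 X, flatChannel W t X z| ≤
      blockLaw W q ℓ z * θ := by
    intro z
    have h0 := blockLaw_nonneg (ℓ := ℓ) hW z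
    refine le_of_sq_le_sq ?_ (mul_nonneg h0 hθ)
    have := expect_mul_sq_le_sq_mul_sq univ (fun _ : Codebook b ℓ => (1 : ℝ))
      (fun c => |flatKeyedLaw W t c v z - 𝔼 X, flatChannel W t X z|)
    simp only [one_mul, one_pow, Fintype.expect_const, sq_abs] at this
    refine this.trans ((expect_sq_flatKeyedLaw_sub_le hW v z).trans ?_)
    rw [mul_pow]
    gcongr
  -- The removed mass enters twice, in the codebook average and in the target law; this is the
  -- origin of `2 * φ`.
  have htri : ∀ (c : Codebook b ℓ) z, |keyedLaw W c v z - blockLaw W q ℓ z| ≤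
      (keyedLaw W c v z - flatKeyedLaw W t c v z) +
      |flatKeyedLaw W t c v z - 𝔼 X, flatChannel W t X z| +
      𝔼 X : Fin q → Fin ℓ → Fin 2, (block (superChannel W) X z - flatChannel W t X z) := by
    intro c z
    have e1 : 0 ≤ keyedLaw W c v z - flatKeyedLaw W t c v z := by
      simp only [keyedLaw, flatKeyedLaw, ← expect_sub_distrib]
      exact expect_nonneg fun u _ => expect_nonneg fun k _ => sub_nonneg.2 (flatChannel_le hW _ _)
    have e2 : 0 ≤ 𝔼 X : Fin q → Fin ℓ → Fin 2,
        (block (superChannel W) X z - flatChannel W t X z) :=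
      expect_nonneg fun X _ => sub_nonneg.2 (flatChannel_le hW _ _)
    have e3 : blockLaw W q ℓ z = (𝔼 X, flatChannel W t X z) + 𝔼 X : Fin q → Fin ℓ → Fin 2,
        (block (superChannel W) X z - flatChannel W t X z) := by
      rw [← expect_add_distrib, ← expect_block_eq]
      simp
    have e4 := abs_le.1 (le_refl |flatKeyedLaw W t c v z - 𝔼 X, flatChannel W t X z|)
    rw [abs_le]
    constructor <;> linarith
  rw [expect_sum_comm] at h2 ⊢
  calc ∑ z, 𝔼 c : Codebook b ℓ, |keyedLaw W c v z - blockLaw W q ℓ z|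
      ≤ ∑ z, (blockLaw W q ℓ z * θ + 2 * 𝔼 X : Fin q → Fin ℓ → Fin 2,
          (block (superChannel W) X z - flatChannel W t X z)) := by
        refine sum_le_sum fun z _ => (expect_le_expect fun c _ => htri c z).trans ?_
        rw [expect_add_distrib, expect_add_distrib, hdiff, Fintype.expect_const]
        linarith [hflat z]
    _ = θ + 2 * ∑ z, 𝔼 X : Fin q → Fin ℓ → Fin 2,
          (block (superChannel W) X z - flatChannel W t X z) := by
        rw [sum_add_distrib, ← sum_mul, sum_blockLaw hW, one_mul, mul_sum]
    _ ≤ _ := by linarith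

/-- The truncation slack `t = ε / (2 q)` uses half of the rate surplus `ε / q`; the other half
leaves `exp (-ℓ ε / (2 q))`. Rounding costs at most `2 ^ q`, the number of sets `A` another `2 ^ q`,
and the first summand is the square root of the product. -/
lemma expect_sum_abs_keyedLaw_sub_le_of_rates {Y : Type*} [Fintype Y] {P : Fin 2 → Y → ℝ}
    {Q : Fin 2 → Z → ℝ} {ε : ℝ} (hQ : ∀ a, Q a ∈ stdSimplex ℝ Z)
    (hac : ∀ y, Q 0 y = 0 → Q 1 y = 0) (hC1 : 1 ≤ C)
    (hC : ∀ y, Q 1 y / Q 0 y ≤ C ∧ (0 < Q 1 y / Q 0 y → C⁻¹ ≤ Q 1 y / Q 0 y)) (hq : 0 < q)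
    (hqC : 2 * Real.log C + 2 * q * Real.log 2 ≤ 2 * q) (hε : 0 ≤ ε)
    (v : Strings (mlcBits P Q ε q ℓ).V) :
    𝔼 c : Codebook (mlcBits P Q ε q ℓ) ℓ, ∑ z, |keyedLaw Q c v z - blockLaw Q q ℓ z| ≤
      2 ^ q * Real.exp (-(ℓ * ε / (4 * q))) +
        2 * (2 ^ q * Real.exp (-(ℓ * ε ^ 2 / (8 * q ^ 4)))) := by
  have hl : 0 < Real.log 2 := Real.log_pos one_lt_two
  have hq' : (0 : ℝ) < q := by exact_mod_cast hq
  refine expect_sum_abs_keyedLaw_sub_le hQ v (t := ε / (2 * q)) (by positivity) ?_ ?_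
  · have : ∀ A ∈ univ.erase (∅ : Finset (Fin q)),
        Real.exp (ℓ * (condMutualInfo Q A ∅ + ε / (2 * q))) /
          2 ^ ∑ i ∈ A, ((mlcBits P Q ε q ℓ).U i + (mlcBits P Q ε q ℓ).K i) ≤
        2 ^ q * Real.exp (-(ℓ * ε / (2 * q))) := by
      intro A hA
      have hA1 : (1 : ℝ) ≤ #A := by
        exact_mod_cast (nonempty_iff_ne_empty.2 (ne_of_mem_erase hA)).card_pos
      have hAq : (#A : ℝ) ≤ q := by
        exact_mod_cast (card_le_univ A).trans_eq (Fintype.card_fin q)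
      have e1 : (2 : ℝ) ^ ∑ i ∈ A, ((mlcBits P Q ε q ℓ).U i + (mlcBits P Q ε q ℓ).K i) =
          Real.exp (∑ i ∈ A, (((mlcBits P Q ε q ℓ).U i : ℝ) + (mlcBits P Q ε q ℓ).K i) *
            Real.log 2) := by
        rw [← sum_mul, mul_comm, Real.exp_mul, Real.exp_log two_pos, ← Real.rpow_natCast]
        push_cast
        rfl
      have e2 : (2 : ℝ) ^ q = Real.exp (q * Real.log 2) := by
        rw [mul_comm, Real.exp_mul, Real.exp_log two_pos, Real.rpow_natCast]
      rw [e1, e2, ← Real.exp_sub, ← Real.exp_add, Real.exp_le_exp]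
      have h1 : ∑ i ∈ A, (ℓ * (levelInfo Q i + ε / q) - Real.log 2) ≤
          ∑ i ∈ A, (((mlcBits P Q ε q ℓ).U i : ℝ) + (mlcBits P Q ε q ℓ).K i) * Real.log 2 :=
        sum_le_sum fun i _ => le_mlcBits_UK_mul_log i
      rw [sum_sub_distrib, ← mul_sum, sum_add_distrib, sum_const, sum_const, nsmul_eq_mul,
        nsmul_eq_mul] at h1
      have h2 := mul_le_mul_of_nonneg_left (le_sum_levelInfo hQ A) (Nat.cast_nonneg (α := ℝ) ℓ)
      have h3 : (ℓ : ℝ) * (ε / q) ≤ ℓ * (#A * (ε / q)) := by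
        gcongr
        exact le_mul_of_one_le_left (by positivity) hA1
      have h4 : (#A : ℝ) * Real.log 2 ≤ q * Real.log 2 := by gcongr
      have h5 : (ℓ : ℝ) * ε / (2 * q) = ℓ * (ε / q) / 2 := by field_simp
      have h6 : (ℓ : ℝ) * (ε / (2 * q)) = ℓ * (ε / q) / 2 := by field_simp
      rw [mul_add, h5, h6]
      linarith
    refine (sum_le_sum this).trans ?_
    rw [sum_const, nsmul_eq_mul]
    have hc : (#(univ.erase (∅ : Finset (Fin q))) : ℝ) ≤ 2 ^ q := by
      exact_mod_cast (card_le_univ _).trans_eq (by simp)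
    refine (mul_le_mul_of_nonneg_right hc (by positivity)).trans_eq ?_
    rw [mul_pow, ← Real.exp_nat_mul]
    have : ((2 : ℕ) : ℝ) * -(ℓ * ε / (4 * q)) = -(ℓ * ε / (2 * q)) := by
      push_cast
      field_simp
      ring
    rw [this]
    ring
  · refine (expect_sub_flatChannel_le hQ hac hC1 hC hq hqC (by positivity)).trans_eq ?_
    congr 3
    field_simp
    norm_num

end Resolvability

/-! ### Uniformity of the keys -/

section Keys

/-- Translation by a preimage of `b` shows that the mean of `g (φ a + b)` over `a` does not depend
on `b`; averaging over `b` first gives the uniform mean. -/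
lemma expect_comp_surjective {A B : Type*} [Fintype A] [Fintype B] [AddGroup A] [AddGroup B]
    (φ : A →+ B) (hφ : Function.Surjective φ) (g : B → ℝ) : 𝔼 a, g (φ a) = 𝔼 b, g b := by
  have h : ∀ b, 𝔼 a, g (φ a + b) = 𝔼 a, g (φ a) := by
    intro b
    obtain ⟨a₀, rfl⟩ := hφ b
    exact Fintype.expect_equiv (Equiv.addRight a₀) _ _ fun a => by simp
  calc 𝔼 a, g (φ a) = 𝔼 b : B, 𝔼 a, g (φ a + b) := by simp [h]
    _ = 𝔼 a, 𝔼 b, g (φ a + b) := expect_comm _ _ _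
    _ = 𝔼 _a : A, 𝔼 b, g b := by
        refine Finset.expect_congr rfl fun a _ => ?_
        exact Fintype.expect_equiv (Equiv.addLeft (φ a)) _ _ fun b => by simp
    _ = _ := by simp

variable {q : ℕ} {b : LevelBits q}

/-- The bits are only selected and rearranged, so `nextKey` is a homomorphism; with surjectivity it
sends uniform bits to uniform keys. -/
lemma nextKey_add (v v' : Strings b.V) (f f' : Fin ((∑ i, b.K i) - ∑ i, b.V i) → Fin 2) :
    nextKey (v + v') (f + f') = nextKey v f + nextKey v' f' := by
  ext i a : 2
  simp only [nextKey, Pi.add_apply]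
  split_ifs <;> rfl

lemma nextKey_surjective (k : Strings b.K) :
    ∃ (v : Strings b.V) (f : Fin ((∑ i, b.K i) - ∑ i, b.V i) → Fin 2), nextKey v f = k := by
  -- The bits of `k` as one sequence, continued by `0`: secret bits in excess of the key length are
  -- not used and may be arbitrary.
  let g : ℕ → Fin 2 := fun n => if h : n < ∑ i, b.K i then
    k (finSigmaFinEquiv.symm ⟨n, h⟩).1 (finSigmaFinEquiv.symm ⟨n, h⟩).2 else 0
  have hg : ∀ i a, g (finSigmaFinEquiv ⟨i, a⟩ : Fin (∑ i, b.K i)).val = k i a := by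
    intro i a
    have hk : ∀ p p' : Σ i, Fin (b.K i), p = p' → k p.1 p.2 = k p'.1 p'.2 := by
      rintro _ _ rfl
      rfl
    simp only [g, dif_pos (finSigmaFinEquiv (⟨i, a⟩ : Σ i, Fin (b.K i))).2]
    exact hk _ ⟨i, a⟩ (by rw [Fin.eta, Equiv.symm_apply_apply])
  refine ⟨fun i a => g (finSigmaFinEquiv ⟨i, a⟩ : Fin (∑ i, b.V i)).val,
    fun j => g (j.val + ∑ i, b.V i), ?_⟩
  ext i a : 2
  rw [nextKey, ← hg i a]
  split_ifs with h
  · simp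
  · simp only
    congr 1
    omega

/-- The key of a block formed from a uniform secret message and uniform fresh bits is uniform. -/
lemma expect_nextKey (g : Strings b.K → ℝ) :
    𝔼 v : Strings b.V, 𝔼 f, g (nextKey v f) = 𝔼 k, g k := by
  let φ : Strings b.V × (Fin ((∑ i, b.K i) - ∑ i, b.V i) → Fin 2) →+ Strings b.K :=
    AddMonoidHom.mk' (fun p => nextKey p.1 p.2) fun p p' => nextKey_add _ _ _ _
  have h := expect_comp_surjective φ (fun k => by
    obtain ⟨v, f, h⟩ := nextKey_surjective k
    exact ⟨(v, f), h⟩) g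
  rw [← univ_product_univ, expect_product] at h
  exact h

end Keys

/-! ### Resolvability of the chain -/

section ChainResolvability

lemma expect_cons {β : Type*} [Fintype β] {N : ℕ} (g : (Fin (N + 1) → β) → ℝ) :
    𝔼 w, g w = 𝔼 a, 𝔼 w, g (Fin.cons a w) := by
  rw [← expect_product', univ_product_univ]
  exact (Fintype.expect_equiv (Fin.consEquiv fun _ => β) _ _ fun p => rfl).symm

lemma sum_cons {β : Type*} [Fintype β] {N : ℕ} (g : (Fin (N + 1) → β) → ℝ) :
    ∑ w, g w = ∑ a, ∑ w, g (Fin.cons a w) := by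
  rw [← Fintype.sum_prod_type']
  exact (Fintype.sum_equiv (Fin.consEquiv fun _ => β) _ _ fun p => rfl).symm

variable {Z : Type*} [Fintype Z] {W : Fin 2 → Z → ℝ} {q ℓ N : ℕ} {b : LevelBits q}

/-- The output distribution of the chain, given the key of the first block. -/
def keyedChainLaw (W : Fin 2 → Z → ℝ) (c : Codebook b ℓ) (N : ℕ) (k : Strings b.K)
    (z : Fin (N + 1) → Fin ℓ → Fin (2 ^ q) → Z) : ℝ :=
  𝔼 w : ChainMessage b N, 𝔼 f : Fin N → Fin ((∑ i, b.K i) - ∑ i, b.V i) → Fin 2,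
    chainChannel W c w (k, f) z

omit [Fintype Z] in
lemma outputLaw_eq_expect (c : Codebook b ℓ) (N : ℕ) (z : Fin (N + 1) → Fin ℓ → Fin (2 ^ q) → Z) :
    outputLaw W c N z = 𝔼 k, keyedChainLaw W c N k z := by
  unfold keyedChainLaw
  rw [expect_comm]
  have : ∀ w : ChainMessage b N, 𝔼 k, 𝔼 f, chainChannel W c w (k, f) z =
      𝔼 s : SharedKey b N, chainChannel W c w s z := fun w => by
    rw [← expect_product', univ_product_univ]
  simp_rw [this, Fintype.expect_eq_sum_div_card, ← sum_div]
  rw [div_div, mul_comm, outputLaw]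

lemma chainChannel_nonneg (hW : ∀ a, W a ∈ stdSimplex ℝ Z) (c : Codebook b ℓ)
    (w : ChainMessage b N) (s : SharedKey b N) (z : Fin (N + 1) → Fin ℓ → Fin (2 ^ q) → Z) :
    0 ≤ chainChannel W c w s z :=
  prod_nonneg fun _ _ => (isChannel_block (isChannel_superChannel hW)).nonneg _ _

lemma sum_chainChannel (hW : ∀ a, W a ∈ stdSimplex ℝ Z) (c : Codebook b ℓ)
    (w : ChainMessage b N) (s : SharedKey b N) : ∑ z, chainChannel W c w s z = 1 := by
  unfold chainChannel
  rw [sum_prod fun j z => blockChannel W (encode c (w j) (chainKeys w s j)) z]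
  exact prod_eq_one fun j _ => (isChannel_block (isChannel_superChannel hW)).sum_eq_one _

lemma keyedChainLaw_nonneg (hW : ∀ a, W a ∈ stdSimplex ℝ Z) (c : Codebook b ℓ) (k : Strings b.K)
    (z : Fin (N + 1) → Fin ℓ → Fin (2 ^ q) → Z) : 0 ≤ keyedChainLaw W c N k z :=
  expect_nonneg fun _ _ => expect_nonneg fun _ _ => chainChannel_nonneg hW _ _ _ _

lemma sum_keyedChainLaw (hW : ∀ a, W a ∈ stdSimplex ℝ Z) (c : Codebook b ℓ) (k : Strings b.K) :
    ∑ z, keyedChainLaw W c N k z = 1 := by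
  simp_rw [keyedChainLaw, ← expect_sum_comm, sum_chainChannel hW]
  simp

omit [Fintype Z] in
lemma keyedChainLaw_zero (c : Codebook b ℓ) (k : Strings b.K) (z₀ : Fin ℓ → Fin (2 ^ q) → Z)
    (z : Fin 0 → Fin ℓ → Fin (2 ^ q) → Z) : keyedChainLaw W c 0 k (Fin.cons z₀ z) =
      𝔼 w : Message b, blockChannel W (encode c w k) z₀ := by
  rw [keyedChainLaw, expect_cons]
  simp [chainChannel, chainKeys]

lemma chainKeys_cons_succ (w₀ : Message b) (w : ChainMessage b N) (k : Strings b.K)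
    (f₀ : Fin ((∑ i, b.K i) - ∑ i, b.V i) → Fin 2)
    (f : Fin N → Fin ((∑ i, b.K i) - ∑ i, b.V i) → Fin 2) (j : Fin (N + 1)) :
    chainKeys (N := N + 1) (Fin.cons w₀ w : Fin (N + 2) → Message b)
      (k, (Fin.cons f₀ f : Fin (N + 1) → _)) j.succ = chainKeys w (nextKey w₀.2 f₀, f) j := by
  cases j using Fin.cases with
  | zero => simp only [chainKeys, Fin.cases_succ, Fin.cases_zero, Fin.castSucc_zero, Fin.cons_zero]
  | succ j =>
    simp only [chainKeys, Fin.cases_succ, Fin.cons_succ, ← Fin.succ_castSucc]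

omit [Fintype Z] in
lemma chainChannel_cons (c : Codebook b ℓ) (w₀ : Message b) (w : ChainMessage b N)
    (k : Strings b.K) (f₀ : Fin ((∑ i, b.K i) - ∑ i, b.V i) → Fin 2)
    (f : Fin N → Fin ((∑ i, b.K i) - ∑ i, b.V i) → Fin 2) (z₀ : Fin ℓ → Fin (2 ^ q) → Z)
    (z : Fin (N + 1) → Fin ℓ → Fin (2 ^ q) → Z) :
    chainChannel (N := N + 1) W c (Fin.cons w₀ w : Fin (N + 2) → Message b)
      (k, (Fin.cons f₀ f : Fin (N + 1) → _)) (Fin.cons z₀ z) =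
      blockChannel W (encode c w₀ k) z₀ * chainChannel W c w (nextKey w₀.2 f₀, f) z := by
  unfold chainChannel
  rw [Fin.prod_univ_succ]
  simp only [chainKeys_cons_succ, Fin.cons_zero, Fin.cons_succ]
  rfl

omit [Fintype Z] in
-- The later blocks depend on the first one only through its secret message, which enters their
-- first key.
lemma keyedChainLaw_succ (c : Codebook b ℓ) (k : Strings b.K) (z₀ : Fin ℓ → Fin (2 ^ q) → Z)
    (z : Fin (N + 1) → Fin ℓ → Fin (2 ^ q) → Z) :
    keyedChainLaw W c (N + 1) k (Fin.cons z₀ z) = 𝔼 w : Message b,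
      blockChannel W (encode c w k) z₀ * 𝔼 f, keyedChainLaw W c N (nextKey w.2 f) z := by
  have h : ∀ w₀ : Message b, 𝔼 w : ChainMessage b N,
      𝔼 f : Fin (N + 1) → Fin ((∑ i, b.K i) - ∑ i, b.V i) → Fin 2,
        chainChannel (N := N + 1) W c (Fin.cons w₀ w : Fin (N + 2) → Message b) (k, f)
          (Fin.cons z₀ z) =
      blockChannel W (encode c w₀ k) z₀ * 𝔼 f, keyedChainLaw W c N (nextKey w₀.2 f) z := by
    intro w₀
    rw [Finset.expect_congr rfl fun w _ => expect_cons _]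
    simp only [chainChannel_cons, ← mul_expect, keyedChainLaw]
    rw [expect_comm]
  rw [← Finset.expect_congr rfl fun w₀ _ => h w₀]
  exact expect_cons fun w : Fin (N + 2) → Message b =>
    𝔼 f, chainChannel (N := N + 1) W c w (k, f) (Fin.cons z₀ z)

/-- Distance from uniform outputs of one block, given the secret message. -/
def leakage (W : Fin 2 → Z → ℝ) (c : Codebook b ℓ) : ℝ :=
  𝔼 v, ∑ z, |keyedLaw W c v z - blockLaw W q ℓ z|

omit [Fintype Z] in
lemma expect_message (g : Strings b.U → Strings b.V → ℝ) :
    𝔼 w : Message b, g w.1 w.2 = 𝔼 v, 𝔼 u, g u v := by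
  rw [expect_comm, ← expect_product', univ_product_univ]

/-- Induction that removes the first block. Given its `v`, its output law is replaced by `blockLaw`
at the cost of one `leakage`; after that it no longer depends on `v`, and averaging the rest over
`v` yields a chain with one block less. -/
lemma sum_abs_outputLaw_sub_le (hW : ∀ a, W a ∈ stdSimplex ℝ Z) (c : Codebook b ℓ) (N : ℕ) :
    ∑ z, |outputLaw W c N z - ∏ j, blockLaw W q ℓ (z j)| ≤ (N + 1) * leakage W c := by
  have hkeyed : ∀ (h : Strings b.V → ℝ) z₀, 𝔼 k, 𝔼 w : Message b,
      blockChannel W (encode c w k) z₀ * h w.2 = 𝔼 v, keyedLaw W c v z₀ * h v := by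
    intro h z₀
    rw [Finset.expect_congr rfl fun k _ =>
      expect_message fun u v => blockChannel W (encode c (u, v) k) z₀ * h v]
    rw [expect_comm]
    refine Finset.expect_congr rfl fun v _ => ?_
    rw [keyedLaw, expect_comm, expect_mul]
    simp_rw [expect_mul]
  induction N with
  | zero =>
    rw [sum_cons]
    simp only [outputLaw_eq_expect, keyedChainLaw_zero, univ_unique, Fin.prod_univ_succ,
      Fin.cons_zero, sum_singleton]
    rw [leakage, expect_sum_comm]
    simp only [CharP.cast_eq_zero, zero_add, one_mul, prod_of_isEmpty, mul_one]
    refine sum_le_sum fun z₀ _ => ?_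
    have := hkeyed (fun _ => 1) z₀
    simp only [mul_one] at this
    rw [this]
    refine le_of_eq_of_le ?_ (abs_expect_le _ _)
    rw [expect_sub_distrib, Fintype.expect_const]
  | succ N ih =>
    rw [sum_cons]
    set G : Strings b.V → (Fin (N + 1) → Fin ℓ → Fin (2 ^ q) → Z) → ℝ := fun v z =>
      𝔼 f, keyedChainLaw W c N (nextKey v f) z with hG
    have hG0 : ∀ v z, 0 ≤ G v z := fun v z => expect_nonneg fun f _ => keyedChainLaw_nonneg hW _ _ _
    have hG1 : ∀ v, ∑ z, G v z = 1 := fun v => by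
      simp_rw [hG, ← expect_sum_comm, sum_keyedChainLaw hW]
      simp
    -- A uniform `v` completed by fresh bits is a uniform key, like the one shared for a first
    -- block.
    have hGm : ∀ z, 𝔼 v, G v z = outputLaw W c N z := fun z => by
      rw [outputLaw_eq_expect, ← expect_nextKey]
    have hout : ∀ z₀ z, outputLaw W c (N + 1) (Fin.cons z₀ z) =
        𝔼 v, keyedLaw W c v z₀ * G v z := fun z₀ z => by
      rw [outputLaw_eq_expect]
      simp_rw [keyedChainLaw_succ]
      exact hkeyed (fun v => G v z) z₀
    have hpt : ∀ z₀ z, |outputLaw W c (N + 1) (Fin.cons z₀ z) -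
        ∏ j, blockLaw W q ℓ ((Fin.cons z₀ z : Fin (N + 2) → Fin ℓ → Fin (2 ^ q) → Z) j)| ≤
        (𝔼 v, |keyedLaw W c v z₀ - blockLaw W q ℓ z₀| * G v z) +
          blockLaw W q ℓ z₀ * |outputLaw W c N z - ∏ j, blockLaw W q ℓ (z j)| := by
      intro z₀ z
      have e : outputLaw W c (N + 1) (Fin.cons z₀ z) -
          ∏ j, blockLaw W q ℓ ((Fin.cons z₀ z : Fin (N + 2) → Fin ℓ → Fin (2 ^ q) → Z) j) =
          (𝔼 v, (keyedLaw W c v z₀ - blockLaw W q ℓ z₀) * G v z) +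
          blockLaw W q ℓ z₀ * (outputLaw W c N z - ∏ j, blockLaw W q ℓ (z j)) := by
        rw [Fin.prod_univ_succ, hout]
        simp only [Fin.cons_zero, Fin.cons_succ, sub_mul, expect_sub_distrib, ← mul_expect, hGm]
        ring
      rw [e]
      refine (abs_add_le _ _).trans (add_le_add ((abs_expect_le _ _).trans_eq ?_) ?_)
      · refine Finset.expect_congr rfl fun v _ => ?_
        rw [abs_mul, abs_of_nonneg (hG0 v z)]
      · rw [abs_mul, abs_of_nonneg (blockLaw_nonneg hW z₀)]
    refine (sum_le_sum fun z₀ _ => sum_le_sum fun z _ => hpt z₀ z).trans ?_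
    simp_rw [sum_add_distrib, ← mul_sum, ← expect_sum_comm, ← mul_sum, hG1, mul_one]
    rw [← sum_mul, sum_blockLaw hW, one_mul]
    have : 𝔼 v, ∑ z₀, |keyedLaw W c v z₀ - blockLaw W q ℓ z₀| = leakage W c := rfl
    rw [this]
    push_cast
    linarith

end ChainResolvability

/-! ### Relative entropy of finite distributions -/

section Entropy

variable {α : Type*} [Fintype α]

/-- Relative entropy as a finite sum. -/
def kl (p r : α → ℝ) : ℝ := ∑ a, p a * Real.log (p a / r a)

open MeasureTheory in
lemma sumDirac_eq_withDensity [MeasurableSpace α] [DiscreteMeasurableSpace α] {p r : α → ℝ}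
    (hr : ∀ a, 0 ≤ r a) (hac : ∀ a, r a = 0 → p a = 0) :
    sumDirac p = (sumDirac r).withDensity fun a => ENNReal.ofReal (p a / r a) := by
  ext s hs
  rw [withDensity_apply _ hs, sumDirac_apply, ← lintegral_indicator hs, sumDirac,
    lintegral_finsetSum_measure]
  refine sum_congr rfl fun a _ => ?_
  rw [lintegral_smul_measure, lintegral_dirac]
  by_cases ha : a ∈ s
  · simp only [ha, Set.indicator_of_mem, Pi.one_apply, mul_one, smul_eq_mul]
    rw [← ENNReal.ofReal_mul (hr a)]
    congr 1
    by_cases h : r a = 0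
    · simp [h, hac a h]
    · field_simp
  · simp [ha]

lemma relEntropy_eq {p r : α → ℝ} (hp : ∀ a, 0 ≤ p a) (hr : ∀ a, 0 ≤ r a) (hp1 : ∑ a, p a = 1)
    (hr1 : ∑ a, r a = 1) (hac : ∀ a, r a = 0 → p a = 0) :
    relEntropy p r = ENNReal.ofReal (kl p r) := by
  let _ : MeasurableSpace α := ⊤
  have e1 : relEntropy p r = InformationTheory.klDiv (sumDirac p) (sumDirac r) := rfl
  have := isProbabilityMeasure_sumDirac hp hp1
  have := isProbabilityMeasure_sumDirac hr hr1
  have hd := sumDirac_eq_withDensity hr hac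
  have hμν : (sumDirac p).AbsolutelyContinuous (sumDirac r) := by
    rw [hd]
    exact MeasureTheory.withDensity_absolutelyContinuous _ _
  have hfin := InformationTheory.klDiv_ne_top hμν
    (MeasureTheory.Integrable.of_finite (f := MeasureTheory.llr (sumDirac p) (sumDirac r)))
  have hrn : ∀ᵐ a ∂(sumDirac p), (sumDirac p).rnDeriv (sumDirac r) a =
      ENNReal.ofReal (p a / r a) := by
    refine hμν.ae_le ?_
    have := MeasureTheory.Measure.rnDeriv_withDensity (sumDirac r)
      (f := fun a => ENNReal.ofReal (p a / r a)) (measurable_of_finite _)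
    rw [← hd] at this
    exact this
  rw [e1, ← ENNReal.ofReal_toReal hfin,
    InformationTheory.toReal_klDiv_of_measure_eq hμν (by simp)]
  congr 1
  rw [kl, ← integral_sumDirac hp fun a => Real.log (p a / r a)]
  refine MeasureTheory.integral_congr_ae ?_
  filter_upwards [hrn] with a ha
  rw [MeasureTheory.llr, ha, ENNReal.toReal_ofReal (div_nonneg (hp a) (hr a))]

lemma kl_nonneg {p r : α → ℝ} (hp : ∀ a, 0 ≤ p a) (hr : ∀ a, 0 ≤ r a) (hp1 : ∑ a, p a = 1)
    (hr1 : ∑ a, r a = 1) (hac : ∀ a, r a = 0 → p a = 0) : 0 ≤ kl p r := by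
  have : ∑ a, (p a - r a) ≤ kl p r := by
    refine sum_le_sum fun a _ => ?_
    rcases (hp a).lt_or_eq with h | h
    · have hra : 0 < r a := lt_of_le_of_ne (hr a) fun h' => h.ne' (hac a h'.symm)
      have h1 := Real.one_sub_inv_le_log_of_pos (div_pos h hra)
      have h2 := mul_le_mul_of_nonneg_left h1 h.le
      refine le_trans (le_of_eq ?_) h2
      field_simp
    · rw [← h]
      simp [hr a]
  rw [sum_sub_distrib, hp1, hr1, sub_self] at this
  exact this

/-- Continuity of the relative entropy in its first argument, for bounded likelihood ratios. -/
lemma kl_le_kl_add {p p' r : α → ℝ} {M L : ℝ} (hp : ∀ a, 0 ≤ p a) (hp' : ∀ a, 0 ≤ p' a)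
    (hr : ∀ a, 0 ≤ r a) (hac : ∀ a, r a = 0 → p' a = 0) (hM1 : 1 ≤ M)
    (hM : ∀ a, p a ≤ M * p' a) (hL : ∀ a, 0 < p' a → |Real.log (p' a / r a)| ≤ L) :
    kl p r ≤ kl p' r + (∑ a, |p a - p' a|) * (1 + Real.log M + L) := by
  have hlM : 0 ≤ Real.log M := Real.log_nonneg hM1
  rw [kl, kl, sum_mul, ← sum_add_distrib]
  refine sum_le_sum fun a _ => ?_
  rcases (hp' a).lt_or_eq with h' | h'
  · have hra : 0 < r a := lt_of_le_of_ne (hr a) fun h => h'.ne' (hac a h.symm)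
    have h1 : (p a - p' a) * Real.log (p' a / r a) ≤ |p a - p' a| * L := by
      refine (le_abs_self _).trans ?_
      rw [abs_mul]
      exact mul_le_mul_of_nonneg_left (hL a h') (abs_nonneg _)
    rcases (hp a).lt_or_eq with h | h
    · have h2 : p a * Real.log (p a / p' a) ≤ |p a - p' a| * (1 + Real.log M) := by
        rcases le_total (p' a) (p a) with hle | hle
        · rw [abs_of_nonneg (sub_nonneg.2 hle)]
          have e1 : p' a * Real.log (p a / p' a) ≤ p a - p' a := by
            have := mul_le_mul_of_nonneg_left (Real.log_le_sub_one_of_pos (div_pos h h')) h'.le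
            refine this.trans_eq ?_
            field_simp
          have e2 : (p a - p' a) * Real.log (p a / p' a) ≤ (p a - p' a) * Real.log M :=
            mul_le_mul_of_nonneg_left (Real.log_le_log (div_pos h h')
              ((div_le_iff₀ h').2 (hM a))) (sub_nonneg.2 hle)
          linarith
        · refine (mul_nonpos_of_nonneg_of_nonpos h.le (Real.log_nonpos (by positivity)
            ((div_le_one h').2 hle))).trans (by positivity)
      rw [Real.log_div h.ne' h'.ne'] at h2
      rw [Real.log_div h'.ne' hra.ne'] at h1 ⊢
      rw [Real.log_div h.ne' hra.ne']
      linarith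
    · rw [← h] at h1 ⊢
      have : 0 ≤ |0 - p' a| * (1 + Real.log M) := by positivity
      simp only [zero_mul]
      linarith
  · have : p a = 0 := le_antisymm ((hM a).trans_eq (by rw [← h', mul_zero])) (hp a)
    simp [this, ← h']

lemma sum_prod_mul_apply {κ : Type*} [Fintype κ] [DecidableEq κ] (p : κ → α → ℝ)
    (hp : ∀ s, ∑ a, p s a = 1) (s₀ : κ) (h : α → ℝ) :
    ∑ z : κ → α, (∏ s, p s (z s)) * h (z s₀) = ∑ a, p s₀ a * h a := by
  have e : ∀ z : κ → α, (∏ s, p s (z s)) * h (z s₀) =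
      ∏ s, p s (z s) * (if s = s₀ then h (z s) else 1) := fun z => by
    rw [prod_mul_distrib, prod_ite_eq']
    simp
  simp_rw [e]
  rw [sum_prod fun s a => p s a * (if s = s₀ then h a else 1), prod_eq_single s₀]
  · simp
  · intro s _ hs
    simp [hs, hp]
  · simp

lemma kl_prod {κ : Type*} [Fintype κ] [DecidableEq κ] {p r : α → ℝ}
    (hp1 : ∑ a, p a = 1) (hac : ∀ a, r a = 0 → p a = 0) :
    kl (fun z : κ → α => ∏ s, p (z s)) (fun z => ∏ s, r (z s)) = Fintype.card κ * kl p r := by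
  have e : ∀ z : κ → α, (∏ s, p (z s)) * Real.log ((∏ s, p (z s)) / ∏ s, r (z s)) =
      ∑ s₀, (∏ s, p (z s)) * Real.log (p (z s₀) / r (z s₀)) := fun z => by
    rw [← mul_sum]
    by_cases h : ∏ s, p (z s) = 0
    · simp [h]
    · rw [← prod_div_distrib, Real.log_prod]
      intro s _
      have hs : p (z s) ≠ 0 := fun h' => h (prod_eq_zero (mem_univ s) h')
      exact div_ne_zero hs fun h' => hs (hac _ h')
  rw [kl, sum_congr rfl fun z _ => e z, sum_comm]
  rw [sum_congr rfl fun s₀ _ => sum_prod_mul_apply (fun _ => p) (fun _ => hp1) s₀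
    fun a => Real.log (p a / r a)]
  simp [kl]

end Entropy

/-! ### Moments of sums of independent variables -/

section Moments

variable {α : Type*} [Fintype α]

lemma sum_mul_add_pow {β : Type*} [Fintype β] (w g : α → ℝ) (v S : β → ℝ) (k : ℕ) :
    ∑ a, ∑ z, w a * v z * (g a + S z) ^ k =
      ∑ j ∈ range (k + 1), (∑ a, w a * g a ^ j) * (∑ z, v z * S z ^ (k - j)) * k.choose j := by
  simp_rw [add_pow, mul_sum]
  rw [sum_congr rfl fun a _ => sum_comm, sum_comm]
  refine sum_congr rfl fun j _ => ?_
  rw [← mul_sum, sum_mul_sum, sum_mul]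
  refine sum_congr rfl fun a _ => ?_
  rw [sum_mul]
  exact sum_congr rfl fun z _ => by ring

/-- One independent centred variable is added at a time, with a binomial expansion of the power. The
fourth moment needs the three lower ones in the induction. -/
lemma moments {w g : α → ℝ} (h0 : ∑ a, w a = 1) (h1 : ∑ a, w a * g a = 0) (n : ℕ) :
    ∑ z : Fin n → α, ∏ t, w (z t) = 1 ∧
    ∑ z : Fin n → α, (∏ t, w (z t)) * ∑ t, g (z t) = 0 ∧
    ∑ z : Fin n → α, (∏ t, w (z t)) * (∑ t, g (z t)) ^ 2 = n * ∑ a, w a * g a ^ 2 ∧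
    ∑ z : Fin n → α, (∏ t, w (z t)) * (∑ t, g (z t)) ^ 3 = n * ∑ a, w a * g a ^ 3 ∧
    ∑ z : Fin n → α, (∏ t, w (z t)) * (∑ t, g (z t)) ^ 4 =
      n * (∑ a, w a * g a ^ 4) + 3 * n * (n - 1) * (∑ a, w a * g a ^ 2) ^ 2 := by
  induction n with
  | zero => simp
  | succ n ih =>
    obtain ⟨i0, i1, i2, i3, i4⟩ := ih
    have key : ∀ k, ∑ z : Fin (n + 1) → α, (∏ t, w (z t)) * (∑ t, g (z t)) ^ k =
        ∑ j ∈ range (k + 1), (∑ a, w a * g a ^ j) *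
          (∑ z : Fin n → α, (∏ t, w (z t)) * (∑ t, g (z t)) ^ (k - j)) * k.choose j := by
      intro k
      rw [← sum_mul_add_pow, sum_cons]
      simp [Fin.prod_univ_succ, Fin.sum_univ_succ]
    have k0 := key 0
    have k1 := key 1
    have k2 := key 2
    have k3 := key 3
    have k4 := key 4
    simp only [sum_range_succ, range_zero, sum_empty, pow_zero, mul_one, pow_one, h0, h1, i0, i1,
      i2, i3, i4, Nat.choose, zero_add, Nat.sub_zero, Nat.sub_self, Nat.reduceSub] at k0 k1 k2 k3 k4
    refine ⟨k0.trans ?_, k1.trans ?_, k2.trans ?_, k3.trans ?_, k4.trans ?_⟩ <;> push_cast <;> ring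

end Moments

/-! ### The PPM output distribution -/

section PPM

/-- The difference of the sides has derivative `(x - 1) ^ 3 / x`, hence its minimum at `1`. -/
lemma log_le_cubic {x : ℝ} (hx : 0 < x) :
    Real.log x ≤ (x - 1) - (x - 1) ^ 2 / 2 + (x - 1) ^ 3 / 3 := by
  set f : ℝ → ℝ := fun x => (x - 1) - (x - 1) ^ 2 / 2 + (x - 1) ^ 3 / 3 - Real.log x with hf
  have hd : ∀ y, 0 < y → HasDerivAt f ((y - 1) ^ 3 / y) y := by
    intro y hy
    have h1 : HasDerivAt (fun x : ℝ => x - 1) 1 y := (hasDerivAt_id y).sub_const 1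
    have := ((h1.sub ((h1.pow 2).div_const 2)).add ((h1.pow 3).div_const 3)).sub
      (Real.hasDerivAt_log hy.ne')
    refine this.congr_deriv ?_
    field_simp
    ring
  have hf1 : f 1 = 0 := by simp [hf]
  suffices h : f 1 ≤ f x by
    rw [hf1] at h
    simp only [hf] at h
    linarith
  rcases le_total 1 x with h | h
  · refine monotoneOn_of_deriv_nonneg (convex_Ici 1)
      (fun y hy => (hd y (lt_of_lt_of_le one_pos hy)).continuousAt.continuousWithinAt)
      (fun y hy => ?_) (fun y hy => ?_) (Set.self_mem_Ici) h h
    all_goals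
      rw [interior_Ici] at hy
      have hy0 : 0 < y := one_pos.trans hy
    · exact (hd y hy0).differentiableAt.differentiableWithinAt
    · rw [(hd y hy0).deriv]
      have : 0 ≤ y - 1 := sub_nonneg.2 (le_of_lt hy)
      positivity
  · refine antitoneOn_of_deriv_nonpos (convex_Ioc 0 1)
      (fun y hy => (hd y hy.1).continuousAt.continuousWithinAt)
      (fun y hy => ?_) (fun y hy => ?_) ⟨hx, h⟩ ⟨one_pos, le_rfl⟩ h
    all_goals rw [interior_Ioc] at hy
    · exact (hd y hy.1).differentiableAt.differentiableWithinAt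
    · rw [(hd y hy.1).deriv]
      refine div_nonpos_of_nonpos_of_nonneg ?_ hy.1.le
      exact (Odd.pow_nonpos (by decide) (by linarith [hy.2]))

lemma mul_log_le {x : ℝ} (hx : 0 ≤ x) :
    x * Real.log x ≤ (x - 1) + (x - 1) ^ 2 / 2 - (x - 1) ^ 3 / 6 + (x - 1) ^ 4 / 3 := by
  rcases hx.lt_or_eq with h | h
  · refine (mul_le_mul_of_nonneg_left (log_le_cubic h) hx).trans_eq ?_
    ring
  · rw [← h]
    norm_num

variable {Z : Type*} [Fintype Z] {W : Fin 2 → Z → ℝ} {q : ℕ}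

/-- The law of `2 ^ q` channel uses with input `0`. -/
def zeroLaw (W : Fin 2 → Z → ℝ) (q : ℕ) (z : Fin (2 ^ q) → Z) : ℝ := ∏ t, W 0 (z t)

lemma zeroLaw_nonneg (hW : ∀ a, W a ∈ stdSimplex ℝ Z) (z : Fin (2 ^ q) → Z) :
    0 ≤ zeroLaw W q z := prod_nonneg fun _ _ => (hW 0).1 _

lemma sum_zeroLaw (hW : ∀ a, W a ∈ stdSimplex ℝ Z) : ∑ z, zeroLaw W q z = 1 := by
  unfold zeroLaw
  rw [sum_prod fun _ a => W 0 a]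
  exact prod_eq_one fun _ _ => (hW 0).2

omit [Fintype Z] in
lemma meanLaw_eq (hac : ∀ y, W 0 y = 0 → W 1 y = 0) (z : Fin (2 ^ q) → Z) :
    meanLaw W q z = zeroLaw W q z * ((∑ t, W 1 (z t) / W 0 (z t)) / 2 ^ q) := by
  unfold meanLaw
  simp_rw [superChannel_eq W _ z hac]
  rw [← mul_expect, zeroLaw]
  congr 1
  rw [Fintype.expect_equiv finFunctionFinEquiv _ (fun t => W 1 (z t) / W 0 (z t)) fun x => rfl,
    Fintype.expect_eq_sum_div_card]
  simp

omit [Fintype Z] in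
lemma meanLaw_eq_zero (hac : ∀ y, W 0 y = 0 → W 1 y = 0) (z : Fin (2 ^ q) → Z)
    (h : zeroLaw W q z = 0) : meanLaw W q z = 0 := by
  rw [meanLaw_eq hac, h, zero_mul]

/-- The density of the PPM output law minus one is `S / m`, with `S` a sum of `m` independent
centred variables under zero input. In `mul_log_le` the first moment vanishes, the second gives `χ₂
/ (2 m)`, and the third and fourth moments, `O(m)` and `O(m ^ 2)`, are divided by `m ^ 3` and `m ^
4`. -/
lemma exists_kl_meanLaw_le (hW : ∀ a, W a ∈ stdSimplex ℝ Z)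
    (hac : ∀ y, W 0 y = 0 → W 1 y = 0) :
    ∃ K, 0 ≤ K ∧ ∀ q : ℕ, kl (meanLaw W q) (zeroLaw W q) ≤
      chiTwo (W 1) (W 0) / (2 * 2 ^ q) + K / (2 ^ q) ^ 2 := by
  set g : Z → ℝ := fun a => W 1 a / W 0 a - 1 with hg
  have hr : ∀ a, W 0 a * (W 1 a / W 0 a) = W 1 a := fun a => by
    by_cases h : W 0 a = 0
    · simp [h, hac a h]
    · field_simp
  have h1 : ∑ a, W 0 a * g a = 0 := by
    simp only [hg, mul_sub, hr, sum_sub_distrib, mul_one, (hW 0).2, (hW 1).2, sub_self]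
  have h2 : ∑ a, W 0 a * g a ^ 2 = chiTwo (W 1) (W 0) := by
    refine sum_congr rfl fun a _ => ?_
    by_cases h : W 0 a = 0
    · simp [h]
    · simp only [hg]
      field_simp
  set a3 := ∑ a, W 0 a * g a ^ 3
  set a4 := ∑ a, W 0 a * g a ^ 4
  set χ := chiTwo (W 1) (W 0)
  have ha4 : 0 ≤ a4 := sum_nonneg fun a _ => mul_nonneg ((hW 0).1 a) (by positivity)
  refine ⟨|a3| / 6 + (a4 + 3 * χ ^ 2) / 3, by positivity, fun q => ?_⟩
  set m : ℝ := 2 ^ q with hm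
  have hm1 : 1 ≤ m := one_le_pow₀ one_le_two
  have hm0 : 0 < m := by linarith
  obtain ⟨-, m1, m2, m3, m4⟩ := moments (hW 0).2 h1 (2 ^ q)
  rw [h2] at m2 m4
  push_cast at m2 m3 m4
  rw [← hm] at m2 m3 m4
  replace m3 : _ = m * a3 := m3
  replace m4 : _ = m * a4 + 3 * m * (m - 1) * χ ^ 2 := m4
  have hL : ∀ z : Fin (2 ^ q) → Z, (∑ t, W 1 (z t) / W 0 (z t)) / m - 1 =
      (∑ t, g (z t)) / m := by
    intro z
    simp only [hg, sum_sub_distrib, sum_const, card_univ, Fintype.card_fin, nsmul_eq_mul, mul_one]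
    push_cast
    rw [← hm]
    field_simp
  have hpt : ∀ z : Fin (2 ^ q) → Z, meanLaw W q z * Real.log (meanLaw W q z / zeroLaw W q z) ≤
      zeroLaw W q z * (∑ t, g (z t)) / m + zeroLaw W q z * (∑ t, g (z t)) ^ 2 / (2 * m ^ 2) -
      zeroLaw W q z * (∑ t, g (z t)) ^ 3 / (6 * m ^ 3) +
      zeroLaw W q z * (∑ t, g (z t)) ^ 4 / (3 * m ^ 4) := by
    intro z
    have hx : 0 ≤ (∑ t, W 1 (z t) / W 0 (z t)) / m := div_nonneg
      (sum_nonneg fun t _ => div_nonneg ((hW 1).1 _) ((hW 0).1 _)) hm0.le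
    have h := mul_log_le hx
    rw [hL] at h
    rw [meanLaw_eq hac, ← hm]
    by_cases h0 : zeroLaw W q z = 0
    · simp [h0]
    · rw [mul_div_cancel_left₀ _ h0, mul_assoc]
      refine (mul_le_mul_of_nonneg_left h (zeroLaw_nonneg hW z)).trans_eq ?_
      field_simp
  refine (sum_le_sum fun z _ => hpt z).trans ?_
  rw [sum_add_distrib, sum_sub_distrib, sum_add_distrib, ← sum_div, ← sum_div, ← sum_div,
    ← sum_div]
  simp only [zeroLaw]
  rw [m1, m2, m3, m4]
  have e3 : -(m * a3 / (6 * m ^ 3)) ≤ |a3| / 6 / m ^ 2 := by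
    have : m * a3 / (6 * m ^ 3) = a3 / 6 / m ^ 2 := by field_simp
    rw [this, ← neg_div, ← neg_div]
    gcongr
    exact neg_le_abs a3
  have e4 : (m * a4 + 3 * m * (m - 1) * χ ^ 2) / (3 * m ^ 4) ≤ (a4 + 3 * χ ^ 2) / 3 / m ^ 2 := by
    rw [div_div, div_le_div_iff₀ (by positivity) (by positivity)]
    have e5 : m * a4 + 3 * m * (m - 1) * χ ^ 2 ≤ (a4 + 3 * χ ^ 2) * m ^ 2 := by
      have : m ≤ m ^ 2 := by nlinarith
      nlinarith [mul_le_mul_of_nonneg_right this ha4, sq_nonneg χ, mul_nonneg hm0.le (sq_nonneg χ)]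
    calc _ ≤ ((a4 + 3 * χ ^ 2) * m ^ 2) * (3 * m ^ 2) := by gcongr
      _ = _ := by ring
  have e2 : m * χ / (2 * m ^ 2) = χ / (2 * m) := by field_simp
  rw [e2, zero_div, zero_add, add_div (|a3| / 6)]
  linarith

/-- The mutual information of the super channel. -/
lemma condMutualInfo_univ_eq (hW : ∀ a, W a ∈ stdSimplex ℝ Z)
    (hac : ∀ y, W 0 y = 0 → W 1 y = 0) :
    condMutualInfo W (univ : Finset (Fin q)) ∅ =
      kl (W 1) (W 0) - kl (meanLaw W q) (zeroLaw W q) := by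
  have hV := isChannel_superChannel (q := q) hW
  have hpos : ∀ x z, 0 < superChannel W x z → 0 < meanLaw W q z := fun x z h => by
    rw [← condLaw_empty x]
    exact condLaw_pos hV _ h
  -- Relative to zero input, the log-ratio is that of the letter at the pulse, whose law is `W 1`;
  -- hence the same divergence for every `x`.
  have e1 : 𝔼 x : Fin q → Fin 2, ∑ z, superChannel W x z *
      Real.log (superChannel W x z / zeroLaw W q z) = kl (W 1) (W 0) := by
    rw [← Fintype.expect_const (ι := Fin q → Fin 2) (kl (W 1) (W 0))]
    refine Finset.expect_congr rfl fun x _ => ?_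
    set e := finFunctionFinEquiv x with he
    have hpp : ppmSymbol x e = 1 := by rw [ppmSymbol, Pi.single_eq_same]
    have h := sum_prod_mul_apply (fun t => W (ppmSymbol x t)) (fun t => (hW _).2) e
      (fun a => Real.log (W 1 a / W 0 a))
    rw [hpp] at h
    refine Eq.trans (sum_congr rfl fun z _ => ?_) h
    change superChannel W x z * _ = superChannel W x z * _
    rcases (hV.nonneg x z).lt_or_eq with h | h
    · have h0 : zeroLaw W q z ≠ 0 := (prod_pos_of_superChannel_pos hW hac h).ne'
      nth_rewrite 2 [superChannel_eq W x z hac]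
      rw [← zeroLaw, mul_div_cancel_left₀ _ h0]
    · simp [← h]
  have e2 : 𝔼 x : Fin q → Fin 2, ∑ z, superChannel W x z *
      Real.log (meanLaw W q z / zeroLaw W q z) = kl (meanLaw W q) (zeroLaw W q) := by
    rw [expect_sum_comm]
    refine sum_congr rfl fun z _ => ?_
    rw [← expect_mul]
    rfl
  rw [condMutualInfo_eq_expect, ← e1, ← e2, ← expect_sub_distrib]
  refine Finset.expect_congr rfl fun x _ => ?_
  rw [← sum_sub_distrib]
  refine sum_congr rfl fun z _ => ?_
  rw [union_empty, condLaw_univ, condLaw_empty]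
  rcases (hV.nonneg x z).lt_or_eq with h | h
  · have h0 : zeroLaw W q z ≠ 0 := (prod_pos_of_superChannel_pos hW hac h).ne'
    rw [Real.log_div h.ne' (hpos x z h).ne', Real.log_div h.ne' h0,
      Real.log_div (hpos x z h).ne' h0]
    ring
  · simp [← h]

end PPM

/-! ### Covertness -/

section Covert

variable {Z : Type*} [Fintype Z] {W : Fin 2 → Z → ℝ} {C : ℝ} {q ℓ N : ℕ} {b : LevelBits q}

lemma outputLaw_nonneg (hW : ∀ a, W a ∈ stdSimplex ℝ Z) (c : Codebook b ℓ)
    (z : Fin (N + 1) → Fin ℓ → Fin (2 ^ q) → Z) : 0 ≤ outputLaw W c N z := by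
  rw [outputLaw_eq_expect]
  exact expect_nonneg fun k _ => keyedChainLaw_nonneg hW c k z

lemma sum_outputLaw (hW : ∀ a, W a ∈ stdSimplex ℝ Z) (c : Codebook b ℓ) :
    ∑ z, outputLaw W c N z = 1 := by
  simp_rw [outputLaw_eq_expect, ← expect_sum_comm, sum_keyedChainLaw hW]
  simp

lemma superChannel_le_meanLaw (hW : ∀ a, W a ∈ stdSimplex ℝ Z) (x : Fin q → Fin 2)
    (z : Fin (2 ^ q) → Z) : superChannel W x z ≤ 2 ^ q * meanLaw W q z := by
  rw [← condLaw_empty x]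
  exact superChannel_le_condLaw hW ∅ x z

lemma abs_log_meanLaw_div_le (hW : ∀ a, W a ∈ stdSimplex ℝ Z)
    (hac : ∀ y, W 0 y = 0 → W 1 y = 0) (hC1 : 1 ≤ C)
    (hC : ∀ y, W 1 y / W 0 y ≤ C ∧ (0 < W 1 y / W 0 y → C⁻¹ ≤ W 1 y / W 0 y))
    {z : Fin (2 ^ q) → Z} (h : 0 < meanLaw W q z) :
    |Real.log (meanLaw W q z / zeroLaw W q z)| ≤ q * Real.log 2 + Real.log C := by
  have hC0 : 0 < C := by linarith
  have hlC : 0 ≤ Real.log C := Real.log_nonneg hC1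
  have hl : 0 < Real.log 2 := Real.log_pos one_lt_two
  obtain ⟨x, -, hx⟩ := exists_ne_zero_of_expect_ne_zero h.ne'
  have hx : 0 < superChannel W x z :=
    lt_of_le_of_ne ((isChannel_superChannel hW).nonneg _ _) hx.symm
  have h0 : 0 < zeroLaw W q z := prod_pos_of_superChannel_pos hW hac hx
  have h1 := Real.log_le_log (mul_pos h0 (inv_pos.2 hC0))
    (le_superChannel hW hac (fun y => (hC y).2) hx)
  have h2 := Real.log_le_log hx (superChannel_le_meanLaw hW x z)
  have h3 : meanLaw W q z ≤ zeroLaw W q z * C := by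
    rw [← condLaw_empty x]
    exact condLaw_superChannel_le hW hac (fun y => (hC y).1) ∅ x z
  have h4 := Real.log_le_log h h3
  rw [Real.log_mul h0.ne' (inv_ne_zero hC0.ne'), Real.log_inv] at h1
  rw [Real.log_mul (by positivity) h.ne', Real.log_pow] at h2
  rw [Real.log_mul h0.ne' hC0.ne'] at h4
  rw [Real.log_div h.ne' h0.ne', abs_le]
  have : 0 ≤ q * Real.log 2 := by positivity
  constructor <;> linarith

/-- The divergence of the product law is additive over the `(N + 1) ℓ` symbols. In the continuity
bound, both the ratio bound and the log-density bound contribute logarithms linear in `(N + 1) ℓ`,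
so the `L¹` distance is multiplied by `O(ℓ q)` only. -/
lemma kl_outputLaw_le (hW : ∀ a, W a ∈ stdSimplex ℝ Z)
    (hac : ∀ y, W 0 y = 0 → W 1 y = 0) (hC1 : 1 ≤ C)
    (hC : ∀ y, W 1 y / W 0 y ≤ C ∧ (0 < W 1 y / W 0 y → C⁻¹ ≤ W 1 y / W 0 y))
    (c : Codebook b ℓ) :
    kl (outputLaw W c N) (innocentLaw W) ≤
      (N + 1) * ℓ * kl (meanLaw W q) (zeroLaw W q) +
      (N + 1) * leakage W c * (1 + (N + 1) * ℓ * (2 * q * Real.log 2 + Real.log C)) := by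
  have hlC : 0 ≤ Real.log C := Real.log_nonneg hC1
  have hl : 0 < Real.log 2 := Real.log_pos one_lt_two
  set R : (Fin (N + 1) → Fin ℓ → Fin (2 ^ q) → Z) → ℝ := fun z => ∏ j, blockLaw W q ℓ (z j) with hR
  have hR0 : ∀ z, 0 ≤ R z := fun z => prod_nonneg fun j _ => blockLaw_nonneg hW _
  have hinn : (innocentLaw W : (Fin (N + 1) → Fin ℓ → Fin (2 ^ q) → Z) → ℝ) =
      fun z => ∏ j, ∏ s, zeroLaw W q (z j s) := rfl
  have hblock : ∀ z : Fin ℓ → Fin (2 ^ q) → Z, ∏ s, zeroLaw W q (z s) = 0 →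
      blockLaw W q ℓ z = 0 := by
    intro z hz
    obtain ⟨s, -, hs⟩ := prod_eq_zero_iff.1 hz
    exact prod_eq_zero (mem_univ s) (meanLaw_eq_zero hac _ hs)
  have hklR : kl R (innocentLaw W) = (N + 1) * ℓ * kl (meanLaw W q) (zeroLaw W q) := by
    rw [hinn, hR, kl_prod (p := blockLaw W q ℓ) (r := fun z => ∏ s, zeroLaw W q (z s))
      (sum_blockLaw hW) hblock]
    unfold blockLaw
    rw [kl_prod (sum_meanLaw hW) (meanLaw_eq_zero hac)]
    simp only [Fintype.card_fin]
    push_cast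
    ring
  have hM : ∀ z, outputLaw W c N z ≤ (2 ^ q) ^ ((N + 1) * ℓ) * R z := by
    intro z
    rw [outputLaw_eq_expect]
    refine expect_le univ_nonempty fun k _ => expect_le univ_nonempty fun w _ =>
      expect_le univ_nonempty fun f _ => ?_
    have : ((2 : ℝ) ^ q) ^ ((N + 1) * ℓ) * R z =
        ∏ j, ∏ s, (2 ^ q * meanLaw W q (z j s)) := by
      simp only [prod_mul_distrib, prod_const, card_univ, Fintype.card_fin, hR, blockLaw]
      rw [← pow_mul (2 ^ q) ℓ, mul_comm ℓ]
    rw [this]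
    exact prod_le_prod (fun j _ => prod_nonneg fun s _ => (isChannel_superChannel hW).nonneg _ _)
      fun j _ => prod_le_prod (fun s _ => (isChannel_superChannel hW).nonneg _ _)
        fun s _ => superChannel_le_meanLaw hW _ _
  have hL : ∀ z, 0 < R z → |Real.log (R z / innocentLaw W z)| ≤
      (N + 1) * ℓ * (q * Real.log 2 + Real.log C) := by
    intro z hz
    have hpos : ∀ j s, 0 < meanLaw W q (z j s) := fun j s =>
      lt_of_le_of_ne (meanLaw_nonneg hW _) fun h => hz.ne'
        (prod_eq_zero (mem_univ j) (prod_eq_zero (mem_univ s) h.symm))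
    have hpos' : ∀ j s, meanLaw W q (z j s) / zeroLaw W q (z j s) ≠ 0 := fun j s =>
      div_ne_zero (hpos j s).ne' fun h => (hpos j s).ne' (meanLaw_eq_zero hac _ h)
    rw [hinn]
    simp only [hR, blockLaw, ← prod_div_distrib]
    rw [Real.log_prod fun j _ => prod_ne_zero_iff.2 fun s _ => hpos' j s]
    simp_rw [Real.log_prod fun s _ => hpos' _ s]
    calc _ ≤ ∑ _j : Fin (N + 1), ∑ _s : Fin ℓ, (q * Real.log 2 + Real.log C) := by
          refine (abs_sum_le_sum_abs _ _).trans (sum_le_sum fun j _ =>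
            (abs_sum_le_sum_abs _ _).trans (sum_le_sum fun s _ =>
              abs_log_meanLaw_div_le hW hac hC1 hC (hpos j s)))
      _ = _ := by
          simp only [sum_const, card_univ, Fintype.card_fin, nsmul_eq_mul]
          push_cast
          ring
  have hac' : ∀ z, (innocentLaw W : (Fin (N + 1) → Fin ℓ → Fin (2 ^ q) → Z) → ℝ) z = 0 →
      R z = 0 := by
    intro z hz
    rw [hinn] at hz
    obtain ⟨j, -, hj⟩ := prod_eq_zero_iff.1 hz
    exact prod_eq_zero (mem_univ j) (hblock _ hj)
  have key := kl_le_kl_add (outputLaw_nonneg hW c) hR0 (r := innocentLaw W)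
    (fun z => prod_nonneg fun j _ => prod_nonneg fun s _ => zeroLaw_nonneg hW _) hac'
    (one_le_pow₀ (one_le_pow₀ one_le_two)) hM hL
  rw [hklR] at key
  refine key.trans ?_
  refine add_le_add le_rfl ?_
  have hlog : Real.log ((2 ^ q) ^ ((N + 1) * ℓ)) = (N + 1) * ℓ * (q * Real.log 2) := by
    rw [Real.log_pow, Real.log_pow]
    push_cast
    ring
  rw [hlog]
  calc _ ≤ ((N + 1) * leakage W c) * (1 + (N + 1) * ℓ * (q * Real.log 2) +
          (N + 1) * ℓ * (q * Real.log 2 + Real.log C)) := by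
        gcongr
        exact sum_abs_outputLaw_sub_le hW c N
    _ = _ := by ring

lemma relEntropy_outputLaw_eq (hW : ∀ a, W a ∈ stdSimplex ℝ Z)
    (hac : ∀ y, W 0 y = 0 → W 1 y = 0) (c : Codebook b ℓ) :
    relEntropy (outputLaw W c N) (innocentLaw W) =
      ENNReal.ofReal (kl (outputLaw W c N) (innocentLaw W)) := by
  refine relEntropy_eq (outputLaw_nonneg hW c)
    (fun z => prod_nonneg fun j _ => prod_nonneg fun s _ => zeroLaw_nonneg hW _)
    (sum_outputLaw hW c) ?_ ?_
  · have hinn : (innocentLaw W : (Fin (N + 1) → Fin ℓ → Fin (2 ^ q) → Z) → ℝ) =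
      fun z => ∏ j, ∏ s, zeroLaw W q (z j s) := rfl
    rw [hinn, sum_prod fun _ (z : Fin ℓ → Fin (2 ^ q) → Z) => ∏ s, zeroLaw W q (z s)]
    refine prod_eq_one fun j _ => ?_
    rw [sum_prod fun _ z => zeroLaw W q z]
    exact prod_eq_one fun s _ => sum_zeroLaw hW
  · intro z hz
    rw [outputLaw_eq_expect]
    refine expect_eq_zero fun k _ => expect_eq_zero fun w _ => expect_eq_zero fun f _ => ?_
    obtain ⟨j, -, hj⟩ := prod_eq_zero_iff.1 hz
    obtain ⟨s, -, hs⟩ := prod_eq_zero_iff.1 hj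
    refine prod_eq_zero (mem_univ j) (prod_eq_zero (mem_univ s) ?_)
    rw [superChannel_eq W _ _ hac, hs, zero_mul]

end Covert

/-! ### Growth of the block length -/

section Asymptotics

open Filter Topology

variable {Z : Type*} [Fintype Z] {Q : Fin 2 → Z → ℝ} {δ : ℝ} {N : ℕ}

lemma chiTwo_pos {α : Type*} [Fintype α] {p r : α → ℝ} (hr : ∀ a, 0 ≤ r a)
    (hac : ∀ a, r a = 0 → p a = 0) (hne : p ≠ r) : 0 < chiTwo p r := by
  obtain ⟨a, ha⟩ := Function.ne_iff.1 hne
  have hra : 0 < r a := lt_of_le_of_ne (hr a) fun h => ha (by rw [hac a h.symm, ← h])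
  refine sum_pos' (fun a _ => div_nonneg (sq_nonneg _) (hr a)) ⟨a, mem_univ a, ?_⟩
  have : p a - r a ≠ 0 := sub_ne_zero.2 ha
  positivity

lemma blockLength_mul_le (hδ : 0 ≤ δ) (hχ : 0 < chiTwo (Q 1) (Q 0)) (N q : ℕ) :
    (N + 1) * (blockLength Q δ N q : ℝ) * chiTwo (Q 1) (Q 0) ≤ 2 * 2 ^ q * δ := by
  have h : (blockLength Q δ N q : ℝ) ≤ 2 * 2 ^ q * δ / ((N + 1) * chiTwo (Q 1) (Q 0)) :=
    Nat.floor_le (by positivity)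
  rw [le_div_iff₀ (by positivity)] at h
  linarith

lemma tendsto_blockLength_div (hδ : 0 ≤ δ) (hχ : 0 < chiTwo (Q 1) (Q 0)) (N : ℕ) :
    Tendsto (fun q => (blockLength Q δ N q : ℝ) / 2 ^ q) atTop
      (𝓝 (2 * δ / ((N + 1) * chiTwo (Q 1) (Q 0)))) := by
  have h := (tendsto_nat_floor_mul_div_atTop (R := ℝ)
    (a := 2 * δ / ((N + 1) * chiTwo (Q 1) (Q 0))) (by positivity)).comp
    (tendsto_pow_atTop_atTop_of_one_lt (one_lt_two (α := ℝ)))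
  refine h.congr fun q => ?_
  have e : 2 * δ / ((N + 1) * chiTwo (Q 1) (Q 0)) * 2 ^ q =
      2 * 2 ^ q * δ / ((N + 1) * chiTwo (Q 1) (Q 0)) := by ring
  simp only [Function.comp_apply, e]
  rfl

lemma tendsto_pow_div_blockLength (hδ : 0 < δ) (hχ : 0 < chiTwo (Q 1) (Q 0)) (N k : ℕ) :
    Tendsto (fun q : ℕ => (q : ℝ) ^ k / blockLength Q δ N q) atTop (𝓝 0) := by
  have h1 := tendsto_pow_const_div_const_pow_of_one_lt k (one_lt_two (α := ℝ))
  have h2 := h1.div (tendsto_blockLength_div hδ.le hχ N) (by positivity)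
  rw [zero_div] at h2
  refine h2.congr fun q => ?_
  simp only [Pi.div_apply]
  rw [div_div_div_cancel_right₀ (by positivity)]

lemma eventually_blockLength_pos (hδ : 0 < δ) (hχ : 0 < chiTwo (Q 1) (Q 0)) (N : ℕ) :
    ∀ᶠ q in atTop, 0 < blockLength Q δ N q := by
  filter_upwards [(tendsto_blockLength_div hδ.le hχ N).eventually_const_lt (u := 0)
    (by positivity)] with q hq
  by_contra h
  rw [Nat.eq_zero_of_not_pos h] at hq
  simp at hq

/-- `exp (- a ℓ / q ^ 4)` decays faster than any power of `2 ^ q`. -/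
lemma tendsto_pow_mul_exp_neg_blockLength (hδ : 0 < δ) (hχ : 0 < chiTwo (Q 1) (Q 0)) (N k : ℕ)
    {a : ℝ} (ha : 0 < a) :
    Tendsto (fun q : ℕ => ((2 : ℝ) ^ q) ^ k * Real.exp (-(a * (blockLength Q δ N q / q ^ 4))))
      atTop (𝓝 0) := by
  have hl : 0 < Real.log 2 := Real.log_pos one_lt_two
  -- The threshold is such that `q (k log 2 + 1) ≤ a ℓ / q ^ 4`: the exponential absorbs `(2 ^ q) ^
  -- k` and leaves `exp (-q)`.
  have h5 := (tendsto_pow_div_blockLength hδ hχ N 5).eventually_le_const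
    (u := a / (k * Real.log 2 + 1)) (by positivity)
  have hexp : Tendsto (fun q : ℕ => Real.exp (-(q : ℝ))) atTop (𝓝 0) :=
    Real.tendsto_exp_neg_atTop_nhds_zero.comp tendsto_natCast_atTop_atTop
  refine squeeze_zero' (Eventually.of_forall fun q => by positivity) ?_ hexp
  filter_upwards [h5, eventually_blockLength_pos hδ hχ N, eventually_gt_atTop 0] with q h hℓ hq
  have hℓ' : (0 : ℝ) < blockLength Q δ N q := by exact_mod_cast hℓ
  have hq' : (0 : ℝ) < q := by exact_mod_cast hq
  have e : ((2 : ℝ) ^ q) ^ k = Real.exp (k * q * Real.log 2) := by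
    rw [mul_comm, Real.exp_mul, Real.exp_log two_pos, ← pow_mul, mul_comm q, ← Nat.cast_mul,
      Real.rpow_natCast]
  rw [e, ← Real.exp_add, Real.exp_le_exp]
  rw [div_le_div_iff₀ hℓ' (by positivity)] at h
  have h' : (q : ℝ) * (k * Real.log 2 + 1) ≤ a * (blockLength Q δ N q / q ^ 4) := by
    rw [← mul_div_assoc, le_div_iff₀ (by positivity)]
    linarith
  linarith

lemma exp_neg_le_of_le {a b : ℝ} {q ℓ : ℕ} {x : ℝ} (hab : a ≤ b)
    (hx : b * (ℓ / q ^ 4) ≤ x) : Real.exp (-x) ≤ Real.exp (-(a * ((ℓ : ℝ) / q ^ 4))) := by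
  rw [Real.exp_le_exp, neg_le_neg_iff]
  exact (mul_le_mul_of_nonneg_right hab (by positivity)).trans hx

lemma div_pow_four_le {q ℓ : ℕ} (hq : 0 < q) : (ℓ : ℝ) / q ^ 4 ≤ ℓ / q := by
  have h1 : (1 : ℝ) ≤ q := by exact_mod_cast hq
  have h2 : (q : ℝ) ≤ q ^ 4 := le_self_pow₀ h1 (by norm_num)
  gcongr

/-- As `log 2 < 1`, the range of the log-likelihood ratios is eventually at most `q`, whence the
plain powers of `q` in the Hoeffding exponents. -/
lemma eventually_range_le (C : ℝ) :
    ∀ᶠ q : ℕ in atTop, 2 * Real.log C + q * Real.log 2 ≤ q := by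
  have h : 0 < 1 - Real.log 2 := by linarith [Real.log_two_lt_d9]
  filter_upwards [eventually_ge_atTop ⌈2 * Real.log C / (1 - Real.log 2)⌉₊] with q hq
  have := (Nat.le_ceil _).trans (Nat.cast_le (α := ℝ).2 hq)
  rw [div_le_iff₀ h] at this
  linarith

end Asymptotics

/-! ### Probability that a random codebook is reliable and covert -/

section Concentration

variable {q ℓ : ℕ} {b : LevelBits q}

lemma codebookProb_mono {E F : Codebook b ℓ → Prop} (h : ∀ c, E c → F c) :
    codebookProb E ≤ codebookProb F := by
  unfold codebookProb
  gcongr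
  exact Nat.card_le_card_of_injective (fun c => ⟨c.1, h c.1 c.2⟩) fun c c' hcc => by
    simpa [Subtype.ext_iff] using hcc

/-- Markov's inequality for two functions of the codebook. -/
lemma le_codebookProb {f g : Codebook b ℓ → ℝ} (hf : ∀ c, 0 ≤ f c) (hg : ∀ c, 0 ≤ g c)
    {x y : ℝ} (hx : 0 < x) (hy : 0 < y) :
    1 - (𝔼 c, f c) / x - (𝔼 c, g c) / y ≤ codebookProb fun c => f c ≤ x ∧ g c ≤ y := by
  classical
  have h : codebookProb (fun c => f c ≤ x ∧ g c ≤ y) =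
      𝔼 c, if f c ≤ x ∧ g c ≤ y then (1 : ℝ) else 0 := by
    rw [codebookProb, Fintype.expect_eq_sum_div_card, sum_boole, Nat.card_eq_fintype_card,
      Fintype.card_subtype]
  have h' : 1 - (𝔼 c, f c) / x - (𝔼 c, g c) / y = 𝔼 c, (1 - f c / x - g c / y) := by
    rw [expect_sub_distrib, expect_sub_distrib, Fintype.expect_const, expect_div, expect_div]
  rw [h, h']
  refine expect_le_expect fun c _ => ?_
  have h1 := div_nonneg (hf c) hx.le
  have h2 := div_nonneg (hg c) hy.le
  split_ifs with hc
  · linarith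
  · rw [not_and_or, not_le, not_le] at hc
    rcases hc with hc | hc
    · have := (one_lt_div hx).2 hc
      linarith
    · have := (one_lt_div hy).2 hc
      linarith

end Concentration

/-! ### Reliability and covertness of random codebooks for large `q` -/

section Main

open Filter Topology

variable {Y Z : Type*} [Fintype Y] [Fintype Z] {P : Fin 2 → Y → ℝ} {Q : Fin 2 → Z → ℝ} {δ : ℝ}

lemma eventually_codebookMean_le (hP : ∀ a, P a ∈ stdSimplex ℝ Y) (hQ : ∀ a, Q a ∈ stdSimplex ℝ Z)
    (hPac : ∀ y, P 0 y = 0 → P 1 y = 0) {ε τ : ℝ} (hτ : 0 < τ) (hτε : τ < ε / 2) (N : ℕ) :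
    ∀ᶠ q : ℕ in atTop,
        codebookMean (b := mlcBits P Q ε q (blockLength Q δ N q)) (ℓ := blockLength Q δ N q)
            (fun c => errorProb P τ c N) ≤
          (N + 1) * 2 ^ q * (Real.exp (-(2 * blockLength Q δ N q * τ ^ 2 / q ^ 4)) +
            (2 : ℝ) ^ (-(blockLength Q δ N q * τ / q))) := by
  obtain ⟨C, hC1, hC⟩ := exists_ratio_bound P hP
  filter_upwards [eventually_range_le C, eventually_gt_atTop 0] with q hq hq0
  exact codebookMean_errorProb_le hP hQ hPac hC1 hC hq0 hq hτ.le (by linarith) N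

lemma tendsto_error_bound (hδ : 0 < δ) (hχ : 0 < chiTwo (Q 1) (Q 0)) {τ : ℝ} (hτ : 0 < τ) (N : ℕ) :
    Tendsto (fun q : ℕ =>
      ((N : ℝ) + 1) * 2 ^ q * (Real.exp (-(2 * blockLength Q δ N q * τ ^ 2 / q ^ 4)) +
            (2 : ℝ) ^ (-(blockLength Q δ N q * τ / q)))) atTop (𝓝 0) := by
  have hl : 0 < Real.log 2 := Real.log_pos one_lt_two
  set a := min (2 * τ ^ 2) (Real.log 2 * τ) with ha
  have ha0 : 0 < a := lt_min (by positivity) (by positivity)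
  have h := (tendsto_pow_mul_exp_neg_blockLength hδ hχ N 1 ha0).const_mul (2 * ((N : ℝ) + 1))
  rw [mul_zero] at h
  refine squeeze_zero' (Eventually.of_forall fun q => by positivity) ?_ h
  filter_upwards [eventually_gt_atTop 0] with q hq
  have h1 : Real.exp (-(2 * blockLength Q δ N q * τ ^ 2 / q ^ 4)) ≤
      Real.exp (-(a * ((blockLength Q δ N q : ℝ) / q ^ 4))) :=
    exp_neg_le_of_le (min_le_left _ _) (le_of_eq (by ring))
  have h2 : (2 : ℝ) ^ (-(blockLength Q δ N q * τ / q)) ≤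
      Real.exp (-(a * ((blockLength Q δ N q : ℝ) / q ^ 4))) := by
    rw [Real.rpow_def_of_pos two_pos, mul_neg]
    refine exp_neg_le_of_le (min_le_right _ _) ?_
    refine (mul_le_mul_of_nonneg_left (div_pow_four_le hq) (by positivity)).trans_eq ?_
    ring
  calc _ ≤ ((N : ℝ) + 1) * 2 ^ q * (Real.exp (-(a * ((blockLength Q δ N q : ℝ) / q ^ 4))) +
        Real.exp (-(a * ((blockLength Q δ N q : ℝ) / q ^ 4)))) := by gcongr
    _ = _ := by ring

lemma errorProb_nonneg (hP : ∀ a, P a ∈ stdSimplex ℝ Y) {τ : ℝ} {q ℓ : ℕ} {b : LevelBits q}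
    (c : Codebook b ℓ) (N : ℕ) : 0 ≤ errorProb P τ c N := by
  refine div_nonneg (sum_nonneg fun w _ => sum_nonneg fun s _ => sum_nonneg fun y _ => ?_)
    (by positivity)
  split_ifs
  exacts [le_rfl, chainChannel_nonneg hP _ _ _ _]

lemma leakage_nonneg {q ℓ : ℕ} {b : LevelBits q} (c : Codebook b ℓ) : 0 ≤ leakage Q c :=
  expect_nonneg fun _ _ => sum_nonneg fun _ _ => abs_nonneg _

lemma eventually_expect_leakage_le (hQ : ∀ a, Q a ∈ stdSimplex ℝ Z)
    (hQac : ∀ z, Q 0 z = 0 → Q 1 z = 0) {ε : ℝ} (hε : 0 < ε) (N : ℕ) :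
    ∀ᶠ q : ℕ in atTop,
      𝔼 c : Codebook (mlcBits P Q ε q (blockLength Q δ N q)) (blockLength Q δ N q),
        leakage Q c ≤ 3 * 2 ^ q * Real.exp
          (-(min (ε / 4) (ε ^ 2 / 8) * ((blockLength Q δ N q : ℝ) / q ^ 4))) := by
  obtain ⟨C, hC1, hC⟩ := exists_ratio_bound Q hQ
  filter_upwards [eventually_range_le C, eventually_gt_atTop 0] with q hq hq0
  have hl2 : Real.log 2 ≤ 1 := by linarith [Real.log_two_lt_d9]
  have hq' : (0 : ℝ) < q := by exact_mod_cast hq0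
  have h1 : Real.exp (-(blockLength Q δ N q * ε / (4 * q))) ≤
      Real.exp (-(min (ε / 4) (ε ^ 2 / 8) * ((blockLength Q δ N q : ℝ) / q ^ 4))) := by
    refine exp_neg_le_of_le (min_le_left _ _) ?_
    refine (mul_le_mul_of_nonneg_left (div_pow_four_le hq0) (by positivity)).trans_eq ?_
    field_simp
  have h2 : Real.exp (-(blockLength Q δ N q * ε ^ 2 / (8 * q ^ 4))) ≤
      Real.exp (-(min (ε / 4) (ε ^ 2 / 8) * ((blockLength Q δ N q : ℝ) / q ^ 4))) :=
    exp_neg_le_of_le (min_le_right _ _) (le_of_eq (by field_simp))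
  unfold leakage
  rw [expect_comm]
  refine expect_le univ_nonempty fun v _ => ?_
  refine (expect_sum_abs_keyedLaw_sub_le_of_rates hQ hQac hC1 hC hq0 (by nlinarith) hε.le v).trans ?_
  calc _ ≤ 2 ^ q * Real.exp (-(min (ε / 4) (ε ^ 2 / 8) * ((blockLength Q δ N q : ℝ) / q ^ 4))) +
        2 * (2 ^ q *
          Real.exp (-(min (ε / 4) (ε ^ 2 / 8) * ((blockLength Q δ N q : ℝ) / q ^ 4)))) := by gcongr
    _ = _ := by ring

/-- The block length makes the leading term at most `δ`. The remainder `O(m⁻²)` over `O(m)` symbols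
is `O(1 / m)`. As `q ≤ m`, the continuity correction is `leakage` times `O(m ^ 2)`, so leakage of
order `m⁻³` suffices. -/
lemma exists_relEntropy_le (hδ : 0 < δ) (hQ : ∀ a, Q a ∈ stdSimplex ℝ Z)
    (hQac : ∀ z, Q 0 z = 0 → Q 1 z = 0) (hχ : 0 < chiTwo (Q 1) (Q 0)) (N : ℕ) :
    ∃ A K : ℝ, 0 < K ∧ ∀ (q ℓ : ℕ) (b : LevelBits q) (c : Codebook b ℓ),
      (N + 1) * (ℓ : ℝ) * chiTwo (Q 1) (Q 0) ≤ 2 * 2 ^ q * δ → leakage Q c ≤ 1 / (K * (2 ^ q) ^ 3) →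
      relEntropy (outputLaw Q c N) (innocentLaw Q) ≤ ENNReal.ofReal (δ + A / 2 ^ q) := by
  obtain ⟨C, hC1, hC⟩ := exists_ratio_bound Q hQ
  obtain ⟨K₁, hK₁, hkl⟩ := exists_kl_meanLaw_le hQ hQac
  have hlC : 0 ≤ Real.log C := Real.log_nonneg hC1
  have hl : 0 < Real.log 2 := Real.log_pos one_lt_two
  have hl2 : Real.log 2 ≤ 1 := by linarith [Real.log_two_lt_d9]
  set χ := chiTwo (Q 1) (Q 0) with hχd
  set K : ℝ := (N + 1) * (1 + 2 * δ / χ * (2 + Real.log C)) with hK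
  have hK0 : 0 < K := by positivity
  refine ⟨K₁ * (2 * δ / χ) + 1, K, hK0, fun q ℓ b c hℓ hc => ?_⟩
  rw [relEntropy_outputLaw_eq hQ hQac]
  refine ENNReal.ofReal_le_ofReal ((kl_outputLaw_le hQ hQac hC1 hC c).trans ?_)
  set m : ℝ := 2 ^ q with hm
  have hm1 : 1 ≤ m := one_le_pow₀ one_le_two
  have hm0 : 0 < m := by linarith
  have hqm : (q : ℝ) ≤ m := by
    rw [hm]
    exact_mod_cast Nat.lt_two_pow_self.le
  have hNℓ : (N + 1) * (ℓ : ℝ) ≤ 2 * δ / χ * m := by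
    rw [div_mul_eq_mul_div, le_div_iff₀ hχ]
    linarith
  have e1 : (N + 1) * (ℓ : ℝ) * kl (meanLaw Q q) (zeroLaw Q q) ≤
      δ + K₁ * (2 * δ / χ) / m := by
    calc (N + 1) * (ℓ : ℝ) * kl (meanLaw Q q) (zeroLaw Q q)
        ≤ (N + 1) * (ℓ : ℝ) * (χ / (2 * m) + K₁ / m ^ 2) := by
          gcongr
          exact hkl q
      _ ≤ (2 * δ / χ * m) * (χ / (2 * m) + K₁ / m ^ 2) := by gcongr
      _ = _ := by field_simp
  have e2 : (N + 1) * leakage Q c * (1 + (N + 1) * ℓ * (2 * q * Real.log 2 + Real.log C)) ≤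
      1 / m := by
    have h1 : 1 + (N + 1) * (ℓ : ℝ) * (2 * q * Real.log 2 + Real.log C) ≤
        (1 + 2 * δ / χ * (2 + Real.log C)) * m ^ 2 := by
      have : 2 * (q : ℝ) * Real.log 2 + Real.log C ≤ (2 + Real.log C) * m := by
        have h3 : 2 * (q : ℝ) * Real.log 2 ≤ 2 * m * 1 := by gcongr
        have h4 : Real.log C * 1 ≤ Real.log C * m := by gcongr
        linarith
      calc _ ≤ m ^ 2 + (2 * δ / χ * m) * ((2 + Real.log C) * m) := by
            gcongr
            exact one_le_pow₀ hm1
        _ = _ := by ring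
    calc _ ≤ (N + 1) * (1 / (K * m ^ 3)) * ((1 + 2 * δ / χ * (2 + Real.log C)) * m ^ 2) := by
          gcongr
      _ = K * m ^ 2 / (K * m ^ 3) := by rw [hK]; ring
      _ = _ := by field_simp
  rw [add_div]
  linarith

lemma exists_eventually_le_codebookProb (hδ : 0 < δ) (hP : ∀ a, P a ∈ stdSimplex ℝ Y)
    (hQ : ∀ a, Q a ∈ stdSimplex ℝ Z)
    (hPac : ∀ y, P 0 y = 0 → P 1 y = 0) (hQac : ∀ z, Q 0 z = 0 → Q 1 z = 0)
    (hχ : 0 < chiTwo (Q 1) (Q 0)) {ε τ : ℝ} (hτ : 0 < τ) (hτε : τ < ε / 2) (N : ℕ) :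
    ∃ A : ℝ, ∀ η : ℝ, 0 < η → ∀ᶠ q : ℕ in atTop,
        1 - η ≤
          codebookProb (b := mlcBits P Q ε q (blockLength Q δ N q)) (ℓ := blockLength Q δ N q)
            (fun c => errorProb P τ c N ≤ η ∧
              relEntropy (outputLaw Q c N) (innocentLaw Q) ≤ ENNReal.ofReal (δ + A / 2 ^ q)) := by
  obtain ⟨A, K, hK, hA⟩ := exists_relEntropy_le hδ hQ hQac hχ N
  have hε : 0 < ε := by linarith
  refine ⟨A, fun η hη => ?_⟩
  have ha : 0 < min (ε / 4) (ε ^ 2 / 8) := lt_min (by positivity) (by positivity)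
  -- Each of the two failures receives probability `η / 2` from Markov's inequality. The power `4`
  -- combines the factor `2 ^ q` of the expected leakage with the `(2 ^ q) ^ 3` of the leakage
  -- threshold.
  filter_upwards [eventually_codebookMean_le hP hQ hPac hτ hτε N (δ := δ),
    eventually_expect_leakage_le (P := P) hQ hQac hε N,
    (tendsto_error_bound hδ hχ hτ N).eventually_le_const (u := η / 2 * η) (by positivity),
    (tendsto_pow_mul_exp_neg_blockLength hδ hχ N 4 ha).eventually_le_const
      (u := η / 2 / (3 * K)) (by positivity)] with q h1 h2 h3 h4
  rw [codebookMean_eq_expect] at h1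
  refine le_trans ?_ (codebookProb_mono (E := fun c => errorProb P τ c N ≤ η ∧
    leakage Q c ≤ 1 / (K * (2 ^ q) ^ 3)) fun c hc => ⟨hc.1, hA q _ _ c (blockLength_mul_le hδ.le hχ N q) hc.2⟩)
  refine le_trans ?_ (le_codebookProb (fun c => errorProb_nonneg hP c N) leakage_nonneg hη
    (by positivity))
  have e1 : (𝔼 c : Codebook (mlcBits P Q ε q (blockLength Q δ N q)) (blockLength Q δ N q),
      errorProb P τ c N) / η ≤ η / 2 := by
    rw [div_le_iff₀ hη]
    exact h1.trans h3
  have e2 : (𝔼 c : Codebook (mlcBits P Q ε q (blockLength Q δ N q)) (blockLength Q δ N q),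
      leakage Q c) / (1 / (K * (2 ^ q) ^ 3)) ≤ η / 2 := by
    rw [div_div_eq_mul_div, div_one]
    rw [le_div_iff₀ (by positivity)] at h4
    refine (mul_le_mul_of_nonneg_right h2 (by positivity)).trans (le_trans (le_of_eq ?_) h4)
    ring
  linarith

/-! ### Throughputs -/

lemma tendsto_condMutualInfo {W : Fin 2 → Z → ℝ} (hW : ∀ a, W a ∈ stdSimplex ℝ Z)
    (hac : ∀ z, W 0 z = 0 → W 1 z = 0) :
    Tendsto (fun q => condMutualInfo W (univ : Finset (Fin q)) ∅) atTop
      (𝓝 (relEntropy (W 1) (W 0)).toReal) := by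
  have hkl : (relEntropy (W 1) (W 0)).toReal = kl (W 1) (W 0) := by
    rw [relEntropy_eq (hW 1).1 (hW 0).1 (hW 1).2 (hW 0).2 hac, ENNReal.toReal_ofReal
      (kl_nonneg (hW 1).1 (hW 0).1 (hW 1).2 (hW 0).2 hac)]
  obtain ⟨K, -, hK⟩ := exists_kl_meanLaw_le hW hac
  simp_rw [condMutualInfo_univ_eq hW hac, hkl]
  have h2 : Tendsto (fun q : ℕ => ((2 : ℝ) ^ q)⁻¹) atTop (𝓝 0) :=
    tendsto_inv_atTop_zero.comp (tendsto_pow_atTop_atTop_of_one_lt one_lt_two)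
  have hb : Tendsto (fun q : ℕ => chiTwo (W 1) (W 0) / (2 * 2 ^ q) + K / ((2 : ℝ) ^ q) ^ 2) atTop
      (𝓝 0) := by
    have := (h2.const_mul (chiTwo (W 1) (W 0) / 2)).add ((h2.pow 2).const_mul K)
    simp only [mul_zero, ne_eq, OfNat.ofNat_ne_zero, not_false_eq_true, zero_pow, add_zero] at this
    refine this.congr fun q => ?_
    field_simp
  have h0 : Tendsto (fun q => kl (meanLaw W q) (zeroLaw W q)) atTop (𝓝 0) :=
    squeeze_zero (fun q => kl_nonneg (meanLaw_nonneg hW) (zeroLaw_nonneg hW) (sum_meanLaw hW)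
      (sum_zeroLaw hW) (meanLaw_eq_zero hac)) hK hb
  simpa using h0.const_sub (kl (W 1) (W 0))

lemma log_card_chainMessage {q : ℕ} (b : LevelBits q) (N : ℕ) :
    Real.log (Fintype.card (ChainMessage b N)) =
      (N + 1) * ∑ i, ((b.U i : ℝ) + b.V i) * Real.log 2 := by
  have : Fintype.card (ChainMessage b N) = 2 ^ ((N + 1) * ∑ i, (b.U i + b.V i)) := by
    rw [Fintype.card_fun, Fintype.card_prod, card_strings, card_strings, ← pow_add,
      ← pow_mul, Fintype.card_fin, ← sum_add_distrib, mul_comm]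
  rw [this, ← sum_mul, Nat.cast_pow, Real.log_pow]
  push_cast
  ring

lemma log_card_sharedKey {q : ℕ} (b : LevelBits q) (N : ℕ) :
    Real.log (Fintype.card (SharedKey b N)) = (∑ i, (b.K i : ℝ) * Real.log 2) +
      N * max 0 (∑ i, ((b.K i : ℝ) - b.V i) * Real.log 2) := by
  have hl : 0 < Real.log 2 := Real.log_pos one_lt_two
  have h : Fintype.card (SharedKey b N) =
      2 ^ ((∑ i, b.K i) + N * ((∑ i, b.K i) - ∑ i, b.V i)) := by
    rw [Fintype.card_prod, card_strings]
    simp only [Fintype.card_fun, Fintype.card_fin]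
    rw [← pow_mul, ← pow_add, mul_comm N]
  -- Truncated subtraction of natural numbers is the positive part.
  have h2 : (((∑ i, b.K i) - ∑ i, b.V i : ℕ) : ℝ) * Real.log 2 =
      max 0 (∑ i, ((b.K i : ℝ) - b.V i) * Real.log 2) := by
    rw [← sum_mul, sum_sub_distrib]
    rcases le_total (∑ i, b.V i) (∑ i, b.K i) with hle | hle
    · have hle' : ∑ i, (b.V i : ℝ) ≤ ∑ i, (b.K i : ℝ) := by exact_mod_cast hle
      rw [max_eq_right (mul_nonneg (sub_nonneg.2 hle') hl.le), Nat.cast_sub hle]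
      push_cast
      rfl
    · have hle' : ∑ i, (b.K i : ℝ) ≤ ∑ i, (b.V i : ℝ) := by exact_mod_cast hle
      rw [max_eq_left (mul_nonpos_of_nonpos_of_nonneg (sub_nonpos.2 hle') hl.le),
        Nat.sub_eq_zero_of_le hle]
      simp
  rw [h, Nat.cast_pow, Real.log_pow, ← h2, ← sum_mul]
  push_cast
  ring

lemma sum_const_div {q : ℕ} (hq : 0 < q) (x : ℝ) : ∑ _i : Fin q, x / q = x := by
  have hq' : (0 : ℝ) < q := by exact_mod_cast hq
  simp only [sum_const, card_univ, Fintype.card_fin, nsmul_eq_mul]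
  field_simp

variable {ε : ℝ} {q ℓ : ℕ}

lemma le_log_card_chainMessage (hP : ∀ a, P a ∈ stdSimplex ℝ Y) (hq : 0 < q) (N : ℕ) :
    (N + 1) * (ℓ * (condMutualInfo P (univ : Finset (Fin q)) ∅ - ε) - 2 * Real.log 2 * q) ≤
      Real.log (Fintype.card (ChainMessage (mlcBits P Q ε q ℓ) N)) := by
  rw [log_card_chainMessage]
  gcongr
  refine le_trans (le_of_eq ?_) (sum_le_sum fun i _ => le_mlcBits_UV_mul_log i)
  rw [sum_sub_distrib, ← mul_sum, sum_sub_distrib, sum_univ_levelInfo hP, sum_const_div hq]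
  simp
  ring

lemma log_card_chainMessage_le (hP : ∀ a, P a ∈ stdSimplex ℝ Y) (hQ : ∀ a, Q a ∈ stdSimplex ℝ Z)
    (hε : 0 ≤ ε) (N : ℕ) :
    Real.log (Fintype.card (ChainMessage (mlcBits P Q ε q ℓ) N)) ≤
      (N + 1) * (ℓ * condMutualInfo P (univ : Finset (Fin q)) ∅) := by
  rw [log_card_chainMessage, ← sum_univ_levelInfo hP, mul_sum univ _ (ℓ : ℝ)]
  refine mul_le_mul_of_nonneg_left (sum_le_sum fun i _ => ?_) (by positivity)
  have h0 := levelInfo_nonneg hP i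
  -- Levels without message bits are treated apart, as `levelInfo P i - ε / q` may be negative
  -- there.
  rcases Nat.eq_zero_or_pos ((mlcBits P Q ε q ℓ).U i + (mlcBits P Q ε q ℓ).V i) with h | h
  · have h' : (((mlcBits P Q ε q ℓ).U i : ℝ) + (mlcBits P Q ε q ℓ).V i) = 0 := by exact_mod_cast h
    rw [h', zero_mul]
    positivity
  · refine (mlcBits_UV_mul_log_le hQ hε i h).trans ?_
    gcongr
    exact sub_le_self _ (by positivity)

/-- Secret bits are aggregated over the levels, so a surplus on one level pays for a deficit on
another: the positive part is taken of the total `I(X; Z̃) - I(X; Ỹ) + 2 ε`, not level by level. -/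
lemma log_card_sharedKey_le (hP : ∀ a, P a ∈ stdSimplex ℝ Y) (hQ : ∀ a, Q a ∈ stdSimplex ℝ Z)
    (hε : 0 ≤ ε) (hq : 0 < q) (N : ℕ) :
    Real.log (Fintype.card (SharedKey (mlcBits P Q ε q ℓ) N)) ≤
      ℓ * (condMutualInfo Q (univ : Finset (Fin q)) ∅ + 2 * ε) + Real.log 2 * q +
      N * (ℓ * max 0 (condMutualInfo Q (univ : Finset (Fin q)) ∅ -
        condMutualInfo P (univ : Finset (Fin q)) ∅ + 2 * ε) + 2 * Real.log 2 * q) := by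
  have hl : 0 < Real.log 2 := Real.log_pos one_lt_two
  rw [log_card_sharedKey]
  gcongr ?_ + N * ?_
  · refine (sum_le_sum fun i _ => mlcBits_K_mul_log_le hP hQ hε i).trans_eq ?_
    rw [sum_add_distrib, ← mul_sum, sum_add_distrib, ← mul_sum, sum_univ_levelInfo hQ,
      sum_const_div hq]
    simp
    ring
  · refine max_le (by positivity) ?_
    refine (sum_le_sum fun i _ => mlcBits_K_sub_V_mul_log_le i).trans ?_
    rw [sum_add_distrib, ← mul_sum, sum_add_distrib, sum_sub_distrib, ← mul_sum,
      sum_univ_levelInfo hQ, sum_univ_levelInfo hP, sum_const_div hq]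
    gcongr
    · exact le_max_right _ _
    · simp
      linarith

lemma le_log_card_sharedKey (hP : ∀ a, P a ∈ stdSimplex ℝ Y) (hQ : ∀ a, Q a ∈ stdSimplex ℝ Z)
    (hq : 0 < q) (N : ℕ) :
    N * (ℓ * max 0 (condMutualInfo Q (univ : Finset (Fin q)) ∅ -
        condMutualInfo P (univ : Finset (Fin q)) ∅ + 2 * ε)) ≤
      Real.log (Fintype.card (SharedKey (mlcBits P Q ε q ℓ) N)) := by
  have hl : 0 < Real.log 2 := Real.log_pos one_lt_two
  rw [log_card_sharedKey]
  refine le_trans ?_ (le_add_of_nonneg_left (sum_nonneg fun i _ => by positivity))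
  rw [mul_max_of_nonneg _ _ (Nat.cast_nonneg (α := ℝ) ℓ), mul_zero]
  gcongr
  refine le_trans (le_of_eq ?_) (sum_le_sum fun i _ => le_mlcBits_K_sub_V_mul_log i)
  rw [← mul_sum, sum_add_distrib, sum_sub_distrib, ← mul_sum,
    sum_univ_levelInfo hQ, sum_univ_levelInfo hP, sum_const_div hq]

/-- The normalization of the throughputs. -/
lemma tendsto_normalization (hδ : 0 < δ) (hχ : 0 < chiTwo (Q 1) (Q 0)) (N : ℕ) :
    Tendsto (fun q : ℕ => (N + 1) * (blockLength Q δ N q : ℝ) /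
      √((N + 1) * 2 ^ q * blockLength Q δ N q * δ)) atTop (𝓝 √(2 / chiTwo (Q 1) (Q 0))) := by
  -- The normalization is the square root of `(N + 1) ℓ / (2 ^ q δ)`.
  have h := ((tendsto_blockLength_div hδ.le hχ N).const_mul (((N : ℝ) + 1) / δ)).sqrt
  have e : ((N : ℝ) + 1) / δ * (2 * δ / ((N + 1) * chiTwo (Q 1) (Q 0))) =
      2 / chiTwo (Q 1) (Q 0) := by field_simp
  rw [e] at h
  refine h.congr' ?_
  filter_upwards [eventually_blockLength_pos hδ hχ N] with q hℓ
  have hℓ' : (0 : ℝ) < blockLength Q δ N q := by exact_mod_cast hℓ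
  have h1 : (N + 1) * (blockLength Q δ N q : ℝ) = √(((N + 1) * (blockLength Q δ N q : ℝ)) ^ 2) :=
    (Real.sqrt_sq (by positivity)).symm
  rw [h1, ← Real.sqrt_div (by positivity)]
  congr 1
  field_simp

/-- The root is of order `ℓ`, and `q / ℓ` tends to zero; rounding costs are therefore negligible. -/
lemma tendsto_remainder (hδ : 0 < δ) (hχ : 0 < chiTwo (Q 1) (Q 0)) (N : ℕ) (a : ℝ) :
    Tendsto (fun q : ℕ => a * q / √((N + 1) * 2 ^ q * blockLength Q δ N q * δ)) atTop (𝓝 0) := by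
  have h := ((tendsto_normalization hδ hχ N).mul
    (tendsto_pow_div_blockLength hδ hχ N 1)).const_mul (a / (N + 1))
  rw [mul_zero, mul_zero] at h
  refine h.congr' ?_
  filter_upwards [eventually_blockLength_pos hδ hχ N] with q hℓ
  have hℓ' : (0 : ℝ) < blockLength Q δ N q := by exact_mod_cast hℓ
  field_simp

variable (P Q δ ε) in
/-- The throughputs of the scheme lie between sequences with explicit limits. -/
lemma eventually_throughputs (hδ : 0 < δ) (hε : 0 < ε) (hP : ∀ a, P a ∈ stdSimplex ℝ Y)
    (hQ : ∀ a, Q a ∈ stdSimplex ℝ Z)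
    (hPac : ∀ y, P 0 y = 0 → P 1 y = 0) (hQac : ∀ z, Q 0 z = 0 → Q 1 z = 0)
    (hχ : 0 < chiTwo (Q 1) (Q 0)) (N : ℕ) {η : ℝ} (hη : 0 < η) :
    ∀ᶠ q : ℕ in atTop,
      (√(2 / chiTwo (Q 1) (Q 0)) * ((relEntropy (P 1) (P 0)).toReal - ε) - η ≤
          msgThroughput (mlcBits P Q ε q (blockLength Q δ N q)) δ N (blockLength Q δ N q) ∧
        msgThroughput (mlcBits P Q ε q (blockLength Q δ N q)) δ N (blockLength Q δ N q) ≤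
          √(2 / chiTwo (Q 1) (Q 0)) * (relEntropy (P 1) (P 0)).toReal + η) ∧
      √(2 / chiTwo (Q 1) (Q 0)) * (N / (N + 1) * max 0
          ((relEntropy (Q 1) (Q 0)).toReal - (relEntropy (P 1) (P 0)).toReal + 2 * ε)) - η ≤
        keyThroughput (mlcBits P Q ε q (blockLength Q δ N q)) δ N (blockLength Q δ N q) ∧
      keyThroughput (mlcBits P Q ε q (blockLength Q δ N q)) δ N (blockLength Q δ N q) ≤
        √(2 / chiTwo (Q 1) (Q 0)) *
          (N / (N + 1) * max 0
              ((relEntropy (Q 1) (Q 0)).toReal - (relEntropy (P 1) (P 0)).toReal + 2 * ε) +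
            ((relEntropy (Q 1) (Q 0)).toReal + 2 * ε) / (N + 1)) + η := by
  have hs := tendsto_normalization hδ hχ N
  have hIP := tendsto_condMutualInfo hP hPac
  have hIQ := tendsto_condMutualInfo hQ hQac
  have hmax := (tendsto_const_nhds (x := (0 : ℝ))).max ((hIQ.sub hIP).add_const (2 * ε))
  have l1 := (hs.mul (hIP.sub_const ε)).sub
    (tendsto_remainder hδ hχ N ((N + 1) * (2 * Real.log 2)))
  have l2 := hs.mul hIP
  have l3 := hs.mul (hmax.const_mul ((N : ℝ) / (N + 1)))
  have l4 := (hs.mul ((hmax.const_mul ((N : ℝ) / (N + 1))).add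
    ((hIQ.add_const (2 * ε)).div_const ((N : ℝ) + 1)))).add
    (tendsto_remainder hδ hχ N (Real.log 2 + N * (2 * Real.log 2)))
  rw [sub_zero] at l1
  rw [add_zero] at l4
  filter_upwards [l1.eventually_const_le (sub_lt_self _ hη),
    l2.eventually_le_const (lt_add_of_pos_right _ hη),
    l3.eventually_const_le (sub_lt_self _ hη),
    l4.eventually_le_const (lt_add_of_pos_right _ hη), eventually_gt_atTop 0] with q h1 h2 h3 h4 hq
  set ℓ := blockLength Q δ N q
  have hD : 0 ≤ √((N + 1) * 2 ^ q * ℓ * δ) := Real.sqrt_nonneg _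
  refine ⟨⟨h1.trans ?_, le_trans ?_ h2⟩, h3.trans ?_, le_trans ?_ h4⟩
  · refine le_trans (le_of_eq ?_) (div_le_div_of_nonneg_right
      (le_log_card_chainMessage (Q := Q) (ε := ε) (ℓ := ℓ) hP hq N) hD)
    ring
  · refine (div_le_div_of_nonneg_right
      (log_card_chainMessage_le (q := q) (ℓ := ℓ) hP hQ hε.le N) hD).trans_eq ?_
    ring
  · refine le_trans (le_of_eq ?_) (div_le_div_of_nonneg_right
      (le_log_card_sharedKey (ε := ε) (ℓ := ℓ) hP hQ hq N) hD)
    field_simp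
  · refine (div_le_div_of_nonneg_right
      (log_card_sharedKey_le (ℓ := ℓ) hP hQ hε.le hq N) hD).trans_eq ?_
    rw [div_mul_eq_mul_div, ← add_div]
    congr 1
    field_simp
    ring

end Main

end MLCPPM

end

/-! ### The coding theorem and its limit of small slack and many blocks -/

open MLCPPM Filter in
theorem mainTheorem4 {Y Z : Type*} [Fintype Y] [Fintype Z]
    (P : Fin 2 → Y → ℝ) (Q : Fin 2 → Z → ℝ)
    (hP : ∀ a, P a ∈ stdSimplex ℝ Y) (hQ : ∀ a, Q a ∈ stdSimplex ℝ Z)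
    (hPac : ∀ y, P 0 y = 0 → P 1 y = 0) (hQac : ∀ z, Q 0 z = 0 → Q 1 z = 0)
    (hQne : Q 1 ≠ Q 0) (δ : ℝ) (hδ : 0 < δ) :
    -- a fixed number `N + 1` of blocks and fixed slacks `0 < τ < ε / 2`
    (∀ ε τ : ℝ, 0 < τ → τ < ε / 2 → ∀ N : ℕ,
      -- reliability on average over the random codebook
      (∀ᶠ q : ℕ in atTop,
        codebookMean (b := mlcBits P Q ε q (blockLength Q δ N q)) (ℓ := blockLength Q δ N q)
            (fun c => errorProb P τ c N) ≤
          (N + 1) * 2 ^ q * (Real.exp (-(2 * blockLength Q δ N q * τ ^ 2 / q ^ 4)) +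
            (2 : ℝ) ^ (-(blockLength Q δ N q * τ / q)))) ∧
      -- a random codebook is reliable and covert with probability tending to one
      (∃ A : ℝ, ∀ η : ℝ, 0 < η → ∀ᶠ q : ℕ in atTop,
        1 - η ≤
          codebookProb (b := mlcBits P Q ε q (blockLength Q δ N q)) (ℓ := blockLength Q δ N q)
            (fun c => errorProb P τ c N ≤ η ∧
              relEntropy (outputLaw Q c N) (innocentLaw Q) ≤ ENNReal.ofReal (δ + A / 2 ^ q))) ∧
      -- message and key throughputs
      (∀ η : ℝ, 0 < η → ∀ᶠ q : ℕ in atTop,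
        √(2 / chiTwo (Q 1) (Q 0)) * ((relEntropy (P 1) (P 0)).toReal - ε) - η ≤
          msgThroughput (mlcBits P Q ε q (blockLength Q δ N q)) δ N (blockLength Q δ N q) ∧
        keyThroughput (mlcBits P Q ε q (blockLength Q δ N q)) δ N (blockLength Q δ N q) ≤
          √(2 / chiTwo (Q 1) (Q 0)) *
            (N / (N + 1) * max 0
                ((relEntropy (Q 1) (Q 0)).toReal - (relEntropy (P 1) (P 0)).toReal + 2 * ε) +
              ((relEntropy (Q 1) (Q 0)).toReal + 2 * ε) / (N + 1)) + η)) ∧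
    -- for small `ε` and many blocks, the throughputs approach the optimal ones
    (∀ ζ : ℝ, 0 < ζ → ∃ ε₀ : ℝ, 0 < ε₀ ∧ ∃ N₀ : ℕ, ∀ ε : ℝ, 0 < ε → ε ≤ ε₀ → ∀ N : ℕ, N₀ ≤ N →
      ∀ᶠ q : ℕ in atTop,
        |msgThroughput (mlcBits P Q ε q (blockLength Q δ N q)) δ N (blockLength Q δ N q) -
          √(2 / chiTwo (Q 1) (Q 0)) * (relEntropy (P 1) (P 0)).toReal| ≤ ζ ∧
        |keyThroughput (mlcBits P Q ε q (blockLength Q δ N q)) δ N (blockLength Q δ N q) -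
          √(2 / chiTwo (Q 1) (Q 0)) *
            max 0 ((relEntropy (Q 1) (Q 0)).toReal - (relEntropy (P 1) (P 0)).toReal)| ≤ ζ) := by
  have hχ := chiTwo_pos (hQ 0).1 hQac hQne
  refine ⟨fun ε τ hτ hτε N => ⟨eventually_codebookMean_le hP hQ hPac hτ hτε N,
    exists_eventually_le_codebookProb hδ hP hQ hPac hQac hχ hτ hτε N, fun η hη => ?_⟩,
    fun ζ hζ => ?_⟩
  · filter_upwards [eventually_throughputs P Q δ ε hδ (by linarith) hP hQ hPac hQac hχ N hη]
      with q h
    refine ⟨h.1.1, h.2.2.trans_eq ?_⟩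
    ring_nf
  · set κ := √(2 / chiTwo (Q 1) (Q 0))
    set d := (relEntropy (P 1) (P 0)).toReal
    set e := (relEntropy (Q 1) (Q 0)).toReal
    have hκ : 0 ≤ κ := Real.sqrt_nonneg _
    have hd : 0 ≤ d := ENNReal.toReal_nonneg
    have he : 0 ≤ e := ENNReal.toReal_nonneg
    -- `ε₀` bounds the rate loss `κ ε` by `ζ / 8` and keeps `2 ε ≤ 2`; `N₀` bounds the cost of the
    -- first key, at most `κ (e + 2) / (N + 1)`, by `ζ / 4`. The remaining `ζ / 2` is the slack of
    -- `eventually_throughputs`.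
    refine ⟨min 1 (ζ / (8 * (κ + 1))), lt_min one_pos (by positivity),
      ⌈4 * κ * (e + 2) / ζ⌉₊, fun ε hε hε₀ N hN => ?_⟩
    have hε1 : ε ≤ 1 := hε₀.trans (min_le_left _ _)
    have hε2 : κ * ε ≤ ζ / 8 := by
      have h := hε₀.trans (min_le_right _ _)
      rw [le_div_iff₀ (by positivity)] at h
      nlinarith
    have hN1 : κ * (e + 2) / (N + 1) ≤ ζ / 4 := by
      have h := (Nat.le_ceil _).trans (Nat.cast_le (α := ℝ).2 hN)
      rw [div_le_iff₀ hζ] at h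
      rw [div_le_iff₀ (by positivity)]
      linarith
    filter_upwards [eventually_throughputs P Q δ ε hδ hε hP hQ hPac hQac hχ N (half_pos hζ)]
      with q h
    obtain ⟨⟨h1, h2⟩, h3, h4⟩ := h
    have hN0 : (N : ℝ) / (N + 1) = 1 - 1 / (N + 1) := by field_simp; ring
    have hN2 : (0 : ℝ) ≤ N / (N + 1) := by positivity
    have hN3 : (N : ℝ) / (N + 1) ≤ 1 := by
      rw [div_le_one (by positivity)]
      linarith
    refine ⟨abs_le.2 ⟨?_, by linarith⟩, abs_le.2 ⟨?_, ?_⟩⟩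
    · rw [mul_sub] at h1
      linarith
    -- Losing the factor `N / (N + 1)` costs little, because `max 0 (e - d) ≤ e + 2`.
    · have hlow : κ * max 0 (e - d) - ζ / 4 ≤ κ * (N / (N + 1) * max 0 (e - d + 2 * ε)) := by
        calc κ * max 0 (e - d) - ζ / 4 ≤ κ * max 0 (e - d) - κ * (e + 2) / (N + 1) := by linarith
          _ ≤ κ * max 0 (e - d) - κ * max 0 (e - d) / (N + 1) := by
            gcongr
            exact max_le (by linarith) (by linarith)
          _ = κ * (N / (N + 1) * max 0 (e - d)) := by
            rw [hN0]
            ring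
          _ ≤ _ := by
            gcongr
            linarith
      linarith
    · have hup : κ * (N / (N + 1) * max 0 (e - d + 2 * ε) + (e + 2 * ε) / (N + 1)) ≤
          κ * max 0 (e - d) + ζ / 2 := by
        have hmax : max 0 (e - d + 2 * ε) ≤ max 0 (e - d) + 2 * ε :=
          max_le (by positivity) (by linarith [le_max_right 0 (e - d)])
        calc _ ≤ κ * (1 * (max 0 (e - d) + 2 * ε) + (e + 2 * 1) / (N + 1)) := by gcongr
          _ = κ * max 0 (e - d) + 2 * (κ * ε) + κ * (e + 2) / (N + 1) := by ring
          _ ≤ _ := by linarith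
      linarith
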